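/- For $n\ge 0$ let $R(n)$ be the Khovanov--Lauda--Rouquier algebra of the Jordan quiver on $n$ strands: the $\mathbb Z$-graded unital $\mathbb C$-algebra generated by $x_1,\dots,x_n$ of degree $2$ and $\tau_1,\dots,\tau_{n-1}$ of degree $0$, with relations $x_kx_l=x_lx_k$; $\tau_k^2=1$; $\tau_kx_k=x_{k+1}\tau_k$; $\tau_kx_{k+1}=x_k\tau_k$; $\tau_kx_l=x_l\tau_k$ for $l\ne k,k+1$; $\tau_k\tau_l=\tau_l\tau_k$ for $|k-l|>1$; $\tau_k\tau_{k+1}\tau_k=\tau_{k+1}\tau_k\tau_{k+1}$. Let $e_\ell=\frac1{\ell!}\sum_{w\in S_\ell}\tau_w\in R(\ell)$, where $\tau_w$ is the product of the $\tau_k$ along any expression of $w$ in adjacent transpositions. For $m,\ell\ge0$ let $1_m\otimes e_\ell\in R(m+\ell)$ be $e_\ell$ placed on the last $\ell$ strands, and let $R(m)\to R(m+\ell)$, $r\mapsto r\otimes 1_\ell$, be the map placing $r$ on the first $m$ strands. For an algebra $A$ as here let $A\text{-Mod}$ be the category of $\mathbb Z$-graded left $A$-modules and degree-preserving $A$-linear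 maps. Define $$\mathcal F_{\ell}\colon R(m)\text{-Mod}\to R(m+\ell)\text{-Mod},\quad M\mapsto R(m+\ell)(1_m\otimes e_\ell)\otimes_{R(m)}M,$$ $$\mathcal E_{\ell}\colon R(m+\ell)\text{-Mod}\to R(m)\text{-Mod},\quad M\mapsto(1_m\otimes e_\ell)M .$$ Let $Z_p$ be the graded algebra of symmetric polynomials over $\mathbb C$ in $p$ variables, each of degree $2$. Then for all $\ell,t\ge1$ and all $n,k\ge0$ with $k+\ell=n+t$ there is a natural isomorphism of functors $R(n)\text{-Mod}\to R(k)\text{-Mod}$ $$\mathcal E_{\ell}\,\mathcal F_{t}\;\simeq\;\bigoplus_{\substack{0\le p\le\min(\ell,t)\\ \ell-p\le n}}\mathcal F_{t-p}\,\mathcal E_{\ell-p}\otimes_{\mathbb C}Z_p ,$$ where $\otimes_{\mathbb C}Z_p$ is the graded tensor product with $R(k)$ acting on the first factor (the terms with $\ell-p>n$ are zero by convention). The analogous statement holds for the cyclotomic quotients. Let $a\ge1$, and let $R^\Lambda(n)$ be the quotient of $R(n)$ by the two-sided ideal generated by $x_1^a$ (with $R^\Lambda(0)=R(0)=\mathbb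 C$). Define $\mathcal F^\Lambda_\ell(M)=R^\Lambda(m+\ell)(1_m\otimes e_\ell)\otimes_{R^\Lambda(m)}M$ and $\mathcal E^\Lambda_\ell(M)=(1_m\otimes e_\ell)M$ in the same way, and let $Z^\Lambda_p=\big(\mathbb C[x_1,\dots,x_p]/(x_1^a,\dots,x_p^a)\big)^{S_p}$, with each $x_k$ of degree $2$. Then for all $\ell,t\ge1$ and all $n,k\ge0$ with $k+\ell=n+t$ there is a natural isomorphism of functors $R^\Lambda(n)\text{-Mod}\to R^\Lambda(k)\text{-Mod}$ $$\mathcal E^\Lambda_{\ell}\,\mathcal F^\Lambda_{t}\;\simeq\;\bigoplus_{\substack{0\le p\le\min(\ell,t)\\ \ell-p\le n}}\mathcal F^\Lambda_{t-p}\,\mathcal E^\Lambda_{\ell-p}\otimes_{\mathbb C}Z^\Lambda_p .$$ -/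

import Mathlib

open CategoryTheory TensorProduct

universe u v

noncomputable section

namespace JordanKLR

section GradedLinearAlgebra

variable {V U : Type*} [AddCommGroup V] [Module ℂ V] [AddCommGroup U] [Module ℂ U]

theorem isInternal_of_coaction (𝒱 : ℤ → Submodule ℂ V) (δ : V →ₗ[ℂ] (ℤ →₀ U)) (j : V →ₗ[ℂ] U)
    (hj : Function.Injective j) (h : ∀ d, ∀ v ∈ 𝒱 d, δ v = Finsupp.single d (j v))
    (hs : ∀ v, v ∈ ⨆ d, 𝒱 d) : DirectSum.IsInternal 𝒱 := by
  classical
  have key : ∀ (x : DirectSum ℤ fun d => 𝒱 d) (d : ℤ),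
      δ (DirectSum.coeLinearMap 𝒱 x) d = j (x d) := by
    intro x d
    induction x using DirectSum.induction_on with
    | zero => simp
    | of i y =>
      rw [DirectSum.coeLinearMap_of, h i _ y.2]
      by_cases hid : i = d
      · subst hid; simp
      · rw [Finsupp.single_eq_of_ne (Ne.symm hid), DirectSum.of_eq_of_ne _ _ _ (Ne.symm hid)]
        simp
    | add x y hx hy => simp [hx, hy]
  constructor
  · intro x y hxy
    have hxy' : DirectSum.coeLinearMap 𝒱 x = DirectSum.coeLinearMap 𝒱 y := hxy
    apply DFinsupp.ext
    intro d
    apply Subtype.ext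
    apply hj
    rw [← key, ← key, hxy']
  · intro v
    have := hs v
    rw [Submodule.iSup_eq_range_dfinsupp_lsum] at this
    exact this

/-- The map sending `v` to the finitely supported family of its homogeneous components. -/
def components {𝒱 : ℤ → Submodule ℂ V} (h : DirectSum.IsInternal 𝒱) : V →ₗ[ℂ] (ℤ →₀ V) := by
  classical
  exact (finsuppLequivDFinsupp ℂ).symm.toLinearMap ∘ₗ
    (DFinsupp.mapRange.linearMap fun d => (𝒱 d).subtype) ∘ₗ
      (LinearEquiv.ofBijective (DirectSum.coeLinearMap 𝒱) h).symm.toLinearMap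

theorem components_of_mem {𝒱 : ℤ → Submodule ℂ V} (h : DirectSum.IsInternal 𝒱) {d : ℤ} {v : V}
    (hv : v ∈ 𝒱 d) : components h v = Finsupp.single d v := by
  classical
  have : (LinearEquiv.ofBijective (DirectSum.coeLinearMap 𝒱) h).symm v
      = DirectSum.of (fun d => 𝒱 d) d ⟨v, hv⟩ := by
    rw [LinearEquiv.symm_apply_eq]
    exact (DirectSum.coeLinearMap_of 𝒱 d ⟨v, hv⟩).symm
  simp only [components, LinearMap.comp_apply, LinearEquiv.coe_coe, this]
  rw [LinearEquiv.symm_apply_eq]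
  ext i
  rw [finsuppLequivDFinsupp_apply_apply, Finsupp.toDFinsupp_single, DFinsupp.mapRange.linearMap_apply]
  change ((DirectSum.of (fun d => 𝒱 d) d ⟨v, hv⟩ i : 𝒱 i) : V) = _
  by_cases hid : d = i
  · subst hid; simp
  · rw [DirectSum.of_eq_of_ne _ _ _ (Ne.symm hid), DFinsupp.single_eq_of_ne (Ne.symm hid)]
    rfl

theorem homogeneous_induction {𝒱 : ℤ → Submodule ℂ V} (h : DirectSum.IsInternal 𝒱) {P : V → Prop}
    (hom : ∀ d, ∀ v ∈ 𝒱 d, P v) (add : ∀ v w, P v → P w → P (v + w)) (v : V) : P v := by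
  have hv : v ∈ ⨆ d, 𝒱 d := by rw [h.submodule_iSup_eq_top]; trivial
  induction hv using Submodule.iSup_induction' with
  | mem d v hv => exact hom d v hv
  | zero => exact hom 0 0 (zero_mem _)
  | add v w _ _ hv hw => exact add v w hv hw

theorem components_mem {𝒱 : ℤ → Submodule ℂ V} (h : DirectSum.IsInternal 𝒱) (v : V) (d : ℤ) :
    components h v d ∈ 𝒱 d := by
  classical
  induction v using homogeneous_induction h with
  | hom e v hv =>
    rw [components_of_mem h hv, Finsupp.single_apply]
    split_ifs with hed
    · exact hed ▸ hv
    · exact zero_mem _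
  | add v w hv hw => rw [map_add]; exact add_mem hv hw

theorem sum_components {𝒱 : ℤ → Submodule ℂ V} (h : DirectSum.IsInternal 𝒱) (v : V) :
    ((components h v).sum fun _ x => x) = v := by
  classical
  induction v using homogeneous_induction h with
  | hom e v hv => rw [components_of_mem h hv]; simp
  | add v w hv hw =>
    rw [map_add, Finsupp.sum_add_index' (by simp) (by simp), hv, hw]

/-- A map preserving degrees commutes with taking homogeneous components. -/
theorem components_map {𝒱 : ℤ → Submodule ℂ V} (h : DirectSum.IsInternal 𝒱)
    {𝒰 : ℤ → Submodule ℂ U} (h' : DirectSum.IsInternal 𝒰) (f : V →ₗ[ℂ] U)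
    (hf : ∀ d, ∀ v ∈ 𝒱 d, f v ∈ 𝒰 d) (v : V) (d : ℤ) :
    components h' (f v) d = f (components h v d) := by
  classical
  induction v using homogeneous_induction h with
  | hom e v hv =>
    rw [components_of_mem h hv, components_of_mem h' (hf e v hv), Finsupp.single_apply,
      Finsupp.single_apply]
    split_ifs <;> simp
  | add v w hv hw => simp [hv, hw]

/-- A subspace containing the components of its elements is graded. -/
theorem isInternal_sub {𝒱 : ℤ → Submodule ℂ V} (h : DirectSum.IsInternal 𝒱) (W : Submodule ℂ V)
    (hW : ∀ w ∈ W, ∀ d, components h w d ∈ W) :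
    DirectSum.IsInternal fun d => (𝒱 d).comap W.subtype := by
  refine isInternal_of_coaction _ (components h ∘ₗ W.subtype) W.subtype W.injective_subtype
    (fun d v hv => components_of_mem h hv) ?_
  intro w
  have hw : w = (components h w.1).sum fun d _ => ⟨components h w.1 d, hW _ w.2 d⟩ := by
    apply Subtype.ext
    conv_lhs => rw [← sum_components h w.1]
    simp [Finsupp.sum]
  rw [hw]
  refine Submodule.sum_mem _ fun d _ => ?_
  exact Submodule.mem_iSup_of_mem d (components_mem h _ d)

/-- The total grading of a tensor product. -/
def tensorDeg (𝒱 : ℤ → Submodule ℂ V) (𝒰 : ℤ → Submodule ℂ U) (d : ℤ) : Submodule ℂ (V ⊗[ℂ] U) :=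
  Submodule.span ℂ {z | ∃ a b, a + b = d ∧ ∃ x ∈ 𝒱 a, ∃ y ∈ 𝒰 b, x ⊗ₜ[ℂ] y = z}

def tensorComponents {𝒱 : ℤ → Submodule ℂ V} (h : DirectSum.IsInternal 𝒱)
    {𝒰 : ℤ → Submodule ℂ U} (h' : DirectSum.IsInternal 𝒰) :
    V ⊗[ℂ] U →ₗ[ℂ] (ℤ →₀ V ⊗[ℂ] U) :=
  Finsupp.lmapDomain _ ℂ (fun i : ℤ × ℤ => i.1 + i.2) ∘ₗ
    (finsuppTensorFinsupp ℂ ℂ V U ℤ ℤ).toLinearMap ∘ₗ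
      TensorProduct.map (components h) (components h')

theorem tensorComponents_tmul {𝒱 : ℤ → Submodule ℂ V} (h : DirectSum.IsInternal 𝒱)
    {𝒰 : ℤ → Submodule ℂ U} (h' : DirectSum.IsInternal 𝒰) {a b : ℤ} {x : V} {y : U}
    (hx : x ∈ 𝒱 a) (hy : y ∈ 𝒰 b) :
    tensorComponents h h' (x ⊗ₜ y) = Finsupp.single (a + b) (x ⊗ₜ y) := by
  simp [tensorComponents, components_of_mem h hx, components_of_mem h' hy,
    Finsupp.mapDomain_single]

theorem tensorComponents_of_mem {𝒱 : ℤ → Submodule ℂ V} (h : DirectSum.IsInternal 𝒱)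
    {𝒰 : ℤ → Submodule ℂ U} (h' : DirectSum.IsInternal 𝒰) {d : ℤ} {z : V ⊗[ℂ] U}
    (hz : z ∈ tensorDeg 𝒱 𝒰 d) : tensorComponents h h' z = Finsupp.single d z := by
  induction hz using Submodule.span_induction with
  | mem z hz =>
    obtain ⟨a, b, rfl, x, hx, y, hy, rfl⟩ := hz
    exact tensorComponents_tmul h h' hx hy
  | zero => simp
  | add x y _ _ hx hy => rw [map_add, hx, hy, Finsupp.single_add]
  | smul c x _ hx => rw [map_smul, hx, Finsupp.smul_single]

theorem mem_iSup_tensorDeg {𝒱 : ℤ → Submodule ℂ V} (h : DirectSum.IsInternal 𝒱)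
    {𝒰 : ℤ → Submodule ℂ U} (h' : DirectSum.IsInternal 𝒰) (z : V ⊗[ℂ] U) :
    z ∈ ⨆ d, tensorDeg 𝒱 𝒰 d := by
  induction z using TensorProduct.induction_on with
  | zero => exact zero_mem _
  | add x y hx hy => exact add_mem hx hy
  | tmul x y =>
    induction x using homogeneous_induction h with
    | add v w hv hw => rw [TensorProduct.add_tmul]; exact add_mem hv hw
    | hom a x hx =>
      induction y using homogeneous_induction h' with
      | add v w hv hw => rw [TensorProduct.tmul_add]; exact add_mem hv hw
      | hom b y hy =>
        exact Submodule.mem_iSup_of_mem (a + b)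
          (Submodule.subset_span ⟨a, b, rfl, x, hx, y, hy, rfl⟩)

theorem isInternal_tensorDeg {𝒱 : ℤ → Submodule ℂ V} (h : DirectSum.IsInternal 𝒱)
    {𝒰 : ℤ → Submodule ℂ U} (h' : DirectSum.IsInternal 𝒰) :
    DirectSum.IsInternal (tensorDeg 𝒱 𝒰) :=
  isInternal_of_coaction _ (tensorComponents h h') LinearMap.id Function.injective_id
    (fun _ _ hz => tensorComponents_of_mem h h' hz) (mem_iSup_tensorDeg h h')

/-- The componentwise grading of a finite product. -/
theorem isInternal_pi {J : Type*} [Fintype J] {W : J → Type*} [∀ j, AddCommGroup (W j)]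
    [∀ j, Module ℂ (W j)] (𝒲 : ∀ j, ℤ → Submodule ℂ (W j))
    (h : ∀ j, DirectSum.IsInternal (𝒲 j)) :
    DirectSum.IsInternal fun d => Submodule.pi Set.univ fun j => 𝒲 j d := by
  classical
  refine isInternal_of_coaction (U := ∀ j, W j) _
    (∑ j, Finsupp.mapRange.linearMap (LinearMap.single ℂ W j) ∘ₗ components (h j) ∘ₗ
      LinearMap.proj j) LinearMap.id Function.injective_id ?_ ?_
  · intro d v hv
    have : ∀ j, components (h j) (v j) = Finsupp.single d (v j) := fun j =>
      components_of_mem (h j) (hv j trivial)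
    simp only [LinearMap.sum_apply, LinearMap.comp_apply, LinearMap.proj_apply, this,
      Finsupp.mapRange.linearMap_apply, Finsupp.mapRange_single, LinearMap.id_apply]
    rw [← Finsupp.single_finsetSum]
    congr 1
    exact LinearMap.sum_single_apply W v
  · intro v
    have hv : v = ∑ j, LinearMap.single ℂ W j (v j) := (LinearMap.sum_single_apply W v).symm
    rw [hv]
    refine Submodule.sum_mem _ fun j _ => ?_
    have := homogeneous_induction (h j) (P := fun x => LinearMap.single ℂ W j x ∈
      ⨆ d, Submodule.pi Set.univ fun j => 𝒲 j d) ?_ ?_ (v j)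
    · exact this
    · intro d x hx
      refine Submodule.mem_iSup_of_mem d fun i _ => ?_
      by_cases hij : i = j
      · subst hij; simpa using hx
      · simp [Pi.single_eq_of_ne hij]
    · intro x y hx hy
      rw [map_add]; exact add_mem hx hy

/-- A quotient by a subspace to which taking components descends is graded. -/
theorem isInternal_map_of_surjective {𝒱 : ℤ → Submodule ℂ V} (hs : ∀ v, v ∈ ⨆ d, 𝒱 d)
    (π : V →ₗ[ℂ] U) (hπ : Function.Surjective π) (δ : V →ₗ[ℂ] (ℤ →₀ U))
    (hδ : LinearMap.ker π ≤ LinearMap.ker δ)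
    (h : ∀ d, ∀ v ∈ 𝒱 d, δ v = Finsupp.single d (π v)) :
    DirectSum.IsInternal fun d => (𝒱 d).map π := by
  refine isInternal_of_coaction _ ((LinearMap.ker π).liftQ δ hδ ∘ₗ
    (π.quotKerEquivOfSurjective hπ).symm.toLinearMap) LinearMap.id Function.injective_id ?_ ?_
  · rintro d _ ⟨v, hv, rfl⟩
    have : (π.quotKerEquivOfSurjective hπ).symm (π v) = (LinearMap.ker π).mkQ v := by
      rw [LinearEquiv.symm_apply_eq]; rfl
    rw [LinearMap.comp_apply, LinearEquiv.coe_coe, this, Submodule.mkQ_apply,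
      Submodule.liftQ_apply, h d v hv, LinearMap.id_apply]
  · intro x
    obtain ⟨v, rfl⟩ := hπ x
    rw [← Submodule.map_iSup]
    exact ⟨v, hs v, rfl⟩

end GradedLinearAlgebra

section GradedModules

variable {A : Type} [Ring A] [Algebra ℂ A]

/-- A `ℤ`-graded left module over the `ℂ`-algebra `A` with grading `𝒜`. -/
structure GrMod (𝒜 : ℤ → Submodule ℂ A) where
  carrier : Type u
  [addCommGroup : AddCommGroup carrier]
  [moduleC : Module ℂ carrier]
  [module : Module A carrier]
  [isScalarTower : IsScalarTower ℂ A carrier]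
  deg : ℤ → Submodule ℂ carrier
  isInternal : DirectSum.IsInternal deg
  smul_mem : ∀ {i j : ℤ} {r : A} {m : carrier}, r ∈ 𝒜 i → m ∈ deg j → r • m ∈ deg (i + j)

attribute [instance] GrMod.addCommGroup GrMod.moduleC GrMod.module GrMod.isScalarTower

variable {𝒜 : ℤ → Submodule ℂ A}

/-- Degree-preserving `A`-linear maps. -/
@[ext]
structure GrMod.Hom (M N : GrMod.{u} 𝒜) where
  toLin : M.carrier →ₗ[A] N.carrier
  map_deg : ∀ (d : ℤ) (m : M.carrier), m ∈ M.deg d → toLin m ∈ N.deg d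

instance : Category (GrMod.{u} 𝒜) where
  Hom M N := GrMod.Hom M N
  id M := ⟨LinearMap.id, fun _ _ h => h⟩
  comp f g := ⟨g.toLin ∘ₗ f.toLin, fun d _ h => g.map_deg d _ (f.map_deg d _ h)⟩

@[ext]
theorem GrMod.hom_ext {M N : GrMod.{u} 𝒜} {f g : M ⟶ N} (h : f.toLin = g.toLin) : f = g :=
  GrMod.Hom.ext h

@[simp]
theorem GrMod.id_toLin (M : GrMod.{u} 𝒜) : GrMod.Hom.toLin (𝟙 M) = LinearMap.id := rfl

@[simp]
theorem GrMod.comp_toLin {M N K : GrMod.{u} 𝒜} (f : M ⟶ N) (g : N ⟶ K) :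
    (f ≫ g).toLin = g.toLin ∘ₗ f.toLin := rfl

/-- A graded `ℂ`-vector space. -/
structure GrSpace where
  carrier : Type
  [addCommGroup : AddCommGroup carrier]
  [module : Module ℂ carrier]
  deg : ℤ → Submodule ℂ carrier
  isInternal : DirectSum.IsInternal deg

attribute [instance] GrSpace.addCommGroup GrSpace.module

/-- The functor `M ↦ M ⊗ Z` for a graded vector space `Z`; the algebra acts on `M`, and the
grading is the total one. -/
def tensorFunctor (𝒜 : ℤ → Submodule ℂ A) (Z : GrSpace) : GrMod.{u} 𝒜 ⥤ GrMod.{u} 𝒜 where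
  obj M :=
    { carrier := M.carrier ⊗[ℂ] Z.carrier
      deg := tensorDeg M.deg Z.deg
      isInternal := isInternal_tensorDeg M.isInternal Z.isInternal
      smul_mem := by
        intro i j r m hr hm
        induction hm using Submodule.span_induction with
        | mem z hz =>
          obtain ⟨a, b, rfl, x, hx, y, hy, rfl⟩ := hz
          rw [TensorProduct.smul_tmul']
          exact Submodule.subset_span
            ⟨i + a, b, by ring, _, M.smul_mem hr hx, y, hy, rfl⟩
        | zero => rw [smul_zero]; exact zero_mem _
        | add x y _ _ hx hy => rw [smul_add]; exact add_mem hx hy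
        | smul c x _ hx => rw [smul_comm]; exact Submodule.smul_mem _ c hx }
  map {M N} f :=
    { toLin := TensorProduct.AlgebraTensorModule.map f.toLin (LinearMap.id (R := ℂ))
      map_deg := by
        intro d m hm
        induction hm using Submodule.span_induction with
        | mem z hz =>
          obtain ⟨a, b, rfl, x, hx, y, hy, rfl⟩ := hz
          exact Submodule.subset_span ⟨a, b, rfl, _, f.map_deg a x hx, y, hy, rfl⟩
        | zero => rw [map_zero]; exact zero_mem _
        | add x y _ _ hx hy => rw [map_add]; exact add_mem hx hy
        | smul c x _ hx =>
          rw [LinearMap.map_smul_of_tower]; exact Submodule.smul_mem _ c hx }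
  map_id M := by
    apply GrMod.hom_ext
    exact TensorProduct.AlgebraTensorModule.map_id
  map_comp f g := by
    apply GrMod.hom_ext
    apply TensorProduct.AlgebraTensorModule.ext
    intro x y
    rfl

/-- The finite direct sum of a family of functors into graded modules. -/
def directSumFunctor {C : Type v} [Category.{u} C] {J : Type} [Fintype J]
    (G : J → (C ⥤ GrMod.{u} 𝒜)) : C ⥤ GrMod.{u} 𝒜 where
  obj X :=
    { carrier := ∀ j, ((G j).obj X).carrier
      deg := fun d => Submodule.pi Set.univ fun j => ((G j).obj X).deg d
      isInternal := isInternal_pi _ fun j => ((G j).obj X).isInternal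
      smul_mem := fun hr hm j hj => ((G j).obj X).smul_mem hr (hm j hj) }
  map f :=
    { toLin := LinearMap.pi fun j => ((G j).map f).toLin ∘ₗ LinearMap.proj j
      map_deg := fun d m hm j hj => ((G j).map f).map_deg d _ (hm j hj) }
  map_id X := by
    apply GrMod.hom_ext
    ext m j
    simp
  map_comp f g := by
    apply GrMod.hom_ext
    ext m j
    simp

end GradedModules

section Corner

variable {S R : Type} [Ring S] [Algebra ℂ S] [Ring R] [Algebra ℂ R]

/-- A degree-preserving algebra homomorphism `ι : S → R` and a degree zero element `e` of `R` that
commutes with its image. -/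
structure Corner (𝒮 : ℤ → Submodule ℂ S) (ℛ : ℤ → Submodule ℂ R) where
  ι : S →ₐ[ℂ] R
  e : R
  ι_mem : ∀ (d : ℤ) (s : S), s ∈ 𝒮 d → ι s ∈ ℛ d
  e_mem : e ∈ ℛ 0
  comm : ∀ s, ι s * e = e * ι s

variable {𝒮 : ℤ → Submodule ℂ S} {ℛ : ℤ → Submodule ℂ R}

namespace Corner

variable (c : Corner 𝒮 ℛ)

/-- The subspace `eM` of `M`. -/
def eSub (M : GrMod.{u} ℛ) : Submodule ℂ M.carrier :=
  LinearMap.range (Algebra.lsmul ℂ ℂ M.carrier c.e)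

theorem smul_mem_eSub (M : GrMod.{u} ℛ) (s : S) {m : M.carrier} (hm : m ∈ c.eSub M) :
    c.ι s • m ∈ c.eSub M := by
  obtain ⟨m, rfl⟩ := hm
  refine ⟨c.ι s • m, ?_⟩
  simp only [Algebra.lsmul_coe, smul_smul, c.comm]

/-- `S` acts on `eM` through `ι`. -/
abbrev eModule (M : GrMod.{u} ℛ) : Module S (c.eSub M) where
  smul s m := ⟨c.ι s • m.1, c.smul_mem_eSub M s m.2⟩
  one_smul m := Subtype.ext (by change c.ι 1 • m.1 = m.1; simp)
  mul_smul s t m := Subtype.ext (by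
    change c.ι (s * t) • m.1 = c.ι s • c.ι t • m.1; rw [map_mul, mul_smul])
  smul_zero s := Subtype.ext (by change c.ι s • (0 : M.carrier) = 0; simp)
  smul_add s m m' := Subtype.ext (by
    change c.ι s • (m.1 + m'.1) = c.ι s • m.1 + c.ι s • m'.1; rw [smul_add])
  add_smul s t m := Subtype.ext (by
    change c.ι (s + t) • m.1 = c.ι s • m.1 + c.ι t • m.1; rw [map_add, add_smul])
  zero_smul m := Subtype.ext (by change c.ι 0 • m.1 = 0; simp)

/-- The functor `M ↦ eM` from graded `R`-modules to graded `S`-modules. -/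
def resFunctor : GrMod.{u} ℛ ⥤ GrMod.{u} 𝒮 where
  obj M :=
    letI := c.eModule M
    { carrier := c.eSub M
      isScalarTower := ⟨fun z s m => Subtype.ext (by
        change c.ι (z • s) • m.1 = z • c.ι s • m.1
        rw [map_smul, smul_assoc])⟩
      deg := fun d => (M.deg d).comap (c.eSub M).subtype
      isInternal := isInternal_sub M.isInternal _ (by
        rintro _ ⟨m, rfl⟩ d
        rw [components_map M.isInternal M.isInternal]
        · exact ⟨_, rfl⟩
        · intro d v hv
          simpa using M.smul_mem c.e_mem hv)
      smul_mem := fun {i j r m} hr hm => M.smul_mem (c.ι_mem i r hr) hm }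
  map {M N} f :=
    letI := c.eModule M
    letI := c.eModule N
    { toLin :=
        { toFun := fun m => ⟨f.toLin m.1, by
            obtain ⟨_, m, rfl⟩ := m
            exact ⟨f.toLin m, by simp⟩⟩
          map_add' := fun m m' => Subtype.ext (map_add f.toLin m.1 m'.1)
          map_smul' := fun s m => Subtype.ext (map_smul f.toLin (c.ι s) m.1) }
      map_deg := fun d m hm => f.map_deg d m.1 hm }
  map_id M := rfl
  map_comp f g := rfl

/-- The left ideal `Re`. -/
def leftIdeal : Submodule R R := Submodule.span R {c.e}

/-- The right action of `S` on `Re` through `ι`. -/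
def rightMul (p : c.leftIdeal) (s : S) : c.leftIdeal :=
  ⟨p.1 * c.ι s, by
    obtain ⟨r, hr⟩ := Submodule.mem_span_singleton.1 p.2
    refine Submodule.mem_span_singleton.2 ⟨r * c.ι s, ?_⟩
    rw [← hr, smul_eq_mul, smul_eq_mul, mul_assoc, mul_assoc, c.comm]⟩

/-- The grading of `Re` by the grading of `R`. -/
def leftIdealDeg (d : ℤ) : Submodule ℂ c.leftIdeal :=
  (ℛ d).comap (c.leftIdeal.subtype.restrictScalars ℂ)

theorem isInternal_leftIdealDeg [GradedAlgebra ℛ] : DirectSum.IsInternal c.leftIdealDeg := by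
  refine isInternal_sub (DirectSum.Decomposition.isInternal ℛ)
    (c.leftIdeal.restrictScalars ℂ) ?_
  intro w hw d
  obtain ⟨r, rfl⟩ := Submodule.mem_span_singleton.1 hw
  have := components_map (DirectSum.Decomposition.isInternal ℛ)
    (DirectSum.Decomposition.isInternal ℛ) (LinearMap.mulRight ℂ c.e)
    (fun i v hv => by simpa using SetLike.mul_mem_graded hv c.e_mem) r d
  rw [LinearMap.mulRight_apply, LinearMap.mulRight_apply] at this
  rw [smul_eq_mul, this]
  exact Submodule.mem_span_singleton.2 ⟨_, rfl⟩

/-- The relations `ps ⊗ m = p ⊗ sm` imposed on `Re ⊗_ℂ M` to form `Re ⊗_S M`. -/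
def balancedSet (M : GrMod.{u} 𝒮) : Set (c.leftIdeal ⊗[ℂ] M.carrier) :=
  {z | ∃ (p : c.leftIdeal) (s : S) (m : M.carrier),
    z = c.rightMul p s ⊗ₜ[ℂ] m - p ⊗ₜ[ℂ] (s • m)}

def balanced (M : GrMod.{u} 𝒮) : Submodule R (c.leftIdeal ⊗[ℂ] M.carrier) :=
  Submodule.span R (c.balancedSet M)

theorem balanced_le (M : GrMod.{u} 𝒮) :
    (c.balanced M).restrictScalars ℂ ≤ Submodule.span ℂ (c.balancedSet M) := by
  intro z hz
  replace hz : z ∈ Submodule.span R (c.balancedSet M) := hz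
  induction hz using Submodule.span_induction with
  | mem z hz => exact Submodule.subset_span hz
  | zero => exact zero_mem _
  | add x y _ _ hx hy => exact add_mem hx hy
  | smul r x hx' hx =>
    clear hx'
    induction hx using Submodule.span_induction with
    | mem z hz =>
      obtain ⟨p, s, m, rfl⟩ := hz
      refine Submodule.subset_span ⟨r • p, s, m, ?_⟩
      rw [smul_sub, TensorProduct.smul_tmul', TensorProduct.smul_tmul']
      congr 2
      exact Subtype.ext (mul_assoc r p.1 (c.ι s)).symm
    | zero => rw [smul_zero]; exact zero_mem _
    | add x y _ _ hx hy => rw [smul_add]; exact add_mem hx hy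
    | smul a x _ hx => rw [smul_comm]; exact Submodule.smul_mem _ a hx

/-- The `R`-module `Re ⊗_S M`. -/
abbrev Ind (M : GrMod.{u} 𝒮) : Type u := (c.leftIdeal ⊗[ℂ] M.carrier) ⧸ c.balanced M

/-- The projection `Re ⊗_ℂ M → Re ⊗_S M`. -/
def indMk (M : GrMod.{u} 𝒮) : c.leftIdeal ⊗[ℂ] M.carrier →ₗ[R] c.Ind M := (c.balanced M).mkQ

/-- The grading of `Re ⊗_S M`: the image of the total grading of `Re ⊗_ℂ M`. -/
def indDeg (M : GrMod.{u} 𝒮) (d : ℤ) : Submodule ℂ (c.Ind M) :=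
  (tensorDeg c.leftIdealDeg M.deg d).map ((c.indMk M).restrictScalars ℂ)

theorem indMk_rightMul (M : GrMod.{u} 𝒮) (p : c.leftIdeal) (s : S) (m : M.carrier) :
    c.indMk M (c.rightMul p s ⊗ₜ[ℂ] m) = c.indMk M (p ⊗ₜ[ℂ] (s • m)) :=
  (Submodule.Quotient.eq _).2 (Submodule.subset_span ⟨p, s, m, rfl⟩)

/-- The components of an element of `Re ⊗_ℂ M`, projected to `Re ⊗_S M`. -/
def preIndComponents [GradedAlgebra ℛ] (M : GrMod.{u} 𝒮) :
    c.leftIdeal ⊗[ℂ] M.carrier →ₗ[ℂ] (ℤ →₀ c.Ind M) :=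
  Finsupp.mapRange.linearMap ((c.indMk M).restrictScalars ℂ) ∘ₗ
    tensorComponents c.isInternal_leftIdealDeg M.isInternal

theorem preIndComponents_of_mem [GradedAlgebra ℛ] (M : GrMod.{u} 𝒮) {d : ℤ}
    {z : c.leftIdeal ⊗[ℂ] M.carrier} (hz : z ∈ tensorDeg c.leftIdealDeg M.deg d) :
    c.preIndComponents M z = Finsupp.single d (c.indMk M z) := by
  rw [preIndComponents, LinearMap.comp_apply,
    tensorComponents_of_mem c.isInternal_leftIdealDeg M.isInternal hz,
    Finsupp.mapRange.linearMap_apply, Finsupp.mapRange_single]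
  rfl

theorem preIndComponents_rel [GradedAlgebra 𝒮] [GradedAlgebra ℛ] (M : GrMod.{u} 𝒮)
    (p : c.leftIdeal) (s : S) (m : M.carrier) :
    c.preIndComponents M (c.rightMul p s ⊗ₜ[ℂ] m) = c.preIndComponents M (p ⊗ₜ[ℂ] (s • m)) := by
  induction p using homogeneous_induction c.isInternal_leftIdealDeg with
  | add v w hv hw =>
    have : c.rightMul (v + w) s = c.rightMul v s + c.rightMul w s :=
      Subtype.ext (add_mul v.1 w.1 _)
    rw [this, TensorProduct.add_tmul, TensorProduct.add_tmul, map_add, map_add, hv, hw]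
  | hom a p hp =>
    induction s using homogeneous_induction (DirectSum.Decomposition.isInternal 𝒮) with
    | add v w hv hw =>
      have : c.rightMul p (v + w) = c.rightMul p v + c.rightMul p w :=
        Subtype.ext (by simp [rightMul, mul_add])
      rw [this, TensorProduct.add_tmul, add_smul, TensorProduct.tmul_add, map_add, map_add,
        hv, hw]
    | hom b s hs =>
      induction m using homogeneous_induction M.isInternal with
      | add v w hv hw =>
        rw [smul_add, TensorProduct.tmul_add, TensorProduct.tmul_add, map_add, map_add, hv, hw]
      | hom d m hm =>
        have h1 : c.rightMul p s ∈ c.leftIdealDeg (a + b) :=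
          SetLike.mul_mem_graded (A := ℛ) hp (c.ι_mem b s hs)
        have h2 := M.smul_mem hs hm
        have h3 : c.rightMul p s ⊗ₜ[ℂ] m ∈ tensorDeg c.leftIdealDeg M.deg (a + b + d) :=
          Submodule.subset_span ⟨a + b, d, rfl, _, h1, _, hm, rfl⟩
        have h4 : p ⊗ₜ[ℂ] (s • m) ∈ tensorDeg c.leftIdealDeg M.deg (a + b + d) :=
          Submodule.subset_span ⟨a, b + d, (add_assoc a b d).symm, _, hp, _, h2, rfl⟩
        rw [c.preIndComponents_of_mem M h3, c.preIndComponents_of_mem M h4, c.indMk_rightMul]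

theorem preIndComponents_balanced [GradedAlgebra 𝒮] [GradedAlgebra ℛ] (M : GrMod.{u} 𝒮) :
    (c.balanced M).restrictScalars ℂ ≤ LinearMap.ker (c.preIndComponents M) := by
  refine (c.balanced_le M).trans (Submodule.span_le.2 ?_)
  rintro _ ⟨p, s, m, rfl⟩
  rw [SetLike.mem_coe, LinearMap.mem_ker, map_sub, preIndComponents_rel, sub_self]

theorem indMk_surjective (M : GrMod.{u} 𝒮) : Function.Surjective (c.indMk M) :=
  Submodule.mkQ_surjective _

theorem indMk_eq_zero (M : GrMod.{u} 𝒮) {z : c.leftIdeal ⊗[ℂ] M.carrier}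
    (hz : c.indMk M z = 0) : z ∈ c.balanced M :=
  (Submodule.Quotient.mk_eq_zero (c.balanced M)).1 hz

theorem isInternal_indDeg [GradedAlgebra 𝒮] [GradedAlgebra ℛ] (M : GrMod.{u} 𝒮) :
    DirectSum.IsInternal (c.indDeg M) := by
  have h1 : LinearMap.ker ((c.indMk M).restrictScalars ℂ) ≤
      LinearMap.ker (c.preIndComponents M) := by
    intro z hz
    rw [LinearMap.mem_ker, LinearMap.restrictScalars_apply] at hz
    exact c.preIndComponents_balanced M (c.indMk_eq_zero M hz)
  have h2 : Function.Surjective ((c.indMk M).restrictScalars ℂ) := by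
    intro z
    obtain ⟨y, hy⟩ := c.indMk_surjective M z
    exact ⟨y, by rw [LinearMap.restrictScalars_apply]; exact hy⟩
  have h3 : ∀ d, ∀ v ∈ tensorDeg c.leftIdealDeg M.deg d, c.preIndComponents M v =
      Finsupp.single d ((c.indMk M).restrictScalars ℂ v) := by
    intro d v hv
    rw [LinearMap.restrictScalars_apply]
    exact c.preIndComponents_of_mem M hv
  have h4 := mem_iSup_tensorDeg c.isInternal_leftIdealDeg M.isInternal
  exact isInternal_map_of_surjective h4 _ h2 _ h1 h3

/-- The functor `M ↦ Re ⊗_S M` from graded `S`-modules to graded `R`-modules. -/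
def indFunctor [GradedAlgebra 𝒮] [GradedAlgebra ℛ] : GrMod.{u} 𝒮 ⥤ GrMod.{u} ℛ where
  obj M :=
    { carrier := c.Ind M
      deg := c.indDeg M
      isInternal := c.isInternal_indDeg M
      smul_mem := by
        rintro i j r _ hr ⟨m, hm, rfl⟩
        change r • c.indMk M m ∈ _
        rw [← map_smul]
        refine Submodule.mem_map_of_mem (f := (c.indMk M).restrictScalars ℂ) ?_
        induction hm using Submodule.span_induction with
        | mem z hz =>
          obtain ⟨a, b, rfl, x, hx, y, hy, rfl⟩ := hz
          rw [TensorProduct.smul_tmul']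
          exact Submodule.subset_span
            ⟨i + a, b, by ring, _, SetLike.mul_mem_graded (A := ℛ) hr hx, y, hy, rfl⟩
        | zero => rw [smul_zero]; exact zero_mem _
        | add x y _ _ hx hy => rw [smul_add]; exact add_mem hx hy
        | smul c x _ hx => rw [smul_comm]; exact Submodule.smul_mem _ c hx }
  map {M N} f :=
    { toLin := (c.balanced M).mapQ (c.balanced N)
        (TensorProduct.AlgebraTensorModule.map (LinearMap.id (R := R)) (f.toLin.restrictScalars ℂ))
        (by
          refine Submodule.span_le.2 ?_
          rintro _ ⟨p, s, m, rfl⟩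
          refine Submodule.subset_span ⟨p, s, f.toLin m, ?_⟩
          simp)
      map_deg := by
        rintro d _ ⟨m, hm, rfl⟩
        change c.indMk N (TensorProduct.AlgebraTensorModule.map (LinearMap.id (R := R))
          (f.toLin.restrictScalars ℂ) m) ∈ _
        refine Submodule.mem_map_of_mem (f := (c.indMk N).restrictScalars ℂ) ?_
        induction hm using Submodule.span_induction with
        | mem z hz =>
          obtain ⟨a, b, rfl, x, hx, y, hy, rfl⟩ := hz
          exact Submodule.subset_span ⟨a, b, rfl, x, hx, _, f.map_deg b y hy, rfl⟩
        | zero => rw [map_zero]; exact zero_mem _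
        | add x y _ _ hx hy => rw [map_add]; exact add_mem hx hy
        | smul c x _ hx =>
          rw [LinearMap.map_smul_of_tower]; exact Submodule.smul_mem _ c hx }
  map_id M := by
    apply GrMod.hom_ext
    apply Submodule.linearMap_qext
    apply TensorProduct.AlgebraTensorModule.ext
    intro x y
    rfl
  map_comp f g := by
    apply GrMod.hom_ext
    apply Submodule.linearMap_qext
    apply TensorProduct.AlgebraTensorModule.ext
    intro x y
    rfl

end Corner

end Corner

section Words

variable {B : Type} [Ring B] [Algebra ℂ B] {G : Type}

/-- The degree `d` part for generators `g i` of degree `w i`: the span of all words in the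
generators whose total degree is `d`. -/
def wordDeg (g : G → B) (w : G → ℤ) (d : ℤ) : Submodule ℂ B :=
  Submodule.span ℂ {b | ∃ l : List G, (l.map w).sum = d ∧ (l.map g).prod = b}

theorem word_mem (g : G → B) (w : G → ℤ) (l : List G) :
    (l.map g).prod ∈ wordDeg g w (l.map w).sum :=
  Submodule.subset_span ⟨l, rfl, rfl⟩

instance wordDeg_gradedMonoid (g : G → B) (w : G → ℤ) : SetLike.GradedMonoid (wordDeg g w) where
  one_mem := by simpa using word_mem g w []
  mul_mem := by
    intro i j x y hx hy
    have h := Submodule.mul_mem_mul hx hy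
    rw [wordDeg, wordDeg, Submodule.span_mul_span] at h
    refine Submodule.span_mono ?_ h
    rintro _ ⟨_, ⟨l, rfl, rfl⟩, _, ⟨l', rfl, rfl⟩, rfl⟩
    exact ⟨l ++ l', by simp, by simp⟩

theorem mem_iSup_wordDeg (g : G → B) (w : G → ℤ) (hg : Algebra.adjoin ℂ (Set.range g) = ⊤) (b : B) :
    b ∈ ⨆ d, wordDeg g w d := by
  have hb : b ∈ Subalgebra.toSubmodule (Algebra.adjoin ℂ (Set.range g)) := by rw [hg]; trivial
  rw [Algebra.adjoin_eq_span] at hb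
  refine Submodule.span_le.2 ?_ hb
  intro c hc
  obtain ⟨l, rfl⟩ : ∃ l : List G, (l.map g).prod = c := by
    induction hc using Submonoid.closure_induction with
    | mem c hc => obtain ⟨i, rfl⟩ := hc; exact ⟨[i], by simp⟩
    | one => exact ⟨[], rfl⟩
    | mul c d _ _ hc hd =>
      obtain ⟨l, rfl⟩ := hc
      obtain ⟨l', rfl⟩ := hd
      exact ⟨l ++ l', by simp⟩
  exact Submodule.mem_iSup_of_mem _ (word_mem g w l)

theorem wordDeg_coaction (g : G → B) (w : G → ℤ) (φ : B →ₐ[ℂ] AddMonoidAlgebra B ℤ)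
    (hφ : ∀ i, φ (g i) = AddMonoidAlgebra.single (w i) (g i)) (d : ℤ) {b : B}
    (hb : b ∈ wordDeg g w d) : φ b = AddMonoidAlgebra.single d b := by
  induction hb using Submodule.span_induction with
  | mem b hb =>
    obtain ⟨l, rfl, rfl⟩ := hb
    induction l with
    | nil => exact map_one φ
    | cons i l ih =>
      simp only [List.map_cons, List.prod_cons, List.sum_cons, map_mul, hφ, ih,
        AddMonoidAlgebra.single_mul_single]
  | zero => simp
  | add x y _ _ hx hy => rw [map_add, hx, hy, AddMonoidAlgebra.single_add]
  | smul c x _ hx => rw [map_smul, hx, AddMonoidAlgebra.smul_single]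

theorem isInternal_wordDeg (g : G → B) (w : G → ℤ) (hg : Algebra.adjoin ℂ (Set.range g) = ⊤)
    (φ : B →ₐ[ℂ] AddMonoidAlgebra B ℤ)
    (hφ : ∀ i, φ (g i) = AddMonoidAlgebra.single (w i) (g i)) :
    DirectSum.IsInternal (wordDeg g w) := by
  refine isInternal_of_coaction _
    ((AddMonoidAlgebra.coeffLinearEquiv ℂ).toLinearMap ∘ₗ φ.toLinearMap) LinearMap.id
    Function.injective_id ?_ (mem_iSup_wordDeg g w hg)
  intro d b hb
  simp only [LinearMap.comp_apply, AlgHom.toLinearMap_apply, wordDeg_coaction g w φ hφ d hb]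
  rfl

/-- An algebra homomorphism sending generators to elements of the same degree preserves degrees. -/
theorem map_wordDeg {B' : Type} [Ring B'] [Algebra ℂ B'] {G' : Type} (g : G → B) (w : G → ℤ)
    (g' : G' → B') (w' : G' → ℤ) (f : B →ₐ[ℂ] B')
    (hf : ∀ i, f (g i) ∈ wordDeg g' w' (w i)) (d : ℤ) (b : B) (hb : b ∈ wordDeg g w d) :
    f b ∈ wordDeg g' w' d := by
  induction hb using Submodule.span_induction with
  | mem b hb =>
    obtain ⟨l, rfl, rfl⟩ := hb
    induction l with
    | nil => simpa using word_mem g' w' []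
    | cons i l ih =>
      simp only [List.map_cons, List.prod_cons, List.sum_cons, map_mul]
      exact SetLike.mul_mem_graded (A := wordDeg g' w') (hf i) ih
  | zero => rw [map_zero]; exact zero_mem _
  | add x y _ _ hx hy => rw [map_add]; exact add_mem hx hy
  | smul c x _ hx => rw [map_smul]; exact Submodule.smul_mem _ c hx

theorem commute_of_generators {A A' : Type} [Ring A] [Algebra ℂ A] [Ring A'] [Algebra ℂ A']
    {G' : Type} (g : G → A) (g' : G' → A') (hg : Algebra.adjoin ℂ (Set.range g) = ⊤)
    (hg' : Algebra.adjoin ℂ (Set.range g') = ⊤) (f : A →ₐ[ℂ] B) (f' : A' →ₐ[ℂ] B)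
    (h : ∀ i j, Commute (f (g i)) (f' (g' j))) (a : A) (a' : A') : Commute (f a) (f' a') := by
  have ha : a ∈ Algebra.adjoin ℂ (Set.range g) := by rw [hg]; trivial
  have ha' : a' ∈ Algebra.adjoin ℂ (Set.range g') := by rw [hg']; trivial
  induction ha using Algebra.adjoin_induction with
  | algebraMap r => rw [AlgHom.commutes]; exact Algebra.commute_algebraMap_left r _
  | add x y _ _ hx hy => rw [map_add]; exact hx.add_left hy
  | mul x y _ _ hx hy => rw [map_mul]; exact hx.mul_left hy
  | mem x hx =>
    obtain ⟨i, rfl⟩ := hx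
    induction ha' using Algebra.adjoin_induction with
    | algebraMap r => rw [AlgHom.commutes]; exact Algebra.commute_algebraMap_right r _
    | add x y _ _ hx hy => rw [map_add]; exact hx.add_right hy
    | mul x y _ _ hx hy => rw [map_mul]; exact hx.mul_right hy
    | mem x hx => obtain ⟨j, rfl⟩ := hx; exact h i j

end Words

section KLR

/-- Positions of crossings on `n` strands: `k` stands for the crossing of the (0-based) strands
`k` and `k + 1`. -/
abbrev Cross (n : ℕ) : Type := {k : ℕ // k + 1 < n}

/-- The strand `k`. -/
abbrev Cross.left {n : ℕ} (k : Cross n) : Fin n := ⟨k.1, (Nat.lt_succ_self _).trans k.2⟩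

/-- The strand `k + 1`. -/
abbrev Cross.right {n : ℕ} (k : Cross n) : Fin n := ⟨k.1 + 1, k.2⟩

/-- The local relations of the Khovanov-Lauda-Rouquier algebra on `n` strands for the Jordan quiver,
imposed on dots `X` and crossings `T` in a ring. -/
inductive KLRRel {n : ℕ} {B : Type} [Ring B] (X : Fin n → B) (T : Cross n → B) : B → B → Prop
  | dot_dot (k l : Fin n) : KLRRel X T (X k * X l) (X l * X k)
  | cross_sq (k : Cross n) : KLRRel X T (T k * T k) 1
  | cross_dot_left (k : Cross n) : KLRRel X T (T k * X k.left) (X k.right * T k)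
  | cross_dot_right (k : Cross n) : KLRRel X T (T k * X k.right) (X k.left * T k)
  | cross_dot_far (k : Cross n) (l : Fin n) (h : l ≠ k.left) (h' : l ≠ k.right) :
      KLRRel X T (T k * X l) (X l * T k)
  | cross_cross_far (k l : Cross n) (h : k.1 + 1 < l.1) : KLRRel X T (T k * T l) (T l * T k)
  | braid (k l : Cross n) (h : k.1 + 1 = l.1) : KLRRel X T (T k * T l * T k) (T l * T k * T l)

/-- The algebra `R(n)` of the Jordan quiver, by generators and relations. -/
def KLR (n : ℕ) : Type :=
  RingQuot (KLRRel (n := n) (fun k => FreeAlgebra.ι ℂ (Sum.inl k : Fin n ⊕ Cross n))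
    (fun k => FreeAlgebra.ι ℂ (Sum.inr k)))

namespace KLR

instance (n : ℕ) : Ring (KLR n) := inferInstanceAs (Ring (RingQuot _))

instance (n : ℕ) : Algebra ℂ (KLR n) := inferInstanceAs (Algebra ℂ (RingQuot _))

/-- The projection from the free algebra to `R(n)`. -/
def mk (n : ℕ) : FreeAlgebra ℂ (Fin n ⊕ Cross n) →ₐ[ℂ] KLR n := RingQuot.mkAlgHom ℂ _

theorem mk_surjective (n : ℕ) : Function.Surjective (mk n) := RingQuot.mkAlgHom_surjective ℂ _

/-- The dot on strand `k`. -/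
def x {n : ℕ} (k : Fin n) : KLR n := mk n (FreeAlgebra.ι ℂ (Sum.inl k))

/-- The crossing at `k`. -/
def t {n : ℕ} (k : Cross n) : KLR n := mk n (FreeAlgebra.ι ℂ (Sum.inr k))

theorem _root_.JordanKLR.KLRRel.map {n : ℕ} {B B' : Type} [Ring B] [Ring B'] (f : B →+* B')
    {X : Fin n → B} {T : Cross n → B} {a b : B} (h : KLRRel X T a b) :
    KLRRel (fun k => f (X k)) (fun k => f (T k)) (f a) (f b) := by
  cases h with
  | dot_dot k l => rw [map_mul, map_mul]; exact .dot_dot k l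
  | cross_sq k => rw [map_mul, map_one]; exact .cross_sq k
  | cross_dot_left k => rw [map_mul, map_mul]; exact .cross_dot_left k
  | cross_dot_right k => rw [map_mul, map_mul]; exact .cross_dot_right k
  | cross_dot_far k l h h' => rw [map_mul, map_mul]; exact .cross_dot_far k l h h'
  | cross_cross_far k l h => rw [map_mul, map_mul]; exact .cross_cross_far k l h
  | braid k l h => simp only [map_mul]; exact .braid k l h

theorem rel {n : ℕ} {a b : KLR n} (h : KLRRel (x (n := n)) t a b) : a = b := by
  have key : ∀ {a b}, KLRRel (n := n) (fun k => FreeAlgebra.ι ℂ (Sum.inl k : Fin n ⊕ Cross n))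
      (fun k => FreeAlgebra.ι ℂ (Sum.inr k)) a b →
      mk n a = mk n b := fun h => RingQuot.mkAlgHom_rel ℂ h
  cases h with
  | dot_dot k l => simpa only [map_mul, x, t] using key (.dot_dot k l)
  | cross_sq k => simpa only [map_mul, map_one, x, t] using key (.cross_sq k)
  | cross_dot_left k => simpa only [map_mul, x, t] using key (.cross_dot_left k)
  | cross_dot_right k => simpa only [map_mul, x, t] using key (.cross_dot_right k)
  | cross_dot_far k l h h' => simpa only [map_mul, x, t] using key (.cross_dot_far k l h h')
  | cross_cross_far k l h => simpa only [map_mul, x, t] using key (.cross_cross_far k l h)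
  | braid k l h => simpa only [map_mul, x, t] using key (.braid k l h)

/-- The homomorphism out of `R(n)` given by elements satisfying the local relations. -/
def lift {n : ℕ} {B : Type} [Ring B] [Algebra ℂ B] (X : Fin n → B) (T : Cross n → B)
    (h : ∀ a b, KLRRel X T a b → a = b) : KLR n →ₐ[ℂ] B :=
  RingQuot.liftAlgHom ℂ ⟨FreeAlgebra.lift ℂ (Sum.elim X T), fun a b hab => h _ _ (by
    simpa using hab.map (FreeAlgebra.lift ℂ (Sum.elim X T) :
      FreeAlgebra ℂ (Fin n ⊕ Cross n) →ₐ[ℂ] B).toRingHom)⟩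

@[simp]
theorem lift_x {n : ℕ} {B : Type} [Ring B] [Algebra ℂ B] (X : Fin n → B) (T : Cross n → B)
    (h : ∀ a b, KLRRel X T a b → a = b) (k : Fin n) : lift X T h (x k) = X k :=
  (RingQuot.liftAlgHom_mkAlgHom_apply ℂ _ _ _).trans (by simp)

@[simp]
theorem lift_t {n : ℕ} {B : Type} [Ring B] [Algebra ℂ B] (X : Fin n → B) (T : Cross n → B)
    (h : ∀ a b, KLRRel X T a b → a = b) (k : Cross n) : lift X T h (t k) = T k :=
  (RingQuot.liftAlgHom_mkAlgHom_apply ℂ _ _ _).trans (by simp)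

/-- The generators of `R(n)`. -/
def gen (n : ℕ) : Fin n ⊕ Cross n → KLR n := Sum.elim x t

/-- The degrees of the generators: dots have degree `2` and crossings have degree `0`. -/
def genDeg (n : ℕ) : Fin n ⊕ Cross n → ℤ := Sum.elim (fun _ => 2) (fun _ => 0)

/-- The grading of `R(n)`. -/
def deg (n : ℕ) : ℤ → Submodule ℂ (KLR n) := wordDeg (gen n) (genDeg n)

theorem adjoin_gen (n : ℕ) : Algebra.adjoin ℂ (Set.range (gen n)) = ⊤ := by
  have h : gen n = mk n ∘ FreeAlgebra.ι ℂ := by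
    funext i; cases i <;> rfl
  rw [h, Set.range_comp, ← AlgHom.map_adjoin, FreeAlgebra.adjoin_range_ι, Algebra.map_top,
    AlgHom.range_eq_top]
  exact mk_surjective n

theorem rel_single {n : ℕ} {B : Type} [Ring B] [Algebra ℂ B] {X : Fin n → B} {T : Cross n → B}
    (h : ∀ a b, KLRRel X T a b → a = b) (a b : AddMonoidAlgebra B ℤ)
    (hab : KLRRel (fun k => AddMonoidAlgebra.single 2 (X k))
      (fun k => AddMonoidAlgebra.single 0 (T k)) a b) : a = b := by
  have key : ∀ (d : ℤ) {c c' : B}, KLRRel X T c c' →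
      AddMonoidAlgebra.single d c = AddMonoidAlgebra.single d c' :=
    fun d _ _ hc => congrArg _ (h _ _ hc)
  cases hab with
  | dot_dot k l => simpa only [AddMonoidAlgebra.single_mul_single] using key _ (.dot_dot k l)
  | cross_sq k =>
    simpa only [AddMonoidAlgebra.single_mul_single, AddMonoidAlgebra.one_def, add_zero] using
      key 0 (.cross_sq k)
  | cross_dot_left k =>
    simpa only [AddMonoidAlgebra.single_mul_single, add_zero, zero_add] using
      key 2 (.cross_dot_left k)
  | cross_dot_right k =>
    simpa only [AddMonoidAlgebra.single_mul_single, add_zero, zero_add] using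
      key 2 (.cross_dot_right k)
  | cross_dot_far k l hl hr =>
    simpa only [AddMonoidAlgebra.single_mul_single, add_zero, zero_add] using
      key 2 (.cross_dot_far k l hl hr)
  | cross_cross_far k l hl =>
    simpa only [AddMonoidAlgebra.single_mul_single, add_zero] using key 0 (.cross_cross_far k l hl)
  | braid k l hl =>
    simpa only [AddMonoidAlgebra.single_mul_single, add_zero] using key 0 (.braid k l hl)

theorem isInternal_deg (n : ℕ) : DirectSum.IsInternal (deg n) :=
  isInternal_wordDeg _ _ (adjoin_gen n)
    (lift _ _ (rel_single (X := x) (T := t) fun _ _ h => rel h))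
    (by rintro (k | k) <;> simp [gen, genDeg])

instance (n : ℕ) : GradedAlgebra (deg n) where
  toGradedMonoid := wordDeg_gradedMonoid _ _
  toDecomposition := (isInternal_deg n).chooseDecomposition

theorem rel_shift {s m n : ℕ} (h : s + m ≤ n) {B : Type} [Ring B] {X : Fin n → B}
    {T : Cross n → B} {a b : B}
    (hab : KLRRel (fun k : Fin m => X ⟨s + k.1, by omega⟩)
      (fun k : Cross m => T ⟨s + k.1, by have := k.2; omega⟩) a b) : KLRRel X T a b := by
  cases hab with
  | dot_dot k l => exact .dot_dot _ _
  | cross_sq k => exact .cross_sq _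
  | cross_dot_left k => exact .cross_dot_left ⟨s + k.1, by have := k.2; omega⟩
  | cross_dot_right k => exact .cross_dot_right ⟨s + k.1, by have := k.2; omega⟩
  | cross_dot_far k l hl hr =>
    refine .cross_dot_far ⟨s + k.1, by have := k.2; omega⟩ _ ?_ ?_ <;>
      simp only [ne_eq, Fin.ext_iff] at * <;> omega
  | cross_cross_far k l hl => exact .cross_cross_far _ _ (by simp only; omega)
  | braid k l hl => exact .braid _ _ (by simp only; omega)

/-- The embedding `r ↦ 1_s ⊗ r ⊗ 1_{n - s - m}` placing a diagram on `m` strands to the right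
of `s` vertical strands. -/
def emb (s m n : ℕ) (h : s + m ≤ n) : KLR m →ₐ[ℂ] KLR n :=
  lift (fun k => x ⟨s + k.1, by omega⟩) (fun k => t ⟨s + k.1, by have := k.2; omega⟩)
    fun _ _ hab => rel (rel_shift h hab)

theorem emb_mem (s m n : ℕ) (h : s + m ≤ n) (d : ℤ) (r : KLR m) (hr : r ∈ deg m d) :
    emb s m n h r ∈ deg n d := by
  refine map_wordDeg _ _ _ _ _ ?_ d r hr
  rintro (k | k)
  · simpa [gen, genDeg, emb] using
      word_mem (gen n) (genDeg n) [Sum.inl ⟨s + k.1, by omega⟩]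
  · simpa [gen, genDeg, emb] using
      word_mem (gen n) (genDeg n) [Sum.inr ⟨s + k.1, by have := k.2; omega⟩]

/-- Diagrams on the first `m` strands commute with diagrams on the next `l` strands. -/
theorem emb_commute {m l n : ℕ} (h : m + l = n) (r : KLR m) (r' : KLR l) :
    Commute (emb 0 m n (by omega) r) (emb m l n h.le r') := by
  refine commute_of_generators _ _ (adjoin_gen m) (adjoin_gen l) _ _ ?_ r r'
  rintro (i | i) (j | j) <;> simp only [gen, Sum.elim_inl, Sum.elim_inr, emb, lift_x, lift_t]
  · exact rel (.dot_dot _ _)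
  · exact (rel (.cross_dot_far _ _ (by simp only [ne_eq, Fin.ext_iff]; omega)
      (by simp only [ne_eq, Fin.ext_iff]; omega))).symm
  · have := i.2
    exact rel (.cross_dot_far _ _ (by simp only [ne_eq, Fin.ext_iff]; omega)
      (by simp only [ne_eq, Fin.ext_iff]; omega))
  · have := i.2
    exact rel (.cross_cross_far _ _ (by simp only; omega))

/-- The transposition of the strands `k` and `k + 1`. -/
def transp {n : ℕ} (k : Cross n) : Equiv.Perm (Fin n) := Equiv.swap k.left k.right

theorem exists_word {n : ℕ} (w : Equiv.Perm (Fin n)) :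
    ∃ l : List (Cross n), (l.map transp).prod = w := by
  cases n with
  | zero => exact ⟨[], Subsingleton.elim _ _⟩
  | succ n =>
    have hw : w ∈ Submonoid.closure
        (Set.range fun i : Fin n => Equiv.swap i.castSucc i.succ) := by
      rw [Equiv.Perm.mclosure_swap_castSucc_succ]; trivial
    induction hw using Submonoid.closure_induction with
    | mem c hc =>
      obtain ⟨i, rfl⟩ := hc
      exact ⟨[⟨i.1, by omega⟩], by simp only [List.map_cons, List.map_nil, List.prod_singleton]; rfl⟩
    | one => exact ⟨[], rfl⟩
    | mul c d _ _ hc hd =>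
      obtain ⟨l, rfl⟩ := hc
      obtain ⟨l', rfl⟩ := hd
      exact ⟨l ++ l', by simp⟩

/-- The element `τ_w` for a permutation `w`: the product of crossings along an expression of `w` in
adjacent transpositions. By the relations `τ_k² = 1` and the braid relations it does not depend on
the expression. -/
def tau {n : ℕ} (w : Equiv.Perm (Fin n)) : KLR n :=
  ((exists_word w).choose.map t).prod

/-- The symmetrizing idempotent `e_n = (1 / n!) ∑_w τ_w`. -/
def sym (n : ℕ) : KLR n := (n.factorial : ℂ)⁻¹ • ∑ w : Equiv.Perm (Fin n), tau w

theorem sym_mem (n : ℕ) : sym n ∈ deg n 0 := by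
  refine Submodule.smul_mem _ _ (Submodule.sum_mem _ fun w _ => ?_)
  have := word_mem (gen n) (genDeg n) ((exists_word w).choose.map Sum.inr)
  simpa [tau, gen, genDeg, Function.comp_def, deg] using this

/-- The embedding `r ↦ r ⊗ 1_l` of `R(m)` into `R(n)`, where `n = m + l`, together with the
idempotent `1_m ⊗ e_l`. -/
def corner {m l n : ℕ} (h : m + l = n) : Corner (deg m) (deg n) where
  ι := emb 0 m n (by omega)
  e := emb m l n h.le (sym l)
  ι_mem := emb_mem _ _ _ _
  e_mem := emb_mem _ _ _ _ _ _ (sym_mem l)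
  comm s := emb_commute h s (sym l)

/-- The functor `M ↦ R(n)(1_m ⊗ e_l) ⊗_{R(m)} M`, where `n = m + l`. -/
def F {m l n : ℕ} (h : m + l = n) : GrMod.{u} (deg m) ⥤ GrMod.{u} (deg n) :=
  (corner h).indFunctor

/-- The functor `M ↦ (1_m ⊗ e_l) M`, where `n = m + l`. -/
def E {m l n : ℕ} (h : m + l = n) : GrMod.{u} (deg n) ⥤ GrMod.{u} (deg m) :=
  (corner h).resFunctor

end KLR

/-- The relation `x_1 ^ a = 0`, imposed when there is at least one strand. -/
inductive CycRel (a n : ℕ) : KLR n → KLR n → Prop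
  | dot_pow (h : 0 < n) : CycRel a n (KLR.x ⟨0, h⟩ ^ a) 0

/-- The cyclotomic algebra: the quotient of `R(n)` by the two-sided ideal generated by
`x_1 ^ a`. -/
def CycKLR (a n : ℕ) : Type := RingQuot (CycRel a n)

namespace CycKLR

instance (a n : ℕ) : Ring (CycKLR a n) := inferInstanceAs (Ring (RingQuot _))

instance (a n : ℕ) : Algebra ℂ (CycKLR a n) := inferInstanceAs (Algebra ℂ (RingQuot _))

variable {a : ℕ}

/-- The projection from `R(n)` to its cyclotomic quotient. -/
def proj (a n : ℕ) : KLR n →ₐ[ℂ] CycKLR a n := RingQuot.mkAlgHom ℂ _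

theorem proj_surjective (a n : ℕ) : Function.Surjective (proj a n) :=
  RingQuot.mkAlgHom_surjective ℂ _

theorem proj_dot_pow {n : ℕ} (h : 0 < n) : proj a n (KLR.x ⟨0, h⟩) ^ a = 0 := by
  have : proj a n (KLR.x ⟨0, h⟩ ^ a) = proj a n 0 :=
    RingQuot.mkAlgHom_rel ℂ (CycRel.dot_pow (a := a) h)
  rwa [map_pow, map_zero] at this

/-- The homomorphism out of the cyclotomic algebra induced by one out of `R(n)`. -/
def lift {n : ℕ} {B : Type} [Ring B] [Algebra ℂ B] (f : KLR n →ₐ[ℂ] B)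
    (hf : ∀ h : 0 < n, f (KLR.x ⟨0, h⟩) ^ a = 0) : CycKLR a n →ₐ[ℂ] B :=
  RingQuot.liftAlgHom ℂ ⟨f, by rintro _ _ ⟨h⟩; rw [map_pow, map_zero, hf h]⟩

@[simp]
theorem lift_proj {n : ℕ} {B : Type} [Ring B] [Algebra ℂ B] (f : KLR n →ₐ[ℂ] B)
    (hf : ∀ h : 0 < n, f (KLR.x ⟨0, h⟩) ^ a = 0) (r : KLR n) : lift f hf (proj a n r) = f r :=
  RingQuot.liftAlgHom_mkAlgHom_apply ℂ _ _ _

/-- The images of the generators of `R(n)`. -/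
def gen (a n : ℕ) (i : Fin n ⊕ Cross n) : CycKLR a n := proj a n (KLR.gen n i)

/-- The grading of the cyclotomic algebra inherited from `R(n)`. -/
def deg (a n : ℕ) : ℤ → Submodule ℂ (CycKLR a n) := wordDeg (gen a n) (KLR.genDeg n)

theorem adjoin_gen (a n : ℕ) : Algebra.adjoin ℂ (Set.range (gen a n)) = ⊤ := by
  have h : gen a n = proj a n ∘ KLR.gen n := rfl
  rw [h, Set.range_comp, ← AlgHom.map_adjoin, KLR.adjoin_gen, Algebra.map_top,
    AlgHom.range_eq_top]
  exact proj_surjective a n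

theorem rel_proj {n : ℕ} (r s : CycKLR a n)
    (h : KLRRel (fun k => proj a n (KLR.x k)) (fun k => proj a n (KLR.t k)) r s) : r = s := by
  have key : ∀ {b c}, KLRRel (KLR.x (n := n)) KLR.t b c → proj a n b = proj a n c :=
    fun h => congrArg _ (KLR.rel h)
  cases h with
  | dot_dot k l => simpa only [map_mul] using key (.dot_dot k l)
  | cross_sq k => simpa only [map_mul, map_one] using key (.cross_sq k)
  | cross_dot_left k => simpa only [map_mul] using key (.cross_dot_left k)
  | cross_dot_right k => simpa only [map_mul] using key (.cross_dot_right k)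
  | cross_dot_far k l h h' => simpa only [map_mul] using key (.cross_dot_far k l h h')
  | cross_cross_far k l h => simpa only [map_mul] using key (.cross_cross_far k l h)
  | braid k l h => simpa only [map_mul] using key (.braid k l h)

theorem isInternal_deg (a n : ℕ) : DirectSum.IsInternal (deg a n) :=
  isInternal_wordDeg _ _ (adjoin_gen a n)
    (lift (KLR.lift _ _ (KLR.rel_single (rel_proj (a := a) (n := n)))) (fun h => by
      rw [KLR.lift_x, AddMonoidAlgebra.single_pow, proj_dot_pow, AddMonoidAlgebra.single_zero]))
    (by rintro (k | k) <;> simp [gen, KLR.gen, KLR.genDeg])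

instance (a n : ℕ) : GradedAlgebra (deg a n) where
  toGradedMonoid := wordDeg_gradedMonoid _ _
  toDecomposition := (isInternal_deg a n).chooseDecomposition

theorem proj_mem (a n : ℕ) (d : ℤ) (r : KLR n) (hr : r ∈ KLR.deg n d) : proj a n r ∈ deg a n d := by
  refine map_wordDeg _ _ _ _ _ ?_ d r hr
  intro i
  simpa [gen] using word_mem (gen a n) (KLR.genDeg n) [i]

/-- The homomorphism `r ↦ r ⊗ 1_{n - m}` between cyclotomic algebras. -/
def emb (a m n : ℕ) (h : m ≤ n) : CycKLR a m →ₐ[ℂ] CycKLR a n :=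
  lift (a := a) ((proj a n).comp (KLR.emb 0 m n (by omega))) (fun hm => by
    have h0 := proj_dot_pow (a := a) (n := n) (by omega)
    simpa [KLR.emb] using h0)

/-- The homomorphism `r ↦ r ⊗ 1_l` between cyclotomic algebras, together with the idempotent
`1_m ⊗ e_l`, where `n = m + l`. -/
def corner (a : ℕ) {m l n : ℕ} (h : m + l = n) : Corner (deg a m) (deg a n) where
  ι := emb a m n (by omega)
  e := proj a n (KLR.emb m l n h.le (KLR.sym l))
  ι_mem := map_wordDeg _ _ _ _ _ fun i => by
    have := proj_mem a n _ _ (KLR.emb_mem 0 m n (by omega) (KLR.genDeg m i) (KLR.gen m i)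
      (by simpa [KLR.deg] using word_mem (KLR.gen m) (KLR.genDeg m) [i]))
    simpa [gen, emb, deg] using this
  e_mem := proj_mem _ _ _ _ (KLR.emb_mem _ _ _ _ _ _ (KLR.sym_mem l))
  comm s := by
    obtain ⟨r, rfl⟩ := proj_surjective a m s
    simp only [emb, lift_proj, AlgHom.comp_apply]
    rw [← map_mul, ← map_mul, (KLR.emb_commute h r (KLR.sym l)).eq]

/-- The functor `M ↦ R^Λ(n)(1_m ⊗ e_l) ⊗_{R^Λ(m)} M`, where `n = m + l`. -/
def F (a : ℕ) {m l n : ℕ} (h : m + l = n) : GrMod.{u} (deg a m) ⥤ GrMod.{u} (deg a n) :=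
  (corner a h).indFunctor

/-- The functor `M ↦ (1_m ⊗ e_l) M`, where `n = m + l`. -/
def E (a : ℕ) {m l n : ℕ} (h : m + l = n) : GrMod.{u} (deg a n) ⥤ GrMod.{u} (deg a m) :=
  (corner a h).resFunctor

end CycKLR

end KLR

section Symmetric

/-- Polynomials in `p` variables that are homogeneous of degree `d`, each variable having
degree `2`. -/
def polyDeg (p : ℕ) (d : ℤ) : Submodule ℂ (MvPolynomial (Fin p) ℂ) :=
  MvPolynomial.weightedHomogeneousSubmodule ℂ (fun _ => (2 : ℤ)) d

theorem isInternal_polyDeg (p : ℕ) : DirectSum.IsInternal (polyDeg p) :=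
  letI := MvPolynomial.weightedDecomposition ℂ (fun _ : Fin p => (2 : ℤ))
  DirectSum.Decomposition.isInternal
    (MvPolynomial.weightedHomogeneousSubmodule ℂ (fun _ : Fin p => (2 : ℤ)))

theorem rename_mem_polyDeg {p : ℕ} (σ : Equiv.Perm (Fin p)) (d : ℤ) (f : MvPolynomial (Fin p) ℂ)
    (hf : f ∈ polyDeg p d) : MvPolynomial.rename σ f ∈ polyDeg p d := by
  have hf' : MvPolynomial.IsWeightedHomogeneous (fun _ : Fin p => (2 : ℤ)) f d := hf
  rw [MvPolynomial.as_sum f, map_sum]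
  refine Submodule.sum_mem _ fun m hm => ?_
  rw [MvPolynomial.rename_monomial]
  refine MvPolynomial.isWeightedHomogeneous_monomial _ _ _ ?_
  rw [← hf' (MvPolynomial.mem_support_iff.1 hm)]
  simp [Finsupp.weight_apply, Finsupp.sum_mapDomain_index, add_mul]

/-- Subspaces of invariants of degree-preserving maps are graded. -/
theorem isInternal_invariants {V : Type*} [AddCommGroup V] [Module ℂ V] {𝒱 : ℤ → Submodule ℂ V}
    (h : DirectSum.IsInternal 𝒱) {G : Type*} (f : G → V →ₗ[ℂ] V)
    (hf : ∀ σ d, ∀ v ∈ 𝒱 d, f σ v ∈ 𝒱 d) (W : Submodule ℂ V)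
    (hW : ∀ v, v ∈ W ↔ ∀ σ, f σ v = v) :
    DirectSum.IsInternal fun d => (𝒱 d).comap W.subtype := by
  refine isInternal_sub h W fun w hw d => (hW _).2 fun σ => ?_
  rw [← components_map h h (f σ) (hf σ), (hW w).1 hw σ]

/-- The graded algebra `Z_p` of symmetric polynomials in `p` variables of degree `2`. -/
def Z (p : ℕ) : GrSpace where
  carrier := MvPolynomial.symmetricSubalgebra (Fin p) ℂ
  deg d := (polyDeg p d).comap (MvPolynomial.symmetricSubalgebra (Fin p) ℂ).val.toLinearMap
  isInternal := isInternal_invariants (isInternal_polyDeg p)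
    (fun σ : Equiv.Perm (Fin p) => (MvPolynomial.rename σ : _ →ₐ[ℂ] _).toLinearMap)
    rename_mem_polyDeg
    (Subalgebra.toSubmodule (MvPolynomial.symmetricSubalgebra (Fin p) ℂ)) (fun _ => Iff.rfl)

/-- The ideal `(x_1 ^ a, …, x_p ^ a)`. -/
def powIdeal (a p : ℕ) : Ideal (MvPolynomial (Fin p) ℂ) :=
  Ideal.span (Set.range fun k => MvPolynomial.X k ^ a)

/-- The truncated polynomial algebra `ℂ[x_1, …, x_p] / (x_1 ^ a, …, x_p ^ a)`. -/
abbrev Trunc (a p : ℕ) : Type := MvPolynomial (Fin p) ℂ ⧸ powIdeal a p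

theorem powIdeal_le (a p : ℕ) (σ : Equiv.Perm (Fin p)) :
    powIdeal a p ≤ (powIdeal a p).comap (MvPolynomial.rename σ : _ →ₐ[ℂ] _) := by
  refine Ideal.span_le.2 ?_
  rintro _ ⟨k, rfl⟩
  exact Ideal.subset_span ⟨σ k, by simp⟩

/-- The action of a permutation of the variables on truncated polynomials. -/
def truncPerm (a p : ℕ) (σ : Equiv.Perm (Fin p)) : Trunc a p →ₐ[ℂ] Trunc a p :=
  Ideal.quotientMapₐ (powIdeal a p) (MvPolynomial.rename σ) (powIdeal_le a p σ)

/-- The algebra of `S_p`-invariants of the truncated polynomial algebra. -/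
def truncInvariants (a p : ℕ) : Subalgebra ℂ (Trunc a p) where
  carrier := {z | ∀ σ, truncPerm a p σ z = z}
  mul_mem' hx hy σ := by rw [map_mul, hx σ, hy σ]
  add_mem' hx hy σ := by rw [map_add, hx σ, hy σ]
  algebraMap_mem' r σ := AlgHom.commutes _ r

/-- The grading of the truncated polynomial algebra, each variable having degree `2`. -/
def truncDeg (a p : ℕ) (d : ℤ) : Submodule ℂ (Trunc a p) :=
  (polyDeg p d).map (Ideal.Quotient.mkₐ ℂ (powIdeal a p)).toLinearMap

/-- The components of a polynomial, projected to the truncated polynomial algebra. -/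
def polyComponents (a p : ℕ) : MvPolynomial (Fin p) ℂ →ₐ[ℂ] AddMonoidAlgebra (Trunc a p) ℤ :=
  MvPolynomial.aeval (R := ℂ) (S₁ := AddMonoidAlgebra (Trunc a p) ℤ) fun k =>
    AddMonoidAlgebra.single 2 (Ideal.Quotient.mkₐ ℂ (powIdeal a p) (MvPolynomial.X k))

theorem polyComponents_monomial (a p : ℕ) (m : Fin p →₀ ℕ) (c : ℂ) :
    polyComponents a p (MvPolynomial.monomial m c) =
      AddMonoidAlgebra.single (Finsupp.weight (fun _ => (2 : ℤ)) m)
        (Ideal.Quotient.mkₐ ℂ (powIdeal a p) (MvPolynomial.monomial m c)) := by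
  induction m using Finsupp.induction_linear generalizing c with
  | zero =>
    have : (MvPolynomial.monomial 0 c : MvPolynomial (Fin p) ℂ) = algebraMap ℂ _ c := rfl
    rw [this, AlgHom.commutes, AlgHom.commutes, map_zero]
    rfl
  | add f g hf hg =>
    have : (MvPolynomial.monomial (f + g) c : MvPolynomial (Fin p) ℂ) =
        MvPolynomial.monomial f c * MvPolynomial.monomial g 1 := by
      rw [MvPolynomial.monomial_mul, mul_one]
    rw [this, map_mul, hf, hg, AddMonoidAlgebra.single_mul_single, map_mul, map_add]
  | single k r =>
    have : (MvPolynomial.monomial (Finsupp.single k r) c : MvPolynomial (Fin p) ℂ) =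
        c • MvPolynomial.X k ^ r := by
      rw [MvPolynomial.X_pow_eq_monomial, MvPolynomial.smul_monomial, smul_eq_mul, mul_one]
    rw [this, map_smul, map_pow, polyComponents, MvPolynomial.aeval_X,
      AddMonoidAlgebra.single_pow, AddMonoidAlgebra.smul_single, map_smul, map_pow]
    congr 1
    simp [Finsupp.weight_apply]

theorem polyComponents_of_mem (a p : ℕ) {d : ℤ} {f : MvPolynomial (Fin p) ℂ}
    (hf : f ∈ polyDeg p d) : polyComponents a p f =
      AddMonoidAlgebra.single d (Ideal.Quotient.mkₐ ℂ (powIdeal a p) f) := by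
  have hf' : MvPolynomial.IsWeightedHomogeneous (fun _ : Fin p => (2 : ℤ)) f d := hf
  have key : polyComponents a p f = ∑ m ∈ f.support, AddMonoidAlgebra.single d
      (Ideal.Quotient.mkₐ ℂ (powIdeal a p) (MvPolynomial.monomial m (f.coeff m))) := by
    conv_lhs => rw [MvPolynomial.as_sum f, map_sum]
    refine Finset.sum_congr rfl fun m hm => ?_
    rw [polyComponents_monomial, hf' (MvPolynomial.mem_support_iff.1 hm)]
  rw [key]
  conv_rhs => rw [MvPolynomial.as_sum f, map_sum]
  exact (map_sum (AddMonoidAlgebra.singleAddHom d) _ _).symm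

theorem powIdeal_le_ker (a p : ℕ) : powIdeal a p ≤ RingHom.ker (polyComponents a p) := by
  refine Ideal.span_le.2 ?_
  rintro _ ⟨k, rfl⟩
  have h0 : Ideal.Quotient.mkₐ ℂ (powIdeal a p) (MvPolynomial.X k) ^ a = 0 := by
    rw [← map_pow]
    exact Ideal.Quotient.eq_zero_iff_mem.2 (Ideal.subset_span ⟨k, rfl⟩)
  change polyComponents a p (MvPolynomial.X k ^ a) = 0
  rw [map_pow, polyComponents, MvPolynomial.aeval_X, AddMonoidAlgebra.single_pow, h0,
    AddMonoidAlgebra.single_zero]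

theorem isInternal_truncDeg (a p : ℕ) : DirectSum.IsInternal (truncDeg a p) := by
  refine isInternal_map_of_surjective (𝒱 := polyDeg p) (fun v => ?_) _
    (Ideal.Quotient.mkₐ_surjective ℂ (powIdeal a p))
    ((AddMonoidAlgebra.coeffLinearEquiv ℂ).toLinearMap ∘ₗ (polyComponents a p).toLinearMap) ?_ ?_
  · rw [(isInternal_polyDeg p).submodule_iSup_eq_top]; trivial
  · intro f hf
    have h1 : f ∈ powIdeal a p := Ideal.Quotient.eq_zero_iff_mem.1 hf
    have h2 : polyComponents a p f = 0 := powIdeal_le_ker a p h1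
    simp [h2]
  · intro d f hf
    simp only [LinearMap.comp_apply, AlgHom.toLinearMap_apply, polyComponents_of_mem a p hf]
    rfl

theorem truncPerm_mem (a p : ℕ) (σ : Equiv.Perm (Fin p)) (d : ℤ) (z : Trunc a p)
    (hz : z ∈ truncDeg a p d) : truncPerm a p σ z ∈ truncDeg a p d := by
  obtain ⟨f, hf, rfl⟩ := hz
  exact ⟨MvPolynomial.rename σ f, rename_mem_polyDeg σ d f hf, rfl⟩

/-- The graded algebra `Z_p^Λ` of `S_p`-invariants of
`ℂ[x_1, …, x_p] / (x_1 ^ a, …, x_p ^ a)`, each variable having degree `2`. -/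
def cycZ (a p : ℕ) : GrSpace where
  carrier := truncInvariants a p
  deg d := (truncDeg a p d).comap (truncInvariants a p).val.toLinearMap
  isInternal := isInternal_invariants (isInternal_truncDeg a p)
    (fun σ => (truncPerm a p σ).toLinearMap) (truncPerm_mem a p)
    (Subalgebra.toSubmodule (truncInvariants a p)) (fun _ => Iff.rfl)

end Symmetric

/-- The indices `0 ≤ p ≤ min(l, t)` for which `F_{t-p} E_{l-p}` is defined on graded modules over the
algebra on `n` strands, that is `l - p ≤ n`; for the others `E_{l-p}` vanishes. -/
abbrev Summand (l t n : ℕ) : Type := {p : Fin (min l t + 1) // l - p.1 ≤ n}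

end JordanKLR

end

open JordanKLR

noncomputable section

/-! Both towers are of wreath type: the algebra on n strands is A(n) = Q(n) ⋊ S_n, with Q(n) the
polynomial ring in the dots or its truncation, and the permutations form a basis of A(n) over Q(n).
`WreathSystem` records what is used of this, so that both statements follow from the single theorem
`nonempty_iso`.

Put N = n + t = k + l. Then E F M = e_l A(N) e_t ⊗_{A(n)} M, and the task is to cut this along the
double cosets of S_k × S_l and S_n × S_t in S_N. A double coset is determined by the number p of
strands running from the last t positions to the last l positions. Its representative s is the block
exchange `blockSwap`: it fixes the first m = n - (l - p) strands, exchanges the next b = l - p with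
the following c = t - p, and fixes the last p (`exists_factor`). The last p strands are symmetrized
from both sides, so only the symmetric part of a polynomial on them survives; this is the source of
Z_p.

For each p the map `forward` sends r e_c ⊗ x ⊗ z to e_l (r e_c) s z ⊗ x, with z placed on the last p
strands. Its left inverse `back` is defined on all of F M. On w q ⊗ x with w = g s g' it has the
value g Ψ(g' q, g' x), where Ψ is `blockEval`: the variables of the first n strands act on x, those
of the next c strands act as the last c of the k strands, and those of the last p strands are
averaged into Z_p. If w is in another double coset, the value is zero. Two factorizations of w
differ by an element of S_m × S_b × S_c × S_p (`blockSwap_factor_unique`), and Ψ is equivariant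
under this group (`blockEval_perm`), so the value is well defined.

The identities `back_forwardLin` and `back_forwardLin_of_ne` make the sum of the maps `forward`
injective. It is surjective because every e_l w q ⊗ x lies in some range (`e_smul_perm_mem_range`).
A bijective degree-preserving map is an isomorphism of graded modules.

That the algebras are of wreath type rests on two facts. The Coxeter relations make τ_w independent
of the expression (`prod_eq_of_prod_transp_eq`). The representation `rep` on functions on S_n shows
that the spanning elements τ_w f are independent over the polynomials. -/

namespace JordanKLR


/-! ### Double cosets of two-block Young subgroups -/

section Permutations

theorem perm_apply_inv {α : Type*} (g : Equiv.Perm α) (i : α) : g (g⁻¹ i) = i :=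
  g.apply_symm_apply i

theorem perm_inv_apply {α : Type*} (g : Equiv.Perm α) (i : α) : g⁻¹ (g i) = i :=
  g.symm_apply_apply i

/-- The inclusion of `m` strands as the strands `s, …, s + m - 1` of `n`. -/
def blk (s m n : ℕ) (h : s + m ≤ n) (i : Fin m) : Fin n := ⟨s + i.1, by omega⟩

@[simp]
theorem blk_val (s m n : ℕ) (h : s + m ≤ n) (i : Fin m) : (blk s m n h i).1 = s + i.1 := rfl

theorem eq_blk_or_eq_blk {m l n : ℕ} (h : m + l = n) (i : Fin n) :
    (∃ j, i = blk 0 m n (by omega) j) ∨ ∃ j, i = blk m l n h.le j := by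
  by_cases hi : i.1 < m
  · exact .inl ⟨⟨i.1, hi⟩, Fin.ext (by simp)⟩
  · exact .inr ⟨⟨i.1 - m, by omega⟩, Fin.ext (by simp; omega)⟩

theorem left_le {m l n : ℕ} (h : m + l = n) : 0 + m ≤ n := by omega

/-- The juxtaposition `u × v` of permutations of `m` and of `l` strands. -/
def juxt {m l n : ℕ} (h : m + l = n) :
    Equiv.Perm (Fin m) × Equiv.Perm (Fin l) →* Equiv.Perm (Fin n) :=
  ((finSumFinEquiv.trans (finCongr h)).permCongrHom).toMonoidHom.comp
    (Equiv.Perm.sumCongrHom (Fin m) (Fin l))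

@[simp]
theorem juxt_left {m l n : ℕ} (h : m + l = n) (g : Equiv.Perm (Fin m) × Equiv.Perm (Fin l))
    (i : Fin m) : juxt h g (blk 0 m n (by omega) i) = blk 0 m n (by omega) (g.1 i) := by
  subst h
  have : blk 0 m (m + l) (by omega) = Fin.castAdd l := by
    ext i; simp
  simp [juxt, this, Equiv.permCongrHom, Equiv.permCongr_apply]

@[simp]
theorem juxt_right {m l n : ℕ} (h : m + l = n) (g : Equiv.Perm (Fin m) × Equiv.Perm (Fin l))
    (i : Fin l) : juxt h g (blk m l n h.le i) = blk m l n h.le (g.2 i) := by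
  subst h
  have : blk m l (m + l) le_rfl = Fin.natAdd m := by
    ext i; simp
  simp [juxt, this, Equiv.permCongrHom, Equiv.permCongr_apply]

theorem juxt_val_lt {m l n : ℕ} (h : m + l = n) (g : Equiv.Perm (Fin m) × Equiv.Perm (Fin l))
    (i : Fin n) : (juxt h g i).1 < m ↔ i.1 < m := by
  obtain ⟨j, rfl⟩ | ⟨j, rfl⟩ := eq_blk_or_eq_blk h i <;> simp

theorem blk_injective (s m n : ℕ) (h : s + m ≤ n) : Function.Injective (blk s m n h) := by
  intro i j hij
  have := congrArg Fin.val hij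
  simp only [blk_val] at this
  exact Fin.ext (by omega)

theorem juxt_injective {m l n : ℕ} (h : m + l = n) : Function.Injective (juxt h) := by
  intro g g' hg
  refine Prod.ext (Equiv.ext fun i => ?_) (Equiv.ext fun i => ?_)
  · have := Equiv.congr_fun hg (blk 0 m n (by omega) i)
    rw [juxt_left, juxt_left] at this
    exact blk_injective _ _ _ _ this
  · have := Equiv.congr_fun hg (blk m l n h.le i)
    rw [juxt_right, juxt_right] at this
    exact blk_injective _ _ _ _ this

/-- A permutation preserving the first block also preserves its complement; on each block the
restriction is injective, hence bijective because the block is finite. -/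
theorem exists_eq_juxt {m l n : ℕ} (h : m + l = n) (g : Equiv.Perm (Fin n))
    (hg : ∀ i, (g i).1 < m ↔ i.1 < m) : ∃ u v, g = juxt h (u, v) := by
  have hb : ∀ i : Fin m, (g (blk 0 m n (by omega) i)).1 < m := fun i => (hg _).2 (by simp)
  have hb' : ∀ i : Fin l, m ≤ (g (blk m l n h.le i)).1 := fun i => by
    rw [← not_lt, hg]; simp
  have hu : Function.Injective fun i : Fin m =>
      (⟨(g (blk 0 m n (by omega) i)).1, hb i⟩ : Fin m) := by
    intro i j hij
    exact blk_injective _ _ _ _ (g.injective (Fin.ext (Fin.mk.inj_iff.1 hij)))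
  have hv : Function.Injective fun i : Fin l =>
      (⟨(g (blk m l n h.le i)).1 - m, by have := hb' i; omega⟩ : Fin l) := by
    intro i j hij
    have h1 := hb' i
    have h2 := hb' j
    have h3 := Fin.mk.inj_iff.1 hij
    exact blk_injective m l n h.le (g.injective (Fin.ext (by omega)))
  refine ⟨Equiv.ofBijective _ (Finite.injective_iff_bijective.1 hu),
    Equiv.ofBijective _ (Finite.injective_iff_bijective.1 hv), Equiv.ext fun i => ?_⟩
  obtain ⟨j, rfl⟩ | ⟨j, rfl⟩ := eq_blk_or_eq_blk h i
  · rw [juxt_left]; exact Fin.ext (by simp)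
  · rw [juxt_right]; have := hb' j; exact Fin.ext (by simp; omega)

/-- The permutation exchanging the block of `b` strands starting at `m` with the following block of
`c` strands. -/
def blockSwap (m b c N : ℕ) (h : m + b + c ≤ N) : Equiv.Perm (Fin N) where
  toFun i := ⟨if i.1 < m then i.1 else if i.1 < m + b then i.1 + c else
    if i.1 < m + b + c then i.1 - b else i.1, by split_ifs <;> omega⟩
  invFun i := ⟨if i.1 < m then i.1 else if i.1 < m + c then i.1 + b else
    if i.1 < m + b + c then i.1 - c else i.1, by split_ifs <;> omega⟩
  left_inv i := Fin.ext (by simp only; split_ifs <;> omega)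
  right_inv i := Fin.ext (by simp only; split_ifs <;> omega)

theorem blockSwap_val (m b c N : ℕ) (h : m + b + c ≤ N) (i : Fin N) :
    (i.1 < m → (blockSwap m b c N h i).1 = i.1) ∧
    (m ≤ i.1 → i.1 < m + b → (blockSwap m b c N h i).1 = i.1 + c) ∧
    (m + b ≤ i.1 → i.1 < m + b + c → (blockSwap m b c N h i).1 + b = i.1) ∧
    (m + b + c ≤ i.1 → (blockSwap m b c N h i).1 = i.1) := by
  simp only [blockSwap, Equiv.coe_fn_mk]
  split_ifs <;> omega

theorem blockSwap_le {m b c p n t N : ℕ} (h1 : m + b = n) (h3 : c + p = t) (h5 : n + t = N) :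
    m + b + c ≤ N := by omega

section Blocks

variable {m b c p n t k l N : ℕ} (h1 : m + b = n) (h2 : m + c = k) (h3 : c + p = t)
  (h4 : b + p = l) (h5 : n + t = N) (h6 : k + l = N)

include h1 h2 h3 h4 h5

/-- The blocks have sizes m, b, c, p in the source, where n = m + b and t = c + p, and m, c, b, p in
the target, where k = m + c and l = b + p. This lemma and the next three follow each block. -/
theorem blockSwap_blk_one (i : Fin m) : blockSwap m b c N (by omega)
    (blk 0 n N (by omega) (blk 0 m n (by omega) i)) =
      blk 0 k N (by omega) (blk 0 m k (by omega) i) :=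
  Fin.ext (by
    have hi := i.2
    have := blockSwap_val m b c N (by omega) 
      (blk 0 n N (by omega) (blk 0 m n (by omega) i))
    simp only [blk_val] at this ⊢
    omega)

theorem blockSwap_blk_two (i : Fin b) : blockSwap m b c N (by omega)
    (blk 0 n N (by omega) (blk m b n (by omega) i)) =
      blk k l N (by omega) (blk 0 b l (by omega) i) :=
  Fin.ext (by
    have hi := i.2
    have := blockSwap_val m b c N (by omega) 
      (blk 0 n N (by omega) (blk m b n (by omega) i))
    simp only [blk_val] at this ⊢
    omega)

theorem blockSwap_blk_three (i : Fin c) : blockSwap m b c N (by omega)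
    (blk n t N (by omega) (blk 0 c t (by omega) i)) =
      blk 0 k N (by omega) (blk m c k (by omega) i) :=
  Fin.ext (by
    have hi := i.2
    have := blockSwap_val m b c N (by omega) 
      (blk n t N (by omega) (blk 0 c t (by omega) i))
    simp only [blk_val] at this ⊢
    omega)

theorem blockSwap_blk_four (i : Fin p) : blockSwap m b c N (by omega)
    (blk n t N (by omega) (blk c p t (by omega) i)) =
      blk k l N (by omega) (blk b p l (by omega) i) :=
  Fin.ext (by
    have hi := i.2
    have := blockSwap_val m b c N (by omega) 
      (blk n t N (by omega) (blk c p t (by omega) i))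
    simp only [blk_val] at this ⊢
    omega)

include h6

/-- The exchange moves each block rigidly, so permutations inside the blocks pass through it. Thus
S_m × S_b × S_c × S_p lies in both Young subgroups up to conjugation by the exchange. -/
theorem blockSwap_mul_juxt (g1 : Equiv.Perm (Fin m)) (g2 : Equiv.Perm (Fin b))
    (g3 : Equiv.Perm (Fin c)) (g4 : Equiv.Perm (Fin p)) :
    blockSwap m b c N (by omega) * juxt h5 (juxt h1 (g1, g2), juxt h3 (g3, g4)) =
      juxt h6 (juxt h2 (g1, g3), juxt h4 (g2, g4)) * blockSwap m b c N (by omega) := by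
  refine Equiv.ext fun i => ?_
  rw [Equiv.Perm.mul_apply, Equiv.Perm.mul_apply]
  obtain ⟨j, rfl⟩ | ⟨j, rfl⟩ := eq_blk_or_eq_blk h5 i
  · rw [juxt_left]
    obtain ⟨j, rfl⟩ | ⟨j, rfl⟩ := eq_blk_or_eq_blk h1 j
    · rw [juxt_left, blockSwap_blk_one h1 h2 h3 h4 h5, blockSwap_blk_one h1 h2 h3 h4 h5,
        juxt_left, juxt_left]
    · rw [juxt_right, blockSwap_blk_two h1 h2 h3 h4 h5, blockSwap_blk_two h1 h2 h3 h4 h5,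
        juxt_right, juxt_left]
  · rw [juxt_right]
    obtain ⟨j, rfl⟩ | ⟨j, rfl⟩ := eq_blk_or_eq_blk h3 j
    · rw [juxt_left, blockSwap_blk_three h1 h2 h3 h4 h5,
        blockSwap_blk_three h1 h2 h3 h4 h5, juxt_left, juxt_right]
    · rw [juxt_right, blockSwap_blk_four h1 h2 h3 h4 h5,
        blockSwap_blk_four h1 h2 h3 h4 h5, juxt_right, juxt_right]

/-- Two factorizations of a permutation through `blockSwap` differ by a permutation preserving the
four blocks. -/
theorem blockSwap_factor_unique {x x' : Equiv.Perm (Fin k)} {y y' : Equiv.Perm (Fin l)}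
    {u u' : Equiv.Perm (Fin n)} {v v' : Equiv.Perm (Fin t)}
    (h : juxt h6 (x, y) * blockSwap m b c N (by omega) * juxt h5 (u, v) =
      juxt h6 (x', y') * blockSwap m b c N (by omega) * juxt h5 (u', v')) :
    ∃ g1 g2 g3 g4, u' = juxt h1 (g1, g2) * u ∧ v' = juxt h3 (g3, g4) * v ∧
      x = x' * juxt h2 (g1, g3) := by
  set s := blockSwap m b c N (by omega) with hs
  -- The two ratios, one in S_n × S_t and one in S_k × S_l, are conjugate under the exchange.
  have key : s * juxt h5 (u' * u⁻¹, v' * v⁻¹) = juxt h6 (x'⁻¹ * x, y'⁻¹ * y) * s := by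
    have e1 : juxt h5 (u' * u⁻¹, v' * v⁻¹) = juxt h5 (u', v') * (juxt h5 (u, v))⁻¹ := by
      rw [← map_inv, ← map_mul]; rfl
    have e2 : juxt h6 (x'⁻¹ * x, y'⁻¹ * y) = (juxt h6 (x', y'))⁻¹ * juxt h6 (x, y) := by
      rw [← map_inv, ← map_mul]; rfl
    rw [e1, e2, ← mul_assoc, mul_inv_eq_iff_eq_mul, mul_assoc, mul_assoc, eq_inv_mul_iff_mul_eq,
      ← mul_assoc, ← mul_assoc, ← h]
  -- Hence the source ratio preserves the set of strands that the exchange sends below k. Cut with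
  -- the first n and the last t strands, this set gives the blocks m and c, so each factor of the
  -- ratio splits once more.
  have klt : ∀ i, (s (juxt h5 (u' * u⁻¹, v' * v⁻¹) i)).1 < k ↔ (s i).1 < k := by
    intro i
    have := Equiv.congr_fun key i
    rw [Equiv.Perm.mul_apply, Equiv.Perm.mul_apply] at this
    rw [this, juxt_val_lt]
  obtain ⟨g1, g2, hu⟩ := exists_eq_juxt h1 (u' * u⁻¹) fun i => by
    have := klt (blk 0 n N (by omega) i)
    rw [juxt_left, hs] at this
    dsimp only at this
    have e1 := blockSwap_val m b c N (by omega) (blk 0 n N (by omega) i)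
    have e2 := blockSwap_val m b c N (by omega) (blk 0 n N (by omega) ((u' * u⁻¹) i))
    have hi := i.2
    have hi' := ((u' * u⁻¹) i).2
    simp only [blk_val] at e1 e2
    omega
  obtain ⟨g3, g4, hv⟩ := exists_eq_juxt h3 (v' * v⁻¹) fun i => by
    have := klt (blk n t N (by omega) i)
    rw [juxt_right, hs] at this
    dsimp only at this
    have e1 := blockSwap_val m b c N (by omega) (blk n t N (by omega) i)
    have e2 := blockSwap_val m b c N (by omega) (blk n t N (by omega) ((v' * v⁻¹) i))
    have hi := i.2
    have hi' := ((v' * v⁻¹) i).2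
    simp only [blk_val] at e1 e2
    omega
  refine ⟨g1, g2, g3, g4, by rw [← hu, inv_mul_cancel_right], by rw [← hv, inv_mul_cancel_right], ?_⟩
  rw [hu, hv, hs, blockSwap_mul_juxt h1 h2 h3 h4 h5 h6] at key
  have := congrArg Prod.fst (juxt_injective h6 (mul_right_cancel key))
  simp only at this
  rw [this, mul_inv_cancel_left]

end Blocks

/-- The number of strands among those from `n` on which `w` sends to the strands from `k` on. -/
def overlap (n k : ℕ) {N : ℕ} (w : Equiv.Perm (Fin N)) : ℕ :=
  (Finset.univ.filter fun i : Fin N => ¬ i.1 < n ∧ ¬ (w i).1 < k).card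

/-- Left and right factors only permute strands inside the blocks that are being counted; the
overlap is therefore an invariant of the double coset. -/
theorem overlap_mul {n t k l N : ℕ} (h5 : n + t = N) (h6 : k + l = N)
    (g : Equiv.Perm (Fin k) × Equiv.Perm (Fin l)) (g' : Equiv.Perm (Fin n) × Equiv.Perm (Fin t))
    (w : Equiv.Perm (Fin N)) : overlap n k (juxt h6 g * w * juxt h5 g') = overlap n k w := by
  refine Finset.card_bij (fun i _ => juxt h5 g' i) ?_ ?_ ?_
  · intro i hi
    simp only [Finset.mem_filter, Finset.mem_univ, true_and, Equiv.Perm.mul_apply,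
      juxt_val_lt] at hi ⊢
    exact hi
  · intro i _ j _ hij
    exact (juxt h5 g').injective hij
  · intro i hi
    refine ⟨(juxt h5 g')⁻¹ i, ?_, by simp⟩
    have h7 := juxt_val_lt h5 g' ((juxt h5 g')⁻¹ i)
    rw [perm_apply_inv] at h7
    simp only [Finset.mem_filter, Finset.mem_univ, true_and] at hi ⊢
    rw [Equiv.Perm.mul_apply, Equiv.Perm.mul_apply, juxt_val_lt, perm_apply_inv, ← h7]
    exact hi

theorem card_not_lt {n t N : ℕ} (h : n + t = N) :
    (Finset.univ.filter fun i : Fin N => ¬ i.1 < n).card = t := by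
  have h1 := Finset.card_filter_add_card_filter_not (s := (Finset.univ : Finset (Fin N)))
    (fun i => i.1 < n)
  have h2 : (Finset.univ.filter fun i : Fin N => i.1 < n).card = n := by
    rw [Fin.card_filter_val_lt]; omega
  rw [h2, Finset.card_univ, Fintype.card_fin] at h1
  omega

theorem overlap_blockSwap {m b c p n t k l N : ℕ} (h1 : m + b = n) (h2 : m + c = k)
    (h3 : c + p = t) (h4 : b + p = l) (h5 : n + t = N) :
    overlap n k (blockSwap m b c N (by omega)) = p := by
  refine Eq.trans ?_ (card_not_lt (n := n + c) (t := p) (N := N) (by omega))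
  rw [overlap]
  congr 1
  ext i
  have := blockSwap_val m b c N (by omega) i
  simp only [Finset.mem_filter, Finset.mem_univ, true_and]
  omega

/-- The numbers of strands with prescribed source and target blocks are determined by the
overlap. -/
theorem card_blocks {n t k l N : ℕ} (h5 : n + t = N) (h6 : k + l = N) (w : Equiv.Perm (Fin N)) :
    (Finset.univ.filter fun i : Fin N => i.1 < n ∧ (w i).1 < k).card + l = n + overlap n k w ∧
    (Finset.univ.filter fun i : Fin N => i.1 < n ∧ ¬ (w i).1 < k).card + overlap n k w = l ∧
    (Finset.univ.filter fun i : Fin N => ¬ i.1 < n ∧ (w i).1 < k).card + overlap n k w = t := by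
  have ht := card_not_lt h5
  have hl : (Finset.univ.filter fun i : Fin N => ¬ (w i).1 < k).card = l := by
    rw [← card_not_lt h6]
    refine Finset.card_bij (fun i _ => w i) (by simp) (fun i _ j _ hij => w.injective hij) ?_
    intro i hi
    exact ⟨w⁻¹ i, by simpa using hi, by simp⟩
  have hn : (Finset.univ.filter fun i : Fin N => i.1 < n).card = n := by
    rw [Fin.card_filter_val_lt]; omega
  -- The four counts form a 2 × 2 table with known margins, so the overlap entry determines the
  -- other three.
  have e1 := Finset.card_filter_add_card_filter_not
    (s := Finset.univ.filter fun i : Fin N => i.1 < n) (fun i => (w i).1 < k)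
  have e2 := Finset.card_filter_add_card_filter_not
    (s := Finset.univ.filter fun i : Fin N => ¬ i.1 < n) (fun i => (w i).1 < k)
  have e3 := Finset.card_filter_add_card_filter_not
    (s := Finset.univ.filter fun i : Fin N => ¬ (w i).1 < k) (fun i => i.1 < n)
  simp only [Finset.filter_filter] at e1 e2 e3
  rw [overlap]
  simp only [and_comm (a := ¬ (w _).1 < k)] at e3
  omega

/-- The overlap is a complete invariant. With equal tables, the strands with a given source and
target block are equally many for w and w', so a bijection e can match them. Then e preserves the
source blocks and w (w' e)⁻¹ the target blocks. -/
theorem exists_perm_of_overlap_eq {n t k l N : ℕ} (h5 : n + t = N) (h6 : k + l = N)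
    (w w' : Equiv.Perm (Fin N)) (h : overlap n k w = overlap n k w') :
    ∃ g g', w = juxt h6 g * w' * juxt h5 g' := by
  obtain ⟨a1, a2, a3⟩ := card_blocks h5 h6 w
  obtain ⟨b1, b2, b3⟩ := card_blocks h5 h6 w'
  have hcard : ∀ z : Bool × Bool,
      Fintype.card {i : Fin N // (decide (i.1 < n), decide ((w i).1 < k)) = z} =
      Fintype.card {i : Fin N // (decide (i.1 < n), decide ((w' i).1 < k)) = z} := by
    rintro ⟨z1, z2⟩
    rw [Fintype.card_subtype, Fintype.card_subtype]
    cases z1 <;> cases z2 <;>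
      simp only [Prod.mk.injEq, decide_eq_true_eq, decide_eq_false_iff_not]
    · exact h
    · omega
    · omega
    · omega
  let e := Equiv.ofFiberEquiv fun z => Fintype.equivOfCardEq (hcard z)
  have he : ∀ i, (decide ((e i).1 < n), decide ((w' (e i)).1 < k)) =
      (decide (i.1 < n), decide ((w i).1 < k)) := fun i =>
    Equiv.ofFiberEquiv_map (fun z => Fintype.equivOfCardEq (hcard z)) i
  have he1 : ∀ i, (e i).1 < n ↔ i.1 < n := fun i => by
    simpa using congrArg Prod.fst (he i)
  have he2 : ∀ i, (w' (e i)).1 < k ↔ (w i).1 < k := fun i => by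
    simpa using congrArg Prod.snd (he i)
  obtain ⟨u, v, huv⟩ := exists_eq_juxt h5 e he1
  obtain ⟨x, y, hxy⟩ := exists_eq_juxt h6 (w * (w' * e)⁻¹) fun i => by
    have := he2 ((w' * e)⁻¹ i)
    have h8 : w' (e ((w' * e)⁻¹ i)) = i := by
      rw [← Equiv.Perm.mul_apply, perm_apply_inv]
    rw [h8] at this
    exact this.symm
  refine ⟨(x, y), (u, v), ?_⟩
  rw [← hxy, ← huv]
  group

/-- The double coset decomposition of permutations. -/
theorem exists_factor {n t k l N : ℕ} (h5 : n + t = N) (h6 : k + l = N) (w : Equiv.Perm (Fin N)) :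
    ∃ (p : ℕ) (_ : p ≤ min l t) (_ : l - p ≤ n), ∃ g g', w = juxt h6 g *
      blockSwap (n - (l - p)) (l - p) (t - p) N (by omega) * juxt h5 g' := by
  obtain ⟨a1, a2, a3⟩ := card_blocks h5 h6 w
  -- The index p is the overlap itself; the bounds p ≤ min l t and l - p ≤ n say that the entries of
  -- the table are nonnegative.
  refine ⟨overlap n k w, by omega, by omega, exists_perm_of_overlap_eq h5 h6 _ _ ?_⟩
  exact (overlap_blockSwap (p := overlap n k w) (l := l) (by omega) (by omega) (by omega) (by omega)
    h5).symm

end Permutations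


/-! ### The Coxeter presentation of the symmetric group -/

section Words

variable {B : Type*} [Monoid B]

/-- The product `T_r T_{r - 1} ⋯` with `j` factors. -/
def descProd (T : ℕ → B) (r : ℕ) : ℕ → B
  | 0 => 1
  | j + 1 => descProd T r j * T (r - j)

variable {T : ℕ → B} {r : ℕ}

/-- All indices occurring in the product are at least r - j + 1, hence exceed i + 1. -/
theorem descProd_mul_far (hfar : ∀ i j, i + 1 < j → j ≤ r → T i * T j = T j * T i) {i : ℕ} (j : ℕ)
    (h : i + j < r) : descProd T r j * T i = T i * descProd T r j := by
  induction j with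
  | zero => simp [descProd]
  | succ j ih =>
    rw [descProd, mul_assoc, ← hfar i (r - j) (by omega) (by omega), ← mul_assoc,
      ih (by omega), mul_assoc]

/-- Here the product contains T_{i+1} T_i. The new T_{i+1} commutes with the later factors, the
braid relation turns it into T_i on the left of this pair, and T_i commutes with the earlier
factors. -/
theorem descProd_mul_braid (hfar : ∀ i j, i + 1 < j → j ≤ r → T i * T j = T j * T i)
    (hbraid : ∀ i, i + 1 ≤ r → T i * T (i + 1) * T i = T (i + 1) * T i * T (i + 1)) {i : ℕ} (j : ℕ)
    (hj : j ≤ r + 1) (h : r < i + j) (hi : i + 1 ≤ r) :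
    descProd T r j * T (i + 1) = T i * descProd T r j := by
  induction j with
  | zero => omega
  | succ j ih =>
    by_cases hij : r < i + j
    · rw [descProd, mul_assoc, hfar (r - j) (i + 1) (by omega) (by omega), ← mul_assoc,
        ih (by omega) hij, mul_assoc]
    · obtain ⟨j, rfl⟩ : ∃ j', j = j' + 1 := ⟨j - 1, by omega⟩
      have e1 : r - (j + 1) = i := by omega
      have e2 : r - j = i + 1 := by omega
      rw [descProd, descProd, e1, e2]
      calc descProd T r j * T (i + 1) * T i * T (i + 1)
          = descProd T r j * (T (i + 1) * T i * T (i + 1)) := by simp only [mul_assoc]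
        _ = descProd T r j * T i * (T (i + 1) * T i) := by
          rw [← hbraid i hi]; simp only [mul_assoc]
        _ = _ := by
          rw [descProd_mul_far hfar j (by omega)]; simp only [mul_assoc]

/-- A monoid generated by `r` elements satisfying the Coxeter relations of the symmetric group has
at most `(r + 1)!` elements. -/
theorem exists_finset_of_coxeter (hsq : ∀ i, i < r → T i * T i = 1)
    (hfar : ∀ i j, i + 1 < j → j < r → T i * T j = T j * T i)
    (hbraid : ∀ i, i + 1 < r → T i * T (i + 1) * T i = T (i + 1) * T i * T (i + 1)) :
    ∃ S : Finset B, S.card ≤ (r + 1).factorial ∧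
      ∀ x ∈ Submonoid.closure (T '' {i | i < r}), x ∈ S := by
  classical
  induction r with
  | zero => exact ⟨{1}, by simp, fun x hx => by simpa using hx⟩
  | succ r ih =>
    obtain ⟨S, hS, hmem⟩ := ih (fun i hi => hsq i (by omega))
      (fun i j h h' => hfar i j h (by omega)) (fun i hi => hbraid i (by omega))
    -- The products with j = 0, …, r + 1 factors play the role of the r + 2 representatives of
    -- cosets of S_{r+1} in S_{r+2}.
    refine ⟨(S ×ˢ Finset.range (r + 2)).image fun z => z.1 * descProd T r z.2, ?_, ?_⟩
    · refine Finset.card_image_le.trans ?_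
      rw [Finset.card_product, Finset.card_range, Nat.factorial_succ (r + 1), mul_comm]
      exact Nat.mul_le_mul_left _ hS
    · have key : ∀ x ∈ Submonoid.closure (T '' {i | i < r + 1}),
          ∃ y ∈ Submonoid.closure (T '' {i | i < r}), ∃ j < r + 2, x = y * descProd T r j := by
        intro x hx
        induction hx using Submonoid.closure_induction_right with
        | one => exact ⟨1, one_mem _, 0, by omega, by simp [descProd]⟩
        | mul_right x _ z hz hx =>
          obtain ⟨i, hi, rfl⟩ := hz
          obtain ⟨y, hy, j, hj, rfl⟩ := hx
          have hi' : i < r + 1 := hi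
          have hT : ∀ i' < r, y * T i' ∈ Submonoid.closure (T '' {i | i < r}) := fun i' h' =>
            mul_mem hy (Submonoid.subset_closure ⟨i', h', rfl⟩)
          -- The last factor of the product has index r - j + 1. A generator with i < r - j passes
          -- to the left unchanged, i = r - j lengthens the product, i = r - j + 1 cancels its last
          -- factor, and a larger i passes to the left as i - 1.
          rcases lt_trichotomy (i + j) r with h | h | h
          · refine ⟨y * T i, hT i (by omega), j, hj, ?_⟩
            rw [mul_assoc, mul_assoc, descProd_mul_far
              (fun i j h h' => hfar i j h (by omega)) j h]
          · refine ⟨y, hy, j + 1, by omega, ?_⟩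
            rw [descProd, mul_assoc, show r - j = i by omega]
          · by_cases h' : i + j = r + 1
            · obtain ⟨j, rfl⟩ : ∃ j', j = j' + 1 := ⟨j - 1, by omega⟩
              refine ⟨y, hy, j, by omega, ?_⟩
              rw [descProd, show r - j = i by omega, mul_assoc, mul_assoc, hsq i hi', mul_one]
            · obtain ⟨i, rfl⟩ : ∃ i', i = i' + 1 := ⟨i - 1, by omega⟩
              refine ⟨y * T i, hT i (by omega), j, hj, ?_⟩
              rw [mul_assoc, mul_assoc, descProd_mul_braid
                (fun i j h h' => hfar i j h (by omega)) (fun i h => hbraid i (by omega)) j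
                (by omega) (by omega) (by omega)]
      intro x hx
      obtain ⟨y, hy, j, hj, rfl⟩ := key x hx
      exact Finset.mem_image.2 ⟨(y, j), Finset.mem_product.2 ⟨hmem y hy, Finset.mem_range.2 hj⟩, rfl⟩

theorem swap_braid {α : Type*} [DecidableEq α] {x y z : α} (hxy : x ≠ y) (hxz : x ≠ z)
    (hyz : y ≠ z) : Equiv.swap x y * Equiv.swap y z * Equiv.swap x y =
      Equiv.swap y z * Equiv.swap x y * Equiv.swap y z := by
  rw [Equiv.swap_mul_swap_mul_swap hxy hxz, Equiv.swap_comm x y, Equiv.swap_comm y z,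
    Equiv.swap_mul_swap_mul_swap hyz.symm hxz.symm, Equiv.swap_comm]

/-- A product of elements satisfying the Coxeter relations along a word in adjacent transpositions
depends only on the permutation which the word expresses. -/
theorem prod_eq_of_prod_transp_eq {n : ℕ} {T : Cross n → B} (hsq : ∀ k, T k * T k = 1)
    (hfar : ∀ k l : Cross n, k.1 + 1 < l.1 → T k * T l = T l * T k)
    (hbraid : ∀ k l : Cross n, k.1 + 1 = l.1 → T k * T l * T k = T l * T k * T l)
    (l l' : List (Cross n)) (h : (l.map KLR.transp).prod = (l'.map KLR.transp).prod) :
    (l.map T).prod = (l'.map T).prod := by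
  classical
  rcases Nat.eq_zero_or_pos n with rfl | hn
  · have : ∀ l : List (Cross 0), l = [] := fun l => by
      cases l with
      | nil => rfl
      | cons a _ => exact absurd a.2 (by omega)
    rw [this l, this l']
  -- Each element is paired with its transposition, so that the monoid generated by the pairs
  -- projects onto S_n. The value 1 beyond the n - 1 crossings is never used.
  let T' : ℕ → B × Equiv.Perm (Fin n) := fun i =>
    if h : i + 1 < n then (T ⟨i, h⟩, KLR.transp ⟨i, h⟩) else 1
  have hT' : ∀ i (h : i + 1 < n), T' i = (T ⟨i, h⟩, KLR.transp ⟨i, h⟩) := fun i h => dif_pos h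
  have hTa : ∀ i, i < n - 1 → T' i * T' i = 1 := by
    intro i hi
    rw [hT' i (by omega)]
    exact Prod.ext (hsq _) (Equiv.swap_mul_self _ _)
  have hTb : ∀ i j, i + 1 < j → j < n - 1 → T' i * T' j = T' j * T' i := by
    intro i j hij hj
    rw [hT' i (by omega), hT' j (by omega)]
    refine Prod.ext (hfar _ _ hij) ?_
    refine (Equiv.Perm.Disjoint.commute ?_).eq
    intro x
    by_cases hx : x.1 = i ∨ x.1 = i + 1
    · right
      refine Equiv.swap_apply_of_ne_of_ne ?_ ?_ <;> simp only [ne_eq, Fin.ext_iff] <;> omega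
    · left
      refine Equiv.swap_apply_of_ne_of_ne ?_ ?_ <;> simp only [ne_eq, Fin.ext_iff] <;> omega
  have hTc : ∀ i, i + 1 < n - 1 → T' i * T' (i + 1) * T' i = T' (i + 1) * T' i * T' (i + 1) := by
    intro i hi
    rw [hT' i (by omega), hT' (i + 1) (by omega)]
    refine Prod.ext (hbraid _ _ rfl) ?_
    have h1 : (⟨i, by omega⟩ : Fin n) ≠ ⟨i + 1, by omega⟩ := by simp
    have h2 : (⟨i, by omega⟩ : Fin n) ≠ ⟨i + 1 + 1, by omega⟩ := by
      simp only [ne_eq, Fin.mk.injEq]; omega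
    have h3 : (⟨i + 1, by omega⟩ : Fin n) ≠ ⟨i + 1 + 1, by omega⟩ := by simp
    change Equiv.swap (⟨i, _⟩ : Fin n) ⟨i + 1, _⟩ * Equiv.swap ⟨i + 1, _⟩ ⟨i + 1 + 1, _⟩ *
      Equiv.swap ⟨i, _⟩ ⟨i + 1, _⟩ = Equiv.swap ⟨i + 1, _⟩ ⟨i + 1 + 1, _⟩ *
      Equiv.swap ⟨i, _⟩ ⟨i + 1, _⟩ * Equiv.swap ⟨i + 1, _⟩ ⟨i + 1 + 1, _⟩
    exact swap_braid h1 h2 h3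
  obtain ⟨S, hS, hmem⟩ := exists_finset_of_coxeter (T := T') (r := n - 1) hTa hTb hTc
  rw [Nat.sub_add_cancel hn] at hS
  set C := Submonoid.closure (T' '' {i | i < n - 1})
  have hword : ∀ l : List (Cross n), ((l.map T).prod, (l.map KLR.transp).prod) ∈ C := by
    intro l
    induction l with
    | nil => exact one_mem C
    | cons a l ih =>
      have h1 : (T a, KLR.transp a) ∈ C :=
        Submonoid.subset_closure ⟨a.1, by have := a.2; simp only [Set.mem_ofPred_eq]; omega,
          hT' a.1 a.2⟩
      simpa using mul_mem h1 ih
  -- The monoid of pairs has at most n! elements and maps onto S_n, so this projection is injective: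
  -- the permutation determines the product in B.
  have himg : (S.filter (· ∈ C)).image Prod.snd = Finset.univ := by
    refine Finset.eq_univ_of_forall fun w => ?_
    obtain ⟨l, rfl⟩ := KLR.exists_word w
    exact Finset.mem_image.2 ⟨_, Finset.mem_filter.2 ⟨hmem _ (hword l), hword l⟩, rfl⟩
  have hinj : Set.InjOn Prod.snd (S.filter (· ∈ C) : Set (B × Equiv.Perm (Fin n))) := by
    have h1 : (S.filter (· ∈ C)).card ≤ n.factorial := (Finset.card_filter_le _ _).trans hS
    have h2 : ((S.filter (· ∈ C)).image Prod.snd).card = n.factorial := by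
      rw [himg, Finset.card_univ, Fintype.card_perm, Fintype.card_fin]
    have := Finset.card_image_iff (s := S.filter (· ∈ C)) (f := Prod.snd)
    exact_mod_cast this.1 (le_antisymm Finset.card_image_le (by rw [h2]; exact h1))
  have := hinj (x₁ := ((l.map T).prod, (l.map KLR.transp).prod))
    (x₂ := ((l'.map T).prod, (l'.map KLR.transp).prod))
    (by simpa using ⟨hmem _ (hword l), hword l⟩) (by simpa using ⟨hmem _ (hword l'), hword l'⟩) h
  exact congrArg Prod.fst this

end Words

namespace KLR

theorem prod_t_eq_tau {n : ℕ} (l : List (Cross n)) :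
    (l.map t).prod = tau (l.map transp).prod :=
  prod_eq_of_prod_transp_eq (fun k => rel (.cross_sq k)) (fun k l h => rel (.cross_cross_far k l h))
    (fun k l h => rel (.braid k l h)) _ _ (exists_word _).choose_spec.symm

/-- The homomorphism `w ↦ τ_w`. -/
def tauHom (n : ℕ) : Equiv.Perm (Fin n) →* KLR n where
  toFun := tau
  map_one' := (prod_t_eq_tau (n := n) []).symm
  map_mul' w w' := by
    obtain ⟨l, rfl⟩ := exists_word w
    obtain ⟨l', rfl⟩ := exists_word w'
    rw [← List.prod_append, ← List.map_append, ← prod_t_eq_tau, ← prod_t_eq_tau, ← prod_t_eq_tau,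
      List.map_append, List.prod_append]

theorem tau_transp {n : ℕ} (k : Cross n) : tau (transp k) = t k := by
  simpa using (prod_t_eq_tau [k]).symm

end KLR


/-! ### Isomorphisms of graded modules -/

section Modules

variable {A : Type} [Ring A] [Algebra ℂ A] {𝒜 : ℤ → Submodule ℂ A}

/-- A bijective degree-preserving linear map is an isomorphism of graded modules. -/
def GrMod.isoOfBijective {M N : GrMod.{u} 𝒜} (f : M ⟶ N) (hf : Function.Bijective f.toLin) :
    M ≅ N where
  hom := f
  inv :=
    { toLin := (LinearEquiv.ofBijective f.toLin hf).symm.toLinearMap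
      map_deg := by
        intro d y hy
        obtain ⟨x, rfl⟩ := hf.2 y
        rw [LinearEquiv.coe_coe, ← LinearEquiv.ofBijective_apply f.toLin (hf := hf),
          LinearEquiv.symm_apply_apply]
        -- The degree d component of the preimage x maps to the degree d component of its image,
        -- which is the whole image; by injectivity x equals that component.
        have h1 := components_map M.isInternal N.isInternal (f.toLin.restrictScalars ℂ)
          f.map_deg x d
        rw [LinearMap.restrictScalars_apply, components_of_mem N.isInternal hy,
          Finsupp.single_eq_same] at h1
        rw [hf.1 h1]
        exact components_mem M.isInternal x d }
  hom_inv_id := GrMod.hom_ext (LinearMap.ext fun x =>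
    (LinearEquiv.ofBijective f.toLin hf).symm_apply_apply x)
  inv_hom_id := GrMod.hom_ext (LinearMap.ext fun x =>
    (LinearEquiv.ofBijective f.toLin hf).apply_symm_apply x)

end Modules

/-! ### Universal properties of induction and restriction -/

namespace Corner

variable {S R : Type} [Ring S] [Algebra ℂ S] [Ring R] [Algebra ℂ R]
  {𝒮 : ℤ → Submodule ℂ S} {ℛ : ℤ → Submodule ℂ R} (c : Corner 𝒮 ℛ)

/-- The map `m ↦ e ⊗ m`. -/
def unit (M : GrMod.{u} 𝒮) : M.carrier →ₗ[ℂ] c.Ind M :=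
  (c.indMk M).restrictScalars ℂ ∘ₗ
    TensorProduct.mk ℂ c.leftIdeal M.carrier ⟨c.e, Submodule.mem_span_singleton_self c.e⟩

theorem smul_unit (M : GrMod.{u} 𝒮) (r : R) (m : M.carrier) :
    r • c.unit M m = c.indMk M ((⟨r * c.e, Submodule.mem_span_singleton.2 ⟨r, rfl⟩⟩ :
      c.leftIdeal) ⊗ₜ[ℂ] m) :=
  rfl

theorem ι_smul_unit (M : GrMod.{u} 𝒮) (s : S) (m : M.carrier) :
    c.ι s • c.unit M m = c.unit M (s • m) := by
  rw [smul_unit]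
  refine Eq.trans ?_ (c.indMk_rightMul M _ s m)
  congr 2
  exact Subtype.ext (c.comm s)

theorem e_smul_unit (he : c.e * c.e = c.e) (M : GrMod.{u} 𝒮) (m : M.carrier) :
    c.e • c.unit M m = c.unit M m := by
  rw [smul_unit]
  change _ = c.indMk M _
  congr 2
  exact Subtype.ext he

/-- The induced module is generated over R by the elements e ⊗ m, since every element of the left
ideal is a multiple of e. -/
theorem ind_induction (M : GrMod.{u} 𝒮) {P : c.Ind M → Prop} (smul : ∀ (r : R) m, P (r • c.unit M m))
    (add : ∀ x y, P x → P y → P (x + y)) (x : c.Ind M) : P x := by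
  obtain ⟨z, rfl⟩ := c.indMk_surjective M x
  induction z using TensorProduct.induction_on with
  | zero => simpa using smul 0 0
  | add x y hx hy => rw [map_add]; exact add _ _ hx hy
  | tmul p m =>
    obtain ⟨⟨p, hp⟩, rfl⟩ : ∃ q : c.leftIdeal, q = p := ⟨p, rfl⟩
    obtain ⟨r, rfl⟩ := Submodule.mem_span_singleton.1 hp
    exact smul r m

section Lift

variable (M : GrMod.{u} 𝒮)

/-- The universal property of `Re ⊗_S M` with respect to `R`-linear maps. -/
def indLift {W : Type*} [AddCommGroup W] [Module ℂ W] [Module R W] [IsScalarTower ℂ R W]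
    (B : M.carrier →ₗ[ℂ] W) (hB : ∀ s m, B (s • m) = c.ι s • B m) : c.Ind M →ₗ[R] W :=
  (c.balanced M).liftQ (TensorProduct.AlgebraTensorModule.lift
    (LinearMap.toSpanSingleton R (M.carrier →ₗ[ℂ] W) B ∘ₗ c.leftIdeal.subtype)) (by
      refine Submodule.span_le.2 ?_
      rintro _ ⟨p, s, m, rfl⟩
      simp [rightMul, hB, mul_smul])

/-- The universal property of `Re ⊗_S M` with respect to linear maps. -/
def indLiftLinear {W : Type*} [AddCommGroup W] [Module ℂ W] (B : R →ₗ[ℂ] M.carrier →ₗ[ℂ] W)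
    (hB : ∀ r s m, B (r * c.ι s) m = B r (s • m)) : c.Ind M →ₗ[ℂ] W :=
  ((c.balanced M).restrictScalars ℂ).liftQ (TensorProduct.lift
    (B ∘ₗ (c.leftIdeal.subtype.restrictScalars ℂ))) (by
      -- The map is only ℂ-linear, but the submodule of relations is already their ℂ-span, so the
      -- relations suffice.
      refine (c.balanced_le M).trans (Submodule.span_le.2 ?_)
      rintro _ ⟨p, s, m, rfl⟩
      simp [rightMul, hB]) ∘ₗ
  (Submodule.Quotient.restrictScalarsEquiv ℂ (c.balanced M)).symm.toLinearMap

end Lift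

theorem unit_mem_indDeg (M : GrMod.{u} 𝒮) {d : ℤ} {m : M.carrier} (hm : m ∈ M.deg d) :
    c.unit M m ∈ c.indDeg M d :=
  Submodule.mem_map_of_mem (f := (c.indMk M).restrictScalars ℂ)
    (Submodule.subset_span ⟨0, d, zero_add d, _, c.e_mem, m, hm, rfl⟩)

/-- The projection `m ↦ em` onto `eM`. -/
def resMk (M : GrMod.{u} ℛ) : M.carrier →ₗ[ℂ] (c.resFunctor.obj M).carrier :=
  (Algebra.lsmul ℂ ℂ M.carrier c.e).rangeRestrict

/-- The inclusion of `eM` into `M`. -/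
def resVal (M : GrMod.{u} ℛ) : (c.resFunctor.obj M).carrier →ₗ[ℂ] M.carrier :=
  (c.eSub M).subtype

theorem resVal_resMk (M : GrMod.{u} ℛ) (m : M.carrier) : c.resVal M (c.resMk M m) = c.e • m :=
  rfl

theorem resVal_smul (M : GrMod.{u} ℛ) (s : S) (m : (c.resFunctor.obj M).carrier) :
    c.resVal M (s • m) = c.ι s • c.resVal M m :=
  rfl

theorem resVal_injective (M : GrMod.{u} ℛ) : Function.Injective (c.resVal M) :=
  Subtype.val_injective

theorem resMk_surjective (M : GrMod.{u} ℛ) : Function.Surjective (c.resMk M) :=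
  LinearMap.surjective_rangeRestrict _

section TensorLift

variable (M : GrMod.{u} 𝒮) (Z : GrSpace) (W : GrMod.{u} ℛ)
  (B : M.carrier →ₗ[ℂ] Z.carrier →ₗ[ℂ] W.carrier) (hB : ∀ s m z, B (s • m) z = c.ι s • B m z)

/-- The map `Re ⊗_S M ⊗ Z → W` given by a bilinear map. -/
def indTensorLin : c.Ind M ⊗[ℂ] Z.carrier →ₗ[R] W.carrier :=
  TensorProduct.AlgebraTensorModule.lift
    (c.indLift M B fun s m => LinearMap.ext fun z => hB s m z)

theorem indTensorLin_mem_deg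
    (hdeg : ∀ a b, ∀ m ∈ M.deg a, ∀ z ∈ Z.deg b, B m z ∈ W.deg (a + b)) (d : ℤ)
    (x : c.Ind M ⊗[ℂ] Z.carrier) (hx : x ∈ tensorDeg (c.indDeg M) Z.deg d) :
    c.indTensorLin M Z W B hB x ∈ W.deg d := by
  induction hx using Submodule.span_induction with
  | zero => rw [map_zero]; exact zero_mem _
  | add x y _ _ hx hy => rw [map_add]; exact add_mem hx hy
  | smul a x _ hx => rw [LinearMap.map_smul_of_tower]; exact Submodule.smul_mem _ a hx
  | mem x hx =>
    obtain ⟨a, b, rfl, y, hy, z, hz, rfl⟩ := hx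
    obtain ⟨y, hy, rfl⟩ := hy
    induction hy using Submodule.span_induction with
    | zero => rw [map_zero, TensorProduct.zero_tmul, map_zero]; exact zero_mem _
    | add x y _ _ hx hy => rw [map_add, TensorProduct.add_tmul, map_add]; exact add_mem hx hy
    | smul a x _ hx =>
      rw [map_smul, ← TensorProduct.smul_tmul', LinearMap.map_smul_of_tower]
      exact Submodule.smul_mem _ a hx
    | mem y hy =>
      obtain ⟨a, a', rfl, p, hp, m, hm, rfl⟩ := hy
      have := W.smul_mem (r := p.1) hp (hdeg a' b m hm z hz)
      rw [← add_assoc] at this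
      exact this

variable [GradedAlgebra 𝒮] [GradedAlgebra ℛ]

/-- The degree-preserving map `Re ⊗_S M ⊗ Z → W` given by a bilinear map. -/
def indTensorLift (hdeg : ∀ a b, ∀ m ∈ M.deg a, ∀ z ∈ Z.deg b, B m z ∈ W.deg (a + b)) :
    (tensorFunctor ℛ Z).obj (c.indFunctor.obj M) ⟶ W where
  toLin := c.indTensorLin M Z W B hB
  map_deg := c.indTensorLin_mem_deg M Z W B hB hdeg

end TensorLift

end Corner


/-- A tower of graded algebras `A n = Q n ⋊ S_n`, where `Q n` is the commutative algebra generated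
by `n` roots of the polynomial `f`, together with graded spaces `Z p` of invariants of `Q p`. -/
structure WreathSystem where
  A : ℕ → Type
  [ringA : ∀ n, Ring (A n)]
  [algebraA : ∀ n, Algebra ℂ (A n)]
  deg : ∀ n, ℤ → Submodule ℂ (A n)
  [gradedAlgebra : ∀ n, GradedAlgebra (deg n)]
  corner : ∀ {m l n : ℕ}, m + l = n → Corner (deg m) (deg n)
  Q : ℕ → Type
  [commRingQ : ∀ n, CommRing (Q n)]
  [algebraQ : ∀ n, Algebra ℂ (Q n)]
  -- The value f = 0 gives free variables and f = X^a truncated ones; `exists_lift` is the universal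
  -- property of Q(n) among commutative algebras.
  f : Polynomial ℂ
  X : ∀ {n : ℕ}, Fin n → Q n
  aeval_X : ∀ {n : ℕ} (i : Fin n), Polynomial.aeval (X i) f = 0
  adjoin_X : ∀ n, Algebra.adjoin ℂ (Set.range (X (n := n))) = ⊤
  exists_lift : ∀ {n : ℕ} {B : Type} [CommRing B] [Algebra ℂ B] (y : Fin n → B),
    (∀ i, Polynomial.aeval (y i) f = 0) → ∃ φ : Q n →ₐ[ℂ] B, ∀ i, φ (X i) = y i
  perm : ∀ {n : ℕ}, Equiv.Perm (Fin n) →* A n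
  pol : ∀ {n : ℕ}, Q n →ₐ[ℂ] A n
  perm_mul_pol_X : ∀ {n : ℕ} (w : Equiv.Perm (Fin n)) (i : Fin n),
    perm w * pol (X i) = pol (X (w i)) * perm w
  -- Together with the next two laws, this makes the permutations a basis of A(n) as a right
  -- Q(n)-module.
  coef : ∀ {n : ℕ}, A n →ₗ[ℂ] Equiv.Perm (Fin n) → Q n
  coef_perm_mul_pol : ∀ {n : ℕ} (w : Equiv.Perm (Fin n)) (q : Q n),
    coef (perm w * pol q) = Pi.single w q
  sum_coef : ∀ {n : ℕ} (r : A n), ∑ w, perm w * pol (coef r w) = r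
  ι_perm : ∀ {m l n : ℕ} (h : m + l = n) (w : Equiv.Perm (Fin m)),
    (corner h).ι (perm w) = perm (juxt h (w, 1))
  ι_pol_X : ∀ {m l n : ℕ} (h : m + l = n) (i : Fin m),
    (corner h).ι (pol (X i)) = pol (X (blk 0 m n (by omega) i))
  e_eq : ∀ {m l n : ℕ} (h : m + l = n),
    (corner h).e = (l.factorial : ℂ)⁻¹ • ∑ w, perm (juxt h (1, w))
  perm_mem : ∀ {n : ℕ} (w : Equiv.Perm (Fin n)), perm w ∈ deg n 0
  Z : ℕ → GrSpace
  incl : ∀ {p : ℕ}, (Z p).carrier →ₗ[ℂ] Q p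
  symm : ∀ {p : ℕ}, Q p →ₗ[ℂ] (Z p).carrier
  symm_incl : ∀ {p : ℕ} (z : (Z p).carrier), symm (incl z) = z
  -- A homomorphism permuting the variables is unique because they generate Q(p); quantifying over φ
  -- is a way of naming this action.
  incl_symm : ∀ {p : ℕ} (φ : Equiv.Perm (Fin p) → Q p →ₐ[ℂ] Q p),
    (∀ σ i, φ σ (X i) = X (σ i)) →
      ∀ q, incl (symm q) = (p.factorial : ℂ)⁻¹ • ∑ σ, φ σ q
  pol_mem : ∀ {p n : ℕ} (j : Fin p → Fin n) (φ : Q p →ₐ[ℂ] Q n), (∀ i, φ (X i) = X (j i)) →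
    ∀ d, ∀ z ∈ (Z p).deg d, pol (φ (incl z)) ∈ deg n d

/-! ### Calculus with permutations, polynomials and idempotents -/

namespace WreathSystem

attribute [instance] ringA algebraA gradedAlgebra commRingQ algebraQ

variable (S : WreathSystem)

/-- The homomorphism `X i ↦ X (j i)`. -/
def map {m n : ℕ} (j : Fin m → Fin n) : S.Q m →ₐ[ℂ] S.Q n :=
  (S.exists_lift (fun i => S.X (j i)) fun i => S.aeval_X (j i)).choose

@[simp]
theorem map_X {m n : ℕ} (j : Fin m → Fin n) (i : Fin m) : S.map j (S.X i) = S.X (j i) :=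
  (S.exists_lift (fun i => S.X (j i)) fun i => S.aeval_X (j i)).choose_spec i

variable {S}

theorem algHom_ext {n : ℕ} {B : Type*} [Semiring B] [Algebra ℂ B] {φ ψ : S.Q n →ₐ[ℂ] B}
    (h : ∀ i, φ (S.X i) = ψ (S.X i)) : φ = ψ :=
  AlgHom.ext_of_adjoin_eq_top (S.adjoin_X n) (by rintro _ ⟨i, rfl⟩; exact h i)

theorem map_map {m n k : ℕ} (j : Fin m → Fin n) (j' : Fin n → Fin k) (q : S.Q m) :
    S.map j' (S.map j q) = S.map (fun i => j' (j i)) q :=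
  AlgHom.congr_fun (φ₁ := (S.map j').comp (S.map j)) (algHom_ext fun i => by simp) q

theorem map_congr {m n : ℕ} {j j' : Fin m → Fin n} (h : ∀ i, j i = j' i) (q : S.Q m) :
    S.map j q = S.map j' q := by
  rw [funext h]

theorem map_id {n : ℕ} (q : S.Q n) : S.map (fun i => i) q = q :=
  AlgHom.congr_fun (φ₂ := AlgHom.id ℂ _) (algHom_ext fun i => by simp) q

theorem map_perm_mul {n : ℕ} (w w' : Equiv.Perm (Fin n)) (q : S.Q n) :
    S.map (w * w') q = S.map w (S.map w' q) := by
  rw [map_map]; rfl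

theorem Q_induction {n : ℕ} {P : S.Q n → Prop} (one : P 1) (add : ∀ q q', P q → P q' → P (q + q'))
    (smul : ∀ (c : ℂ) q, P q → P (c • q)) (mul_X : ∀ q i, P q → P (q * S.X i)) (q : S.Q n) :
    P q := by
  have key : ∀ a ∈ Algebra.adjoin ℂ (Set.range (S.X (n := n))), ∀ q, P q → P (q * a) := by
    intro a ha
    induction ha using Algebra.adjoin_induction with
    | mem x hx => obtain ⟨i, rfl⟩ := hx; exact fun q => mul_X q i
    | algebraMap c =>
      intro q hq
      rw [mul_comm, ← Algebra.smul_def]; exact smul c q hq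
    | add x y _ _ hx hy => intro q hq; rw [mul_add]; exact add _ _ (hx q hq) (hy q hq)
    | mul x y _ _ hx hy => intro q hq; rw [← mul_assoc]; exact hy _ (hx q hq)
  have := key q (by rw [S.adjoin_X]; trivial) 1 one
  rwa [one_mul] at this

/-- Linear identities on A(n) need only be checked on the products w q. -/
theorem A_induction {n : ℕ} {P : S.A n → Prop} (add : ∀ r r', P r → P r' → P (r + r'))
    (mul : ∀ w q, P (S.perm w * S.pol q)) (r : S.A n) : P r := by
  rw [← S.sum_coef r]
  refine Finset.sum_induction _ P add ?_ fun w _ => mul w _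
  simpa using mul 1 0

theorem perm_mul_pol {n : ℕ} (w : Equiv.Perm (Fin n)) (q : S.Q n) :
    S.perm w * S.pol q = S.pol (S.map w q) * S.perm w := by
  induction q using Q_induction with
  | one => simp
  | add q q' h h' => simp only [map_add, mul_add, add_mul, h, h']
  | smul c q h => simp only [map_smul, mul_smul_comm, smul_mul_assoc, h]
  | mul_X q i h =>
    rw [map_mul, map_mul, map_mul, ← mul_assoc, h, mul_assoc, S.perm_mul_pol_X, map_X, mul_assoc]

theorem pol_mul_perm {n : ℕ} (w : Equiv.Perm (Fin n)) (q : S.Q n) :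
    S.pol q * S.perm w = S.perm w * S.pol (S.map (w⁻¹ : Equiv.Perm (Fin n)) q) := by
  rw [perm_mul_pol, ← map_perm_mul, mul_inv_cancel]
  congr 2
  exact (map_id q).symm

theorem ι_pol {m l n : ℕ} (h : m + l = n) (q : S.Q m) :
    (S.corner h).ι (S.pol q) = S.pol (S.map (blk 0 m n (by omega)) q) :=
  AlgHom.congr_fun (φ₁ := (S.corner h).ι.comp S.pol)
    (φ₂ := S.pol.comp (S.map (blk 0 m n (by omega)))) (algHom_ext fun i => by simp [S.ι_pol_X]) q

section Idempotents

variable {m l n : ℕ} (h : m + l = n)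

theorem juxt_mul (u u' : Equiv.Perm (Fin m)) (v v' : Equiv.Perm (Fin l)) :
    juxt h (u, v) * juxt h (u', v') = juxt h (u * u', v * v') := by
  rw [← map_mul]; rfl

theorem perm_mul_e (v : Equiv.Perm (Fin l)) :
    S.perm (juxt h (1, v)) * (S.corner h).e = (S.corner h).e := by
  rw [S.e_eq, mul_smul_comm, Finset.mul_sum]
  congr 1
  refine Fintype.sum_equiv (Equiv.mulLeft v) _ _ fun w => ?_
  rw [← map_mul, juxt_mul, one_mul]; rfl

theorem e_mul_perm (v : Equiv.Perm (Fin l)) :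
    (S.corner h).e * S.perm (juxt h (1, v)) = (S.corner h).e := by
  rw [S.e_eq, smul_mul_assoc, Finset.sum_mul]
  congr 1
  refine Fintype.sum_equiv (Equiv.mulRight v) _ _ fun w => ?_
  rw [← map_mul, juxt_mul, one_mul]; rfl

theorem inv_factorial_smul_sum {V : Type*} [AddCommGroup V] [Module ℂ V] (x : V) :
    (l.factorial : ℂ)⁻¹ • ∑ _w : Equiv.Perm (Fin l), x = x := by
  rw [Finset.sum_const, Finset.card_univ, Fintype.card_perm, Fintype.card_fin,
    ← Nat.cast_smul_eq_nsmul ℂ, smul_smul, inv_mul_cancel₀, one_smul]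
  exact_mod_cast l.factorial_ne_zero

theorem e_mul_e : (S.corner h).e * (S.corner h).e = (S.corner h).e := by
  conv_lhs => rw [S.e_eq, smul_mul_assoc, Finset.sum_mul, ← S.e_eq]
  simp only [perm_mul_e]
  exact inv_factorial_smul_sum _

theorem e_mul_perm_juxt (u : Equiv.Perm (Fin m)) (v : Equiv.Perm (Fin l)) :
    (S.corner h).e * S.perm (juxt h (u, v)) = (S.corner h).ι (S.perm u) * (S.corner h).e := by
  have : juxt h (u, v) = juxt h (1, v) * juxt h (u, 1) := by rw [juxt_mul]; simp
  rw [this, map_mul, ← mul_assoc, e_mul_perm, ← S.ι_perm, (S.corner h).comm]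

/-- The permutations coming from A(m) fix the variables of the last l strands, and the polynomials
commute among themselves. -/
theorem pol_blk_comm (q : S.Q l) (s : S.A m) :
    S.pol (S.map (blk m l n h.le) q) * (S.corner h).ι s =
      (S.corner h).ι s * S.pol (S.map (blk m l n h.le) q) := by
  induction s using A_induction with
  | add r r' h1 h2 => rw [map_add, mul_add, add_mul, h1, h2]
  | mul w q' =>
    have h1 : S.perm (juxt h (w, 1)) * S.pol (S.map (blk m l n h.le) q) =
        S.pol (S.map (blk m l n h.le) q) * S.perm (juxt h (w, 1)) := by
      rw [perm_mul_pol, map_map, map_congr fun i => juxt_right h (w, 1) i]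
      rfl
    rw [map_mul, S.ι_perm, ι_pol, ← mul_assoc, ← h1, mul_assoc, mul_assoc, ← map_mul, ← map_mul,
      mul_comm]

theorem e_smul_unit (M : GrMod.{u} (S.deg m)) (x : M.carrier) :
    (S.corner h).e • (S.corner h).unit M x = (S.corner h).unit M x :=
  (S.corner h).e_smul_unit (e_mul_e h) M x

/-- The factor in S_l is absorbed by the idempotent of e ⊗ x, and the factor in S_m crosses the
tensor sign. -/
theorem perm_smul_unit (M : GrMod.{u} (S.deg m)) (u : Equiv.Perm (Fin m)) (v : Equiv.Perm (Fin l))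
    (x : M.carrier) : S.perm (juxt h (u, v)) • (S.corner h).unit M x =
      (S.corner h).unit M (S.perm u • x) := by
  have : juxt h (u, v) = juxt h (u, 1) * juxt h (1, v) := by rw [juxt_mul]; simp
  rw [← e_smul_unit, smul_smul, this, map_mul, mul_assoc, perm_mul_e, mul_smul, e_smul_unit,
    ← S.ι_perm, (S.corner h).ι_smul_unit]

theorem pol_smul_unit (M : GrMod.{u} (S.deg m)) (q : S.Q m) (x : M.carrier) :
    S.pol (S.map (blk 0 m n (by omega)) q) • (S.corner h).unit M x =
      (S.corner h).unit M (S.pol q • x) := by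
  rw [← ι_pol h, (S.corner h).ι_smul_unit]

theorem e_smul_resVal (M : GrMod.{u} (S.deg n))
    (x : ((S.corner h).resFunctor.obj M).carrier) :
    (S.corner h).e • (S.corner h).resVal M x = (S.corner h).resVal M x := by
  obtain ⟨y, rfl⟩ := (S.corner h).resMk_surjective M x
  rw [(S.corner h).resVal_resMk, smul_smul, e_mul_e]

theorem resMk_resVal (M : GrMod.{u} (S.deg n))
    (x : ((S.corner h).resFunctor.obj M).carrier) :
    (S.corner h).resMk M ((S.corner h).resVal M x) = x :=
  (S.corner h).resVal_injective M (e_smul_resVal h M x)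

theorem ι_smul_resMk (M : GrMod.{u} (S.deg n)) (s : S.A m) (x : M.carrier) :
    s • (S.corner h).resMk M x = (S.corner h).resMk M ((S.corner h).ι s • x) := by
  apply (S.corner h).resVal_injective M
  rw [(S.corner h).resVal_smul, (S.corner h).resVal_resMk, (S.corner h).resVal_resMk, smul_smul,
    smul_smul, (S.corner h).comm]

theorem resMk_e_smul (M : GrMod.{u} (S.deg n)) (x : M.carrier) :
    (S.corner h).resMk M ((S.corner h).e • x) = (S.corner h).resMk M x := by
  apply (S.corner h).resVal_injective M
  rw [(S.corner h).resVal_resMk, (S.corner h).resVal_resMk, smul_smul, e_mul_e]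

/-- Dual to `perm_smul_unit`: multiplication by e absorbs S_l and commutes with the image of A(m).
-/
theorem resMk_perm_smul (M : GrMod.{u} (S.deg n)) (u : Equiv.Perm (Fin m))
    (v : Equiv.Perm (Fin l)) (x : M.carrier) :
    (S.corner h).resMk M (S.perm (juxt h (u, v)) • x) = S.perm u • (S.corner h).resMk M x := by
  rw [ι_smul_resMk, ← resMk_e_smul, smul_smul, e_mul_perm_juxt, mul_smul,
    ← ι_smul_resMk, resMk_e_smul, ι_smul_resMk]

end Idempotents

end WreathSystem


/-! ### The map from F E ⊗ Z to E F -/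

namespace WreathSystem

variable {S : WreathSystem}

section Blocks

variable {m b c p n t k l N : ℕ} (h1 : m + b = n) (h2 : m + c = k) (h3 : c + p = t)
  (h4 : b + p = l) (h5 : n + t = N) (h6 : k + l = N)

include h1 h2 h3 h4 h5 h6

/-- The exchange fixes the first m strands and so carries one embedding of A(m) into A(N) to the
other. This is what makes `forward` balanced over A(m). -/
theorem ι_mul_perm_blockSwap (s : S.A m) :
    (S.corner h6).ι ((S.corner h2).ι s) * S.perm (blockSwap m b c N (by omega)) =
      S.perm (blockSwap m b c N (by omega)) * (S.corner h5).ι ((S.corner h1).ι s) := by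
  induction s using A_induction with
  | add r r' e1 e2 => simp only [map_add, mul_add, add_mul, e1, e2]
  | mul w q =>
    have e1 := blockSwap_mul_juxt h1 h2 h3 h4 h5 h6 w 1 1 1
    rw [Prod.mk_one_one, Prod.mk_one_one, map_one, map_one] at e1
    simp only [map_mul, S.ι_perm, ι_pol, map_map, mul_assoc]
    rw [pol_mul_perm, ← mul_assoc, ← map_mul, ← e1, map_mul, map_map, mul_assoc]
    congr 3
    refine map_congr (fun i => ?_) q
    rw [Equiv.Perm.inv_eq_iff_eq, blockSwap_blk_one h1 h2 h3 h4 h5]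

end Blocks

section Forward

variable {m b c p n t k l N : ℕ} (h1 : m + b = n) (h2 : m + c = k) (h3 : c + p = t)
  (h4 : b + p = l) (h5 : n + t = N) (h6 : k + l = N)

/-- The polynomial `z` placed on the last `p` strands. -/
def lastPol (q : S.Q p) : S.A N :=
  S.pol (S.map (blk n t N h5.le) (S.map (blk c p t h3.le) q))

theorem lastPol_mul_ι (q : S.Q p) (s : S.A n) :
    lastPol h3 h5 q * (S.corner h5).ι s = (S.corner h5).ι s * lastPol h3 h5 q :=
  pol_blk_comm h5 _ s

theorem lastPol_add (q q' : S.Q p) :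
    lastPol h3 h5 (q + q') = lastPol h3 h5 q + lastPol h3 h5 q' := by
  simp only [lastPol, map_add]

theorem lastPol_smul (z : ℂ) (q : S.Q p) : lastPol h3 h5 (z • q) = z • lastPol h3 h5 q := by
  simp only [lastPol, map_smul]

variable (M : GrMod.{u} (S.deg n))

/-- The bilinear map `(x, z) ↦ e w z ⊗ x`, where `w` is the exchange of blocks. -/
def forwardBilin : M.carrier →ₗ[ℂ] (S.Z p).carrier →ₗ[ℂ] (S.corner h5).Ind M :=
  LinearMap.mk₂ ℂ (fun x z => (S.corner h6).e • S.perm (blockSwap m b c N (by omega)) •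
      lastPol h3 h5 (S.incl z) • (S.corner h5).unit M x)
    (fun x x' z => by simp only [map_add, smul_add])
    (fun a x z => by rw [map_smul]; simp only [smul_comm _ a])
    (fun x z z' => by simp only [map_add, lastPol_add, add_smul, smul_add])
    (fun a x z => by simp only [map_smul, lastPol_smul, smul_assoc, smul_comm _ a])

theorem forwardBilin_apply (x : M.carrier) (z : (S.Z p).carrier) :
    forwardBilin h1 h2 h3 h4 h5 h6 M x z =
      (S.corner h6).e • S.perm (blockSwap m b c N (by omega)) •
        lastPol h3 h5 (S.incl z) • (S.corner h5).unit M x :=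
  rfl

/-- The bilinear map `(x, z) ↦ e w z ⊗ x` with values in the graded module `E F M`. -/
def forwardRes : ((S.corner h1).resFunctor.obj M).carrier →ₗ[ℂ] (S.Z p).carrier →ₗ[ℂ]
    ((S.corner h6).resFunctor.obj ((S.corner h5).indFunctor.obj M)).carrier :=
  LinearMap.mk₂ ℂ (fun x z => (⟨forwardBilin h1 h2 h3 h4 h5 h6 M x.1 z, ⟨_, rfl⟩⟩ :
      (S.corner h6).eSub ((S.corner h5).indFunctor.obj M)))
    (fun x x' z => Subtype.ext (LinearMap.map_add₂ (forwardBilin h1 h2 h3 h4 h5 h6 M) x.1 x'.1 z))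
    (fun a x z => Subtype.ext (LinearMap.map_smul₂ (forwardBilin h1 h2 h3 h4 h5 h6 M) a x.1 z))
    (fun x z z' => Subtype.ext (map_add (forwardBilin h1 h2 h3 h4 h5 h6 M x.1) z z'))
    (fun a x z => Subtype.ext (map_smul (forwardBilin h1 h2 h3 h4 h5 h6 M x.1) a z))

/-- An element of A(m) commutes with the polynomial on the last p strands, passes through the
exchange, and commutes with e_l. -/
theorem forwardBilin_ι_smul (s : S.A m) (x : M.carrier) (z : (S.Z p).carrier) :
    forwardBilin h1 h2 h3 h4 h5 h6 M ((S.corner h1).ι s • x) z =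
      (S.corner h6).ι ((S.corner h2).ι s) • forwardBilin h1 h2 h3 h4 h5 h6 M x z := by
  simp only [forwardBilin_apply, ← (S.corner h5).ι_smul_unit, smul_smul]
  congr 1
  rw [lastPol_mul_ι, ← mul_assoc (S.perm _), ← ι_mul_perm_blockSwap h1 h2 h3 h4 h5 h6]
  simp only [← mul_assoc]
  rw [(S.corner h6).comm]

/-- Idempotent and permutation have degree 0, so only x and z contribute to the degree. -/
theorem forwardBilin_mem {d d' : ℤ} {x : M.carrier} (hx : x ∈ M.deg d) {z : (S.Z p).carrier}
    (hz : z ∈ (S.Z p).deg d') : forwardBilin h1 h2 h3 h4 h5 h6 M x z ∈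
      ((S.corner h5).indFunctor.obj M).deg (d + d') := by
  have e1 := (S.corner h5).unit_mem_indDeg M hx
  have e2 : lastPol h3 h5 (S.incl z) ∈ S.deg N d' := by
    rw [lastPol, map_map]
    exact S.pol_mem _ _ (fun i => S.map_X _ i) d' z hz
  have := ((S.corner h5).indFunctor.obj M).smul_mem (S.corner h6).e_mem
    (((S.corner h5).indFunctor.obj M).smul_mem (S.perm_mem (blockSwap m b c N (by omega)))
      (((S.corner h5).indFunctor.obj M).smul_mem e2 e1))
  rw [zero_add, zero_add, add_comm] at this
  exact this

/-- The component `F E M ⊗ Z → E F M` of the isomorphism. -/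
def forward : (tensorFunctor (S.deg k) (S.Z p)).obj
      ((S.corner h2).indFunctor.obj ((S.corner h1).resFunctor.obj M)) ⟶
    (S.corner h6).resFunctor.obj ((S.corner h5).indFunctor.obj M) :=
  (S.corner h2).indTensorLift _ (S.Z p) _ (forwardRes h1 h2 h3 h4 h5 h6 M)
    (fun s x z => Subtype.ext (forwardBilin_ι_smul h1 h2 h3 h4 h5 h6 M s x.1 z))
    (fun _ _ _ hx _ hz => forwardBilin_mem h1 h2 h3 h4 h5 h6 M hx hz)

theorem resVal_forward (r : S.A k) (x : ((S.corner h1).resFunctor.obj M).carrier)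
    (z : (S.Z p).carrier) :
    (S.corner h6).resVal _ ((forward h1 h2 h3 h4 h5 h6 M).toLin
        ((r • (S.corner h2).unit ((S.corner h1).resFunctor.obj M) x) ⊗ₜ z)) =
      (S.corner h6).ι (r * (S.corner h2).e) •
        forwardBilin h1 h2 h3 h4 h5 h6 M ((S.corner h1).resVal M x) z :=
  rfl

end Forward

end WreathSystem


/-! ### The inverse on the block exchange -/

namespace WreathSystem

variable {S : WreathSystem}

/-- The map `(r, z) ↦ (x ↦ φ r x ⊗ ψ z)`. -/
def actTensor {A V Q Q' W : Type*} [Ring A] [Algebra ℂ A] [AddCommGroup V] [Module ℂ V] [Module A V]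
    [IsScalarTower ℂ A V] [AddCommGroup Q] [Module ℂ Q] [AddCommGroup Q'] [Module ℂ Q']
    [AddCommGroup W] [Module ℂ W] (φ : Q →ₗ[ℂ] A) (ψ : Q' →ₗ[ℂ] W) :
    Q ⊗[ℂ] Q' →ₗ[ℂ] V →ₗ[ℂ] V ⊗[ℂ] W :=
  TensorProduct.lift (LinearMap.mk₂ ℂ
    (fun r z => (TensorProduct.mk ℂ V W).flip (ψ z) ∘ₗ Algebra.lsmul ℂ ℂ V (φ r))
    (fun r r' z => by ext x; simp)
    (fun a r z => by ext x; simp [TensorProduct.smul_tmul'])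
    (fun r z z' => by ext x; simp)
    (fun a r z => by ext x; simp))

section Backward

variable {m b c p n t k l N : ℕ} (h1 : m + b = n) (h2 : m + c = k) (h3 : c + p = t)
  (h4 : b + p = l) (h5 : n + t = N) (h6 : k + l = N)

section Split

include h2 h3 h5 in
-- A homomorphism out of Q(N) is a choice of N roots of `f`. The middle c variables are put at the
-- positions m, …, k - 1 of the k strands because the exchange takes them there.
theorem exists_split : ∃ φ : S.Q N →ₐ[ℂ] S.Q n ⊗[ℂ] (S.Q k ⊗[ℂ] S.Q p),
    (∀ i, φ (S.X (blk 0 n N (left_le h5) i)) = S.X i ⊗ₜ 1) ∧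
    (∀ i, φ (S.X (blk n t N h5.le (blk 0 c t (left_le h3) i))) =
      1 ⊗ₜ (S.X (blk m c k h2.le i) ⊗ₜ 1)) ∧
    ∀ i, φ (S.X (blk n t N h5.le (blk c p t h3.le i))) = 1 ⊗ₜ (1 ⊗ₜ S.X i) := by
  let i1 : S.Q n →ₐ[ℂ] S.Q n ⊗[ℂ] (S.Q k ⊗[ℂ] S.Q p) := Algebra.TensorProduct.includeLeft
  let i2 : S.Q k →ₐ[ℂ] S.Q n ⊗[ℂ] (S.Q k ⊗[ℂ] S.Q p) :=
    Algebra.TensorProduct.includeRight.comp Algebra.TensorProduct.includeLeft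
  let i3 : S.Q p →ₐ[ℂ] S.Q n ⊗[ℂ] (S.Q k ⊗[ℂ] S.Q p) :=
    Algebra.TensorProduct.includeRight.comp Algebra.TensorProduct.includeRight
  obtain ⟨φ, hφ⟩ := S.exists_lift (n := N) (B := S.Q n ⊗[ℂ] (S.Q k ⊗[ℂ] S.Q p))
    (fun i => if hi : i.1 < n then i1 (S.X ⟨i.1, hi⟩) else
      if hi' : i.1 < n + c then i2 (S.X ⟨m + (i.1 - n), by omega⟩) else
        i3 (S.X ⟨i.1 - n - c, by omega⟩)) (fun i => by
          split_ifs <;> rw [Polynomial.aeval_algHom_apply, S.aeval_X, map_zero])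
  refine ⟨φ, fun i => ?_, fun i => ?_, fun i => ?_⟩
  · rw [hφ, dif_pos (by simp)]
    change _ = i1 _
    congr 2
    exact Fin.ext (by simp)
  · rw [hφ, dif_neg (by simp), dif_pos (by simp)]
    change _ = i2 _
    congr 2
    exact Fin.ext (by simp)
  · rw [hφ, dif_neg (by simp), dif_neg (by simp)]
    change _ = i3 _
    congr 2
    exact Fin.ext (by simp)

/-- The homomorphism separating the variables on the first `n`, the next `c` and the last `p`
strands, those of the second group being regarded as the last `c` of `k` strands. -/
def split : S.Q N →ₐ[ℂ] S.Q n ⊗[ℂ] (S.Q k ⊗[ℂ] S.Q p) := (exists_split h2 h3 h5).choose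

theorem split_one (i : Fin n) :
    split h2 h3 h5 (S.X (blk 0 n N (left_le h5) i)) = S.X i ⊗ₜ 1 :=
  (exists_split h2 h3 h5).choose_spec.1 i

theorem split_two (i : Fin c) : split h2 h3 h5 (S.X (blk n t N h5.le (blk 0 c t (left_le h3) i))) =
    1 ⊗ₜ (S.X (blk m c k h2.le i) ⊗ₜ 1) :=
  (exists_split h2 h3 h5).choose_spec.2.1 i

theorem split_three (i : Fin p) : split h2 h3 h5 (S.X (blk n t N h5.le (blk c p t h3.le i))) =
    1 ⊗ₜ (1 ⊗ₜ S.X i) :=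
  (exists_split h2 h3 h5).choose_spec.2.2 i

theorem split_map_blk (q : S.Q n) :
    split h2 h3 h5 (S.map (blk 0 n N (left_le h5)) q) = q ⊗ₜ 1 :=
  AlgHom.congr_fun (φ₁ := (split h2 h3 h5).comp (S.map (blk 0 n N (left_le h5))))
    (φ₂ := Algebra.TensorProduct.includeLeft) (algHom_ext fun i => by
      rw [AlgHom.comp_apply, map_X, split_one]; rfl) q

theorem split_map_last (q : S.Q p) :
    split h2 h3 h5 (S.map (blk n t N h5.le) (S.map (blk c p t h3.le) q)) = 1 ⊗ₜ (1 ⊗ₜ q) :=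
  AlgHom.congr_fun (φ₁ := ((split h2 h3 h5).comp (S.map (blk n t N h5.le))).comp
    (S.map (blk c p t h3.le)))
    (φ₂ := (Algebra.TensorProduct.includeRight : _ →ₐ[ℂ] S.Q n ⊗[ℂ] (S.Q k ⊗[ℂ] S.Q p)).comp
      Algebra.TensorProduct.includeRight) (algHom_ext fun i => by
      rw [AlgHom.comp_apply, AlgHom.comp_apply, map_X, map_X, split_three]; rfl) q

theorem split_map_juxt (g1 : Equiv.Perm (Fin m)) (g2 : Equiv.Perm (Fin b))
    (g3 : Equiv.Perm (Fin c)) (g4 : Equiv.Perm (Fin p)) (q : S.Q N) :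
    split h2 h3 h5 (S.map (juxt h5 (juxt h1 (g1, g2), juxt h3 (g3, g4))) q) =
      Algebra.TensorProduct.map (S.map (juxt h1 (g1, g2)))
        (Algebra.TensorProduct.map (S.map (juxt h2 (g1, g3))) (S.map g4)) (split h2 h3 h5 q) := by
  refine AlgHom.congr_fun (φ₁ := (split h2 h3 h5).comp
    (S.map (juxt h5 (juxt h1 (g1, g2), juxt h3 (g3, g4)))))
    (φ₂ := (Algebra.TensorProduct.map (S.map (juxt h1 (g1, g2)))
      (Algebra.TensorProduct.map (S.map (juxt h2 (g1, g3))) (S.map g4))).comp (split h2 h3 h5))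
    (algHom_ext fun i => ?_) q
  rw [AlgHom.comp_apply, AlgHom.comp_apply, map_X]
  obtain ⟨j, rfl⟩ | ⟨j, rfl⟩ := eq_blk_or_eq_blk h5 i
  · rw [juxt_left, split_one, split_one]
    simp
  · rw [juxt_right]
    obtain ⟨j, rfl⟩ | ⟨j, rfl⟩ := eq_blk_or_eq_blk h3 j
    · rw [juxt_left, split_two, split_two]
      simp
    · rw [juxt_right, split_three, split_three]
      simp

end Split

variable (M : GrMod.{u} (S.deg n))

/-- The target of the inverse map. -/
abbrev Summ : Type u :=
  (S.corner h2).Ind ((S.corner h1).resFunctor.obj M) ⊗[ℂ] (S.Z p).carrier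

/-- The map `(q, x) ↦ e ⊗ e q x`. -/
def unitPol : S.Q n →ₗ[ℂ] M.carrier →ₗ[ℂ]
    (S.corner h2).Ind ((S.corner h1).resFunctor.obj M) :=
  LinearMap.mk₂ ℂ (fun q x => (S.corner h2).unit _ ((S.corner h1).resMk M (S.pol q • x)))
    (fun q q' x => by simp only [map_add, add_smul])
    (fun a q x => by simp only [map_smul, smul_assoc])
    (fun q x x' => by simp only [map_add, smul_add])
    (fun a q x => by simp only [map_smul, smul_comm _ a])

theorem unitPol_apply (q : S.Q n) (x : M.carrier) : unitPol h1 h2 M q x =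
    (S.corner h2).unit _ ((S.corner h1).resMk M (S.pol q • x)) :=
  rfl

theorem unitPol_mul (q q' : S.Q n) (x : M.carrier) :
    unitPol h1 h2 M (q * q') x = unitPol h1 h2 M q (S.pol q' • x) := by
  simp only [unitPol_apply, map_mul, mul_smul]

/-- Polynomials on the first m strands come from A(m), over which the tensor product is balanced,
and so move from x to the outside. -/
theorem unitPol_map_mul (q : S.Q m) (q' : S.Q n) (x : M.carrier) :
    unitPol h1 h2 M (S.map (blk 0 m n (left_le h1)) q * q') x =
      S.pol (S.map (blk 0 m k (left_le h2)) q) • unitPol h1 h2 M q' x := by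
  rw [unitPol_apply, unitPol_apply, pol_smul_unit, ι_smul_resMk, ι_pol, map_mul, mul_smul]

/-- S_b is absorbed by the projection to e M and S_c by the idempotent of the induced module; only
g1 acts, and it crosses the tensor product over A(m). Hence g3 may be arbitrary. -/
theorem unitPol_perm (g1 : Equiv.Perm (Fin m)) (g2 : Equiv.Perm (Fin b))
    (g3 : Equiv.Perm (Fin c)) (q : S.Q n) (x : M.carrier) :
    unitPol h1 h2 M (S.map (juxt h1 (g1, g2)) q) (S.perm (juxt h1 (g1, g2)) • x) =
      S.perm (juxt h2 (g1, g3)) • unitPol h1 h2 M q x := by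
  rw [unitPol_apply, unitPol_apply, perm_smul_unit, smul_smul, ← perm_mul_pol, mul_smul,
    resMk_perm_smul]

/-- The map `(r, z) ↦ (x ↦ r x ⊗ z)`. -/
def tensorEval : S.Q k ⊗[ℂ] S.Q p →ₗ[ℂ]
    (S.corner h2).Ind ((S.corner h1).resFunctor.obj M) →ₗ[ℂ] Summ (p := p) h1 h2 M :=
  actTensor S.pol.toLinearMap S.symm

/-- The map `y ⊗ r ⊗ z ↦ (x ↦ (r e ⊗ e y x) ⊗ z)`. -/
def splitEval : S.Q n ⊗[ℂ] (S.Q k ⊗[ℂ] S.Q p) →ₗ[ℂ] M.carrier →ₗ[ℂ] Summ (p := p) h1 h2 M :=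
  TensorProduct.lift (LinearMap.mk₂ ℂ (fun y z => tensorEval h1 h2 M z ∘ₗ unitPol h1 h2 M y)
    (fun y y' z => by rw [map_add, LinearMap.comp_add])
    (fun a y z => by rw [map_smul, LinearMap.comp_smul])
    (fun y z z' => by rw [map_add, LinearMap.add_comp])
    (fun a y z => by rw [map_smul, LinearMap.smul_comp]))

theorem splitEval_tmul (y : S.Q n) (r : S.Q k) (z : S.Q p) (x : M.carrier) :
    splitEval h1 h2 M (y ⊗ₜ (r ⊗ₜ z)) x = (S.pol r • unitPol h1 h2 M y x) ⊗ₜ S.symm z :=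
  rfl

theorem splitEval_induction {P : S.Q n ⊗[ℂ] (S.Q k ⊗[ℂ] S.Q p) → Prop}
    (add : ∀ z z', P z → P z' → P (z + z')) (tmul : ∀ y r z, P (y ⊗ₜ (r ⊗ₜ z)))
    (x : S.Q n ⊗[ℂ] (S.Q k ⊗[ℂ] S.Q p)) : P x := by
  induction x with
  | zero => simpa using tmul 0 0 0
  | add x y hx hy => exact add _ _ hx hy
  | tmul y x =>
    induction x with
    | zero => simpa using tmul 0 0 0
    | add x x' hx hx' => rw [TensorProduct.tmul_add]; exact add _ _ hx hx'
    | tmul r z => exact tmul y r z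

theorem splitEval_mul_left (ξ : S.Q n ⊗[ℂ] (S.Q k ⊗[ℂ] S.Q p)) (q : S.Q n) (x : M.carrier) :
    splitEval h1 h2 M (ξ * (q ⊗ₜ 1)) x = splitEval h1 h2 M ξ (S.pol q • x) := by
  induction ξ using splitEval_induction with
  | add ξ ξ' e e' => simp only [add_mul, map_add, LinearMap.add_apply, e, e']
  | tmul y r z =>
    rw [Algebra.TensorProduct.tmul_mul_tmul, mul_one, splitEval_tmul, splitEval_tmul, unitPol_mul]

/-- Seen from the k strands, the first m variables are recorded in the factor Q(n) and the last c in
the middle factor. This rule and `splitEval_mul_middle` describe the two actions. -/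
theorem splitEval_mul_map (ξ : S.Q n ⊗[ℂ] (S.Q k ⊗[ℂ] S.Q p)) (q : S.Q m) (x : M.carrier) :
    splitEval h1 h2 M (ξ * (S.map (blk 0 m n (left_le h1)) q ⊗ₜ 1)) x =
      S.pol (S.map (blk 0 m k (left_le h2)) q) • splitEval h1 h2 M ξ x := by
  induction ξ using splitEval_induction with
  | add ξ ξ' e e' => simp only [add_mul, map_add, LinearMap.add_apply, smul_add, e, e']
  | tmul y r z =>
    rw [Algebra.TensorProduct.tmul_mul_tmul, mul_one, splitEval_tmul, splitEval_tmul,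
      TensorProduct.smul_tmul', mul_comm y, unitPol_map_mul, smul_smul, smul_smul, ← map_mul,
      ← map_mul, mul_comm]

theorem splitEval_mul_middle (ξ : S.Q n ⊗[ℂ] (S.Q k ⊗[ℂ] S.Q p)) (q : S.Q k) (x : M.carrier) :
    splitEval h1 h2 M (ξ * (1 ⊗ₜ (q ⊗ₜ 1))) x = S.pol q • splitEval h1 h2 M ξ x := by
  induction ξ using splitEval_induction with
  | add ξ ξ' e e' => simp only [add_mul, map_add, LinearMap.add_apply, smul_add, e, e']
  | tmul y r z =>
    rw [Algebra.TensorProduct.tmul_mul_tmul, Algebra.TensorProduct.tmul_mul_tmul, mul_one, mul_one,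
      splitEval_tmul, splitEval_tmul, TensorProduct.smul_tmul', smul_smul, ← map_mul, mul_comm]

/-- Precomposing with g reindexes the average; the comparison is made in Q(p), into which the
invariants embed. -/
theorem symm_map (g : Equiv.Perm (Fin p)) (q : S.Q p) : S.symm (S.map g q) = S.symm q := by
  have h : ∀ q : S.Q p, S.incl (S.symm q) = _ :=
    S.incl_symm (fun σ => S.map σ) (fun σ i => S.map_X _ i)
  rw [← S.symm_incl (S.symm (S.map g q)), ← S.symm_incl (S.symm q), h, h]
  congr 2
  refine Fintype.sum_equiv (Equiv.mulRight g) _ _ fun σ => ?_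
  exact (map_perm_mul σ g q).symm

theorem splitEval_perm (g1 : Equiv.Perm (Fin m)) (g2 : Equiv.Perm (Fin b))
    (g3 : Equiv.Perm (Fin c)) (g4 : Equiv.Perm (Fin p)) (ξ : S.Q n ⊗[ℂ] (S.Q k ⊗[ℂ] S.Q p))
    (x : M.carrier) :
    splitEval h1 h2 M (Algebra.TensorProduct.map (S.map (juxt h1 (g1, g2)))
        (Algebra.TensorProduct.map (S.map (juxt h2 (g1, g3))) (S.map g4)) ξ)
        (S.perm (juxt h1 (g1, g2)) • x) =
      S.perm (juxt h2 (g1, g3)) • splitEval h1 h2 M ξ x := by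
  induction ξ using splitEval_induction with
  | add ξ ξ' e e' => simp only [map_add, LinearMap.add_apply, smul_add, e, e']
  | tmul y r z =>
    rw [Algebra.TensorProduct.map_tmul, Algebra.TensorProduct.map_tmul, splitEval_tmul,
      splitEval_tmul, TensorProduct.smul_tmul', unitPol_perm (g3 := g3), smul_smul, smul_smul,
      perm_mul_pol, symm_map]

/-- The value of the inverse map on the block exchange permutation. -/
def blockEval : S.Q N →ₗ[ℂ] M.carrier →ₗ[ℂ] Summ (p := p) h1 h2 M :=
  splitEval h1 h2 M ∘ₗ (split h2 h3 h5).toLinearMap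

theorem blockEval_apply (q : S.Q N) (x : M.carrier) :
    blockEval h1 h2 h3 h5 M q x = splitEval h1 h2 M (split h2 h3 h5 q) x :=
  rfl

theorem blockEval_mul_map (q : S.Q N) (q' : S.Q n) (x : M.carrier) :
    blockEval h1 h2 h3 h5 M (q * S.map (blk 0 n N (left_le h5)) q') x =
      blockEval h1 h2 h3 h5 M q (S.pol q' • x) := by
  rw [blockEval_apply, map_mul, split_map_blk, splitEval_mul_left, blockEval_apply]

/-- Equivariance under the ambiguity S_m × S_b × S_c × S_p of a factorization: it gives independence
of choices in `cosetEval_of_eq`. -/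
theorem blockEval_perm (g1 : Equiv.Perm (Fin m)) (g2 : Equiv.Perm (Fin b))
    (g3 : Equiv.Perm (Fin c)) (g4 : Equiv.Perm (Fin p)) (q : S.Q N) (x : M.carrier) :
    blockEval h1 h2 h3 h5 M (S.map (juxt h5 (juxt h1 (g1, g2), juxt h3 (g3, g4))) q)
        (S.perm (juxt h1 (g1, g2)) • x) =
      S.perm (juxt h2 (g1, g3)) • blockEval h1 h2 h3 h5 M q x := by
  rw [blockEval_apply, split_map_juxt h1, splitEval_perm, blockEval_apply]

theorem blockEval_last (q : S.Q p) (x : M.carrier) :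
    blockEval h1 h2 h3 h5 M (S.map (blk n t N h5.le) (S.map (blk c p t h3.le) q)) x =
      (S.corner h2).unit _ ((S.corner h1).resMk M x) ⊗ₜ S.symm q := by
  rw [blockEval_apply, split_map_last, splitEval_tmul, unitPol_apply, map_one, map_one, one_smul,
    one_smul]

include h4 in
-- Pulled back through the exchange, a variable on the first k strands lands among the first m or in
-- the block c, where `splitEval_mul_map` and `splitEval_mul_middle` apply.
theorem blockEval_mul_swap (g : S.Q k) (q : S.Q N) (x : M.carrier) :
    blockEval h1 h2 h3 h5 M (q * S.map ((blockSwap m b c N (blockSwap_le h1 h3 h5))⁻¹ : Equiv.Perm _)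
        (S.map (blk 0 k N (left_le h6)) g)) x = S.pol g • blockEval h1 h2 h3 h5 M q x := by
  induction g using Q_induction generalizing q with
  | one => simp
  | add g g' e e' => simp only [map_add, mul_add, LinearMap.add_apply, add_smul, e, e']
  | smul a g e => simp only [map_smul, mul_smul_comm, LinearMap.smul_apply, smul_assoc, e]
  | mul_X g i e =>
    have comm : ∀ y y' : S.Q N, q * (y * y') = q * y' * y := fun y y' => by ring
    rw [map_mul (S.map (blk 0 k N (left_le h6))),
      map_mul (S.map ((blockSwap m b c N (blockSwap_le h1 h3 h5))⁻¹ : Equiv.Perm _)), comm, e,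
      map_mul S.pol, mul_smul]
    congr 1
    rw [map_X, map_X]
    obtain ⟨j, rfl⟩ | ⟨j, rfl⟩ := eq_blk_or_eq_blk h2 i
    · rw [← blockSwap_blk_one h1 h2 h3 h4 h5, perm_inv_apply, blockEval_apply, map_mul,
        split_one, ← S.map_X, splitEval_mul_map, map_X]
      rfl
    · rw [← blockSwap_blk_three h1 h2 h3 h4 h5, perm_inv_apply, blockEval_apply, map_mul,
        split_two, splitEval_mul_middle]
      rfl

end Backward

end WreathSystem


/-! ### The inverse map on a double coset -/

namespace WreathSystem

variable {S : WreathSystem}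

section Inverse

variable {m b c p n t k l N : ℕ} (h1 : m + b = n) (h2 : m + c = k) (h3 : c + p = t)
  (h4 : b + p = l) (h5 : n + t = N) (h6 : k + l = N) (M : GrMod.{u} (S.deg n))

/-- The bilinear map `(q, x) ↦ g Ψ(g' q, g' x)`, where `Ψ` is `blockEval`. -/
def cosetBilin (g : Equiv.Perm (Fin k) × Equiv.Perm (Fin l))
    (g' : Equiv.Perm (Fin n) × Equiv.Perm (Fin t)) :
    S.Q N →ₗ[ℂ] M.carrier →ₗ[ℂ] Summ (p := p) h1 h2 M :=
  LinearMap.mk₂ ℂ (fun q x => S.perm g.1 •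
      blockEval h1 h2 h3 h5 M (S.map (juxt h5 g') q) (S.perm g'.1 • x))
    (fun q q' x => by simp only [map_add, LinearMap.add_apply, smul_add])
    (fun a q x => by simp only [map_smul, LinearMap.smul_apply, smul_comm _ a])
    (fun q x x' => by simp only [map_add, smul_add])
    (fun a q x => by simp only [map_smul, smul_comm _ a])

theorem cosetBilin_apply (g : Equiv.Perm (Fin k) × Equiv.Perm (Fin l))
    (g' : Equiv.Perm (Fin n) × Equiv.Perm (Fin t)) (q : S.Q N) (x : M.carrier) :
    cosetBilin h1 h2 h3 h5 M g g' q x = S.perm g.1 •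
      blockEval h1 h2 h3 h5 M (S.map (juxt h5 g') q) (S.perm g'.1 • x) :=
  rfl

/-- The double coset of the block exchange permutation. -/
def InCoset (w : Equiv.Perm (Fin N)) : Prop :=
  ∃ z : (Equiv.Perm (Fin k) × Equiv.Perm (Fin l)) × (Equiv.Perm (Fin n) × Equiv.Perm (Fin t)),
    w = juxt h6 z.1 * blockSwap m b c N (blockSwap_le h1 h3 h5) * juxt h5 z.2

open Classical in
/-- The value of the inverse map on `w q ⊗ x`. -/
def cosetEval (w : Equiv.Perm (Fin N)) :
    S.Q N →ₗ[ℂ] M.carrier →ₗ[ℂ] Summ (p := p) h1 h2 M :=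
  if h : InCoset h1 h3 h5 h6 w then cosetBilin h1 h2 h3 h5 M h.choose.1 h.choose.2 else 0

include h4 in
-- The chosen factorization may be replaced by any other: the two differ by a four-block
-- permutation, which `blockEval_perm` moves from the right factor to the left one.
theorem cosetEval_of_eq {w : Equiv.Perm (Fin N)} {g : Equiv.Perm (Fin k) × Equiv.Perm (Fin l)}
    {g' : Equiv.Perm (Fin n) × Equiv.Perm (Fin t)}
    (hw : w = juxt h6 g * blockSwap m b c N (blockSwap_le h1 h3 h5) * juxt h5 g') (q : S.Q N)
    (x : M.carrier) : cosetEval h1 h2 h3 h5 h6 M w q x = S.perm g.1 •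
      blockEval h1 h2 h3 h5 M (S.map (juxt h5 g') q) (S.perm g'.1 • x) := by
  have h : InCoset h1 h3 h5 h6 w := ⟨(g, g'), hw⟩
  rw [cosetEval, dif_pos h, cosetBilin_apply]
  have hs := h.choose_spec
  generalize h.choose = z at hs ⊢
  obtain ⟨⟨a, a'⟩, ⟨u, v⟩⟩ := z
  obtain ⟨y, y'⟩ := g
  obtain ⟨u', v'⟩ := g'
  obtain ⟨g1, g2, g3, g4, e1, e2, e3⟩ :=
    blockSwap_factor_unique h1 h2 h3 h4 h5 h6 (hw.symm.trans hs)
  have e4 : juxt h5 (u, v) = juxt h5 (juxt h1 (g1, g2), juxt h3 (g3, g4)) * juxt h5 (u', v') := by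
    rw [juxt_mul, e1, e2]
  dsimp only
  rw [e4, e1, e3, map_perm_mul, map_mul S.perm, mul_smul, blockEval_perm, map_mul S.perm, mul_smul]

theorem cosetEval_of_not {w : Equiv.Perm (Fin N)} (hw : ¬ InCoset h1 h3 h5 h6 w) :
    cosetEval h1 h2 h3 h5 h6 M w = 0 :=
  dif_neg hw

theorem inCoset_mul_juxt {w : Equiv.Perm (Fin N)} {g : Equiv.Perm (Fin n) × Equiv.Perm (Fin t)} :
    InCoset h1 h3 h5 h6 (w * juxt h5 g) ↔ InCoset h1 h3 h5 h6 w := by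
  constructor
  · rintro ⟨z, hz⟩
    refine ⟨(z.1, z.2 * g⁻¹), ?_⟩
    rw [map_mul, ← mul_assoc, ← hz, map_inv, mul_inv_cancel_right]
  · rintro ⟨z, rfl⟩
    exact ⟨(z.1, z.2 * g), by rw [map_mul, ← mul_assoc]⟩

theorem inCoset_juxt_mul {w : Equiv.Perm (Fin N)} {g : Equiv.Perm (Fin k) × Equiv.Perm (Fin l)} :
    InCoset h1 h3 h5 h6 (juxt h6 g * w) ↔ InCoset h1 h3 h5 h6 w := by
  constructor
  · rintro ⟨z, hz⟩
    refine ⟨(g⁻¹ * z.1, z.2), ?_⟩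
    rw [map_mul, mul_assoc, mul_assoc, ← mul_assoc (juxt h6 z.1), ← hz, map_inv,
      inv_mul_cancel_left]
  · rintro ⟨z, rfl⟩
    exact ⟨(g * z.1, z.2), by rw [map_mul]; simp only [mul_assoc]⟩

/-- The bilinear map underlying the inverse. -/
def backBilin : S.A N →ₗ[ℂ] M.carrier →ₗ[ℂ] Summ (p := p) h1 h2 M :=
  ∑ w, cosetEval h1 h2 h3 h5 h6 M w ∘ₗ LinearMap.proj w ∘ₗ S.coef

theorem backBilin_perm_mul_pol (w : Equiv.Perm (Fin N)) (q : S.Q N) :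
    backBilin h1 h2 h3 h5 h6 M (S.perm w * S.pol q) = cosetEval h1 h2 h3 h5 h6 M w q := by
  rw [backBilin, LinearMap.sum_apply, Finset.sum_eq_single w]
  · simp [S.coef_perm_mul_pol]
  · intro w' _ hw'
    simp [S.coef_perm_mul_pol, Pi.single_eq_of_ne hw']
  · simp

include h4 in
theorem backBilin_mul_perm (r : S.A N) (g : Equiv.Perm (Fin n) × Equiv.Perm (Fin t))
    (x : M.carrier) : backBilin h1 h2 h3 h5 h6 M (r * S.perm (juxt h5 g)) x =
      backBilin h1 h2 h3 h5 h6 M r (S.perm g.1 • x) := by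
  induction r using A_induction with
  | add r r' e e' => simp only [add_mul, map_add, LinearMap.add_apply, e, e']
  | mul w q =>
    rw [mul_assoc, pol_mul_perm, ← mul_assoc, ← map_mul, backBilin_perm_mul_pol,
      backBilin_perm_mul_pol]
    by_cases hw : InCoset h1 h3 h5 h6 w
    · obtain ⟨z, hz⟩ := hw
      rw [cosetEval_of_eq h1 h2 h3 h4 h5 h6 M hz,
        cosetEval_of_eq h1 h2 h3 h4 h5 h6 M (w := w * juxt h5 g) (g := z.1) (g' := z.2 * g)
          (by rw [hz, map_mul]; simp only [mul_assoc]),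
        map_mul (juxt h5), ← map_perm_mul, mul_inv_cancel_right, Prod.fst_mul, map_mul, mul_smul]
    · rw [cosetEval_of_not _ _ _ _ _ _ hw,
        cosetEval_of_not _ _ _ _ _ _ (mt (inCoset_mul_juxt h1 h3 h5 h6).1 hw)]
      rfl

include h4 in
theorem backBilin_perm_mul (r : S.A N) (g : Equiv.Perm (Fin k) × Equiv.Perm (Fin l))
    (x : M.carrier) : backBilin h1 h2 h3 h5 h6 M (S.perm (juxt h6 g) * r) x =
      S.perm g.1 • backBilin h1 h2 h3 h5 h6 M r x := by
  induction r using A_induction with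
  | add r r' e e' => simp only [mul_add, map_add, LinearMap.add_apply, smul_add, e, e']
  | mul w q =>
    rw [← mul_assoc, ← map_mul, backBilin_perm_mul_pol, backBilin_perm_mul_pol]
    by_cases hw : InCoset h1 h3 h5 h6 w
    · obtain ⟨z, hz⟩ := hw
      rw [cosetEval_of_eq h1 h2 h3 h4 h5 h6 M hz,
        cosetEval_of_eq h1 h2 h3 h4 h5 h6 M (w := juxt h6 g * w) (g := g * z.1) (g' := z.2)
          (by rw [hz, map_mul]; simp only [mul_assoc]), Prod.fst_mul, map_mul, mul_smul]
    · rw [cosetEval_of_not _ _ _ _ _ _ hw,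
        cosetEval_of_not _ _ _ _ _ _ (mt (inCoset_juxt_mul h1 h3 h5 h6).1 hw)]
      exact (smul_zero _).symm

include h4 in
theorem backBilin_mul_pol (r : S.A N) (q' : S.Q n) (x : M.carrier) :
    backBilin h1 h2 h3 h5 h6 M (r * S.pol (S.map (blk 0 n N (left_le h5)) q')) x =
      backBilin h1 h2 h3 h5 h6 M r (S.pol q' • x) := by
  induction r using A_induction with
  | add r r' e e' => simp only [add_mul, map_add, LinearMap.add_apply, e, e']
  | mul w q =>
    rw [mul_assoc, ← map_mul, backBilin_perm_mul_pol, backBilin_perm_mul_pol]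
    by_cases hw : InCoset h1 h3 h5 h6 w
    · obtain ⟨z, hz⟩ := hw
      rw [cosetEval_of_eq h1 h2 h3 h4 h5 h6 M hz, cosetEval_of_eq h1 h2 h3 h4 h5 h6 M hz, map_mul,
        smul_smul, perm_mul_pol, mul_smul, ← blockEval_mul_map, map_map, map_map]
      congr 4
      exact map_congr (fun i => juxt_left h5 z.2 i) q'
    · rw [cosetEval_of_not _ _ _ _ _ _ hw]
      rfl

include h4 in
-- Balancedness over A(n), by which the map descends to F M; it is checked separately for
-- permutations and for polynomials.
theorem backBilin_mul_ι (r : S.A N) (s : S.A n) (x : M.carrier) :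
    backBilin h1 h2 h3 h5 h6 M (r * (S.corner h5).ι s) x =
      backBilin h1 h2 h3 h5 h6 M r (s • x) := by
  induction s using A_induction with
  | add s s' e e' => simp only [mul_add, map_add, LinearMap.add_apply, add_smul, e, e']
  | mul w q =>
    rw [map_mul (S.corner h5).ι, S.ι_perm, ι_pol, ← mul_assoc, backBilin_mul_pol h1 h2 h3 h4,
      backBilin_mul_perm h1 h2 h3 h4, mul_smul]

include h4 in
-- The idempotent is an average over S_t, which acts trivially from the right, so the map can be
-- evaluated on all of A(N) and not only on the left ideal.
theorem backBilin_mul_e (r : S.A N) (x : M.carrier) :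
    backBilin h1 h2 h3 h5 h6 M (r * (S.corner h5).e) x = backBilin h1 h2 h3 h5 h6 M r x := by
  rw [S.e_eq, mul_smul_comm, Finset.mul_sum, map_smul, map_sum, LinearMap.smul_apply,
    LinearMap.sum_apply]
  simp only [backBilin_mul_perm h1 h2 h3 h4, map_one, one_smul]
  exact inv_factorial_smul_sum _

include h4 in
theorem backBilin_e_mul (r : S.A N) (x : M.carrier) :
    backBilin h1 h2 h3 h5 h6 M ((S.corner h6).e * r) x = backBilin h1 h2 h3 h5 h6 M r x := by
  rw [S.e_eq, smul_mul_assoc, Finset.sum_mul, map_smul, map_sum, LinearMap.smul_apply,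
    LinearMap.sum_apply]
  simp only [backBilin_perm_mul h1 h2 h3 h4, map_one, one_smul]
  exact inv_factorial_smul_sum _

include h4 in
theorem backBilin_swap (q : S.Q N) (x : M.carrier) : backBilin h1 h2 h3 h5 h6 M
    (S.perm (blockSwap m b c N (blockSwap_le h1 h3 h5)) * S.pol q) x =
      blockEval h1 h2 h3 h5 M q x := by
  rw [backBilin_perm_mul_pol, cosetEval_of_eq h1 h2 h3 h4 h5 h6 M (g := 1) (g' := 1)
    (by rw [map_one, map_one, one_mul, mul_one])]
  simp only [map_one, Prod.fst_one, one_smul]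
  rw [show S.map (1 : Equiv.Perm (Fin N)) q = q from map_id q]

include h4 in
-- Linearity over A(k) on the exchange: permutations act through the left factor of the double
-- coset, polynomials are pulled back through the exchange to its right.
theorem backBilin_ι_mul_swap (r : S.A k) (q : S.Q N) (x : M.carrier) :
    backBilin h1 h2 h3 h5 h6 M ((S.corner h6).ι r *
      (S.perm (blockSwap m b c N (blockSwap_le h1 h3 h5)) * S.pol q)) x =
      r • blockEval h1 h2 h3 h5 M q x := by
  induction r using A_induction with
  | add r r' e e' => simp only [add_mul, map_add, LinearMap.add_apply, add_smul, e, e']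
  | mul w g =>
    rw [map_mul (S.corner h6).ι, S.ι_perm, ι_pol, mul_assoc, backBilin_perm_mul h1 h2 h3 h4, ← mul_assoc,
      pol_mul_perm, mul_assoc, ← map_mul, backBilin_swap h1 h2 h3 h4, mul_comm,
      blockEval_mul_swap h1 h2 h3 h4 h5 h6, mul_smul]

/-- The inverse map, defined on all of `F M`. -/
def back : (S.corner h5).Ind M →ₗ[ℂ] Summ (p := p) h1 h2 M :=
  (S.corner h5).indLiftLinear M (backBilin h1 h2 h3 h5 h6 M) (backBilin_mul_ι h1 h2 h3 h4 h5 h6 M)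

theorem back_smul_unit (r : S.A N) (x : M.carrier) :
    back h1 h2 h3 h4 h5 h6 M (r • (S.corner h5).unit M x) = backBilin h1 h2 h3 h5 h6 M r x :=
  backBilin_mul_e h1 h2 h3 h4 h5 h6 M r x

/-- The map `F E M ⊗ Z → F M` underlying `forward`. -/
def forwardLin : Summ (p := p) h1 h2 M →ₗ[ℂ] (S.corner h5).Ind M :=
  (S.corner h6).resVal ((S.corner h5).indFunctor.obj M) ∘ₗ
    (forward h1 h2 h3 h4 h5 h6 M).toLin.restrictScalars ℂ

theorem forwardLin_tmul (r : S.A k) (x : ((S.corner h1).resFunctor.obj M).carrier)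
    (z : (S.Z p).carrier) : forwardLin h1 h2 h3 h4 h5 h6 M
        ((r • (S.corner h2).unit ((S.corner h1).resFunctor.obj M) x) ⊗ₜ z) =
      ((S.corner h6).e * ((S.corner h6).ι (r * (S.corner h2).e) *
        (S.perm (blockSwap m b c N (blockSwap_le h1 h3 h5)) * lastPol h3 h5 (S.incl z)))) •
        (S.corner h5).unit M ((S.corner h1).resVal M x) := by
  refine (resVal_forward h1 h2 h3 h4 h5 h6 M r x z).trans ?_
  rw [forwardBilin_apply, smul_smul, smul_smul, smul_smul, (S.corner h6).comm]
  simp only [mul_assoc]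
  rfl

/-- The idempotent e_l drops out, r e moves to the left by linearity, and z reaches the last tensor
factor, where averaging does not change an invariant. -/
theorem back_forwardLin (ξ : Summ (p := p) h1 h2 M) :
    back h1 h2 h3 h4 h5 h6 M (forwardLin h1 h2 h3 h4 h5 h6 M ξ) = ξ := by
  induction ξ using TensorProduct.induction_on with
  | zero => rw [map_zero, map_zero]
  | add ξ ξ' e e' => rw [map_add, map_add, e, e']
  | tmul y z =>
    induction y using Corner.ind_induction with
    | add y y' e e' => rw [TensorProduct.add_tmul, map_add, map_add, e, e']
    | smul r x =>
      rw [forwardLin_tmul, back_smul_unit, backBilin_e_mul h1 h2 h3 h4, lastPol,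
        backBilin_ι_mul_swap h1 h2 h3 h4, blockEval_last, resMk_resVal, S.symm_incl,
        TensorProduct.smul_tmul', mul_smul, e_smul_unit]

end Inverse

/-- After e_l has dropped out, only permutations in the double coset with overlap p occur in the
image of `forwardLin`; the map `back` for p' vanishes on them. -/
theorem back_forwardLin_of_ne {m b c p m' b' c' p' n t k l N : ℕ} (h1 : m + b = n) (h2 : m + c = k)
    (h3 : c + p = t) (h4 : b + p = l) (h1' : m' + b' = n) (h2' : m' + c' = k) (h3' : c' + p' = t)
    (h4' : b' + p' = l) (h5 : n + t = N) (h6 : k + l = N) (M : GrMod.{u} (S.deg n)) (hp : p' ≠ p)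
    (ξ : Summ (p := p) h1 h2 M) :
    back h1' h2' h3' h4' h5 h6 M (forwardLin h1 h2 h3 h4 h5 h6 M ξ) = 0 := by
  induction ξ using TensorProduct.induction_on with
  | zero => rw [map_zero, map_zero]
  | add ξ ξ' e e' => rw [map_add, map_add, e, e', add_zero]
  | tmul y z =>
    induction y using Corner.ind_induction with
    | add y y' e e' => rw [TensorProduct.add_tmul, map_add, map_add, e, e', add_zero]
    | smul r x =>
      rw [forwardLin_tmul, back_smul_unit, backBilin_e_mul h1' h2' h3' h4', lastPol]
      generalize r * (S.corner h2).e = r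
      induction r using A_induction with
      | add r r' e e' =>
        simp only [add_mul, map_add, LinearMap.add_apply, e, e', add_zero]
      | mul w g =>
        rw [map_mul (S.corner h6).ι, S.ι_perm, ι_pol, mul_assoc,
          backBilin_perm_mul h1' h2' h3' h4', ← mul_assoc (S.pol _), pol_mul_perm, mul_assoc,
          ← map_mul, backBilin_perm_mul_pol, cosetEval_of_not, LinearMap.zero_apply,
          LinearMap.zero_apply, smul_zero]
        rintro ⟨z, hz⟩
        have := congrArg (overlap n k) hz
        rw [overlap_mul h5 h6, overlap_blockSwap h1 h2 h3 h4 h5,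
          overlap_blockSwap h1' h2' h3' h4' h5] at this
        exact hp this.symm

end WreathSystem


/-! ### Surjectivity -/

namespace WreathSystem

variable {S : WreathSystem}

section Surjective

variable {m b c p n t k l N : ℕ} (h1 : m + b = n) (h2 : m + c = k) (h3 : c + p = t)
  (h4 : b + p = l) (h5 : n + t = N) (h6 : k + l = N) (M : GrMod.{u} (S.deg n))

theorem juxt_last (g3 : Equiv.Perm (Fin c)) (g4 : Equiv.Perm (Fin p)) (u : Equiv.Perm (Fin n))
    (q : S.Q p) : S.perm (juxt h5 (u, juxt h3 (g3, g4))) * lastPol h3 h5 q =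
      lastPol h3 h5 (S.map g4 q) * S.perm (juxt h5 (u, juxt h3 (g3, g4))) := by
  rw [lastPol, perm_mul_pol, lastPol]
  congr 2
  rw [map_map, map_map, map_map, map_map]
  refine map_congr (fun i => ?_) q
  rw [juxt_right, juxt_right]

theorem perm_blockSwap_mul (g1 : Equiv.Perm (Fin m)) (g2 : Equiv.Perm (Fin b))
    (g3 : Equiv.Perm (Fin c)) (g4 : Equiv.Perm (Fin p)) :
    S.perm (blockSwap m b c N (blockSwap_le h1 h3 h5)) *
      S.perm (juxt h5 (juxt h1 (g1, g2), juxt h3 (g3, g4))) =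
    S.perm (juxt h6 (juxt h2 (g1, g3), juxt h4 (g2, g4))) *
      S.perm (blockSwap m b c N (blockSwap_le h1 h3 h5)) := by
  rw [← map_mul, ← map_mul, blockSwap_mul_juxt h1 h2 h3 h4 h5 h6]

/-- The element `e w ⊗ x`, where `w` is the exchange of blocks. -/
def swapUnit (q : S.Q N) (x : M.carrier) : (S.corner h5).Ind M :=
  ((S.corner h6).e * (S.perm (blockSwap m b c N (blockSwap_le h1 h3 h5)) * S.pol q)) •
    (S.corner h5).unit M x

include h2 h4 in
-- Moved through the exchange, S_b × S_p becomes a subgroup of S_l and is absorbed by e_l. So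
-- averaging x over S_b and z over S_p changes nothing.
theorem swapUnit_perm (g2 : Equiv.Perm (Fin b)) (g4 : Equiv.Perm (Fin p)) (q : S.Q p)
    (x : M.carrier) :
    ((S.corner h6).e * (S.perm (blockSwap m b c N (blockSwap_le h1 h3 h5)) *
        lastPol h3 h5 (S.map g4 q))) •
      (S.corner h5).unit M (S.perm (juxt h1 (1, g2)) • x) =
    ((S.corner h6).e * (S.perm (blockSwap m b c N (blockSwap_le h1 h3 h5)) *
        lastPol h3 h5 q)) • (S.corner h5).unit M x := by
  rw [← perm_smul_unit h5 M _ (juxt h3 (1, g4)), smul_smul, mul_assoc, mul_assoc,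
    ← juxt_last h3 h5, ← mul_assoc (S.perm _), perm_blockSwap_mul h1 h2 h3 h4 h5 h6,
    Prod.mk_one_one, map_one, mul_assoc, ← mul_assoc (S.corner h6).e, e_mul_perm]

include h4 in
-- In the other direction: S_c, moved through the exchange to the right, becomes a subgroup of S_t
-- and is absorbed by e ⊗ x.
theorem ι_perm_mul_swapUnit (g3 : Equiv.Perm (Fin c)) (q : S.Q p) (x : M.carrier) :
    ((S.corner h6).e * ((S.corner h6).ι (S.perm (juxt h2 (1, g3))) *
        (S.perm (blockSwap m b c N (blockSwap_le h1 h3 h5)) * lastPol h3 h5 q))) •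
      (S.corner h5).unit M x =
    ((S.corner h6).e * (S.perm (blockSwap m b c N (blockSwap_le h1 h3 h5)) *
        lastPol h3 h5 q)) • (S.corner h5).unit M x := by
  have e := perm_blockSwap_mul (S := S) h1 h2 h3 h4 h5 h6 1 1 g3 1
  rw [Prod.mk_one_one, Prod.mk_one_one, map_one, map_one] at e
  rw [S.ι_perm, ← mul_assoc (S.perm _), ← e, mul_assoc, juxt_last,
    show S.map (1 : Equiv.Perm (Fin p)) q = q from map_id q, ← mul_assoc, ← mul_assoc, mul_smul,
    perm_smul_unit, map_one, one_smul, mul_assoc]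

/-- Three averages enter on the left: over S_c in the idempotent of the induced module, over S_b in
e M, and over S_p in the invariants. By the two preceding lemmas each is an average of equal terms,
so a polynomial on the last p strands need not be symmetric to be reached. -/
theorem forwardLin_unit (x : M.carrier) (q : S.Q p) :
    forwardLin h1 h2 h3 h4 h5 h6 M
      ((S.corner h2).unit _ ((S.corner h1).resMk M x) ⊗ₜ S.symm q) =
    swapUnit h1 h3 h5 h6 M (S.map (blk n t N h5.le) (S.map (blk c p t h3.le) q)) x := by
  have h := forwardLin_tmul h1 h2 h3 h4 h5 h6 M 1 ((S.corner h1).resMk M x) (S.symm q)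
  rw [one_smul, one_mul, S.e_eq h2, map_smul, map_sum, smul_mul_assoc, Finset.sum_mul,
    mul_smul_comm, Finset.mul_sum, smul_assoc, Finset.sum_smul] at h
  simp only [ι_perm_mul_swapUnit h1 h2 h3 h4 h5 h6] at h
  rw [inv_factorial_smul_sum, (S.corner h1).resVal_resMk,
    S.incl_symm (fun σ => S.map σ) (fun σ i => S.map_X _ i), lastPol, map_smul, map_sum, map_smul,
    map_sum, map_smul, map_sum, mul_smul_comm, Finset.mul_sum, mul_smul_comm, Finset.mul_sum,
    smul_assoc, Finset.sum_smul, S.e_eq h1, smul_assoc, Finset.sum_smul, map_smul, map_sum] at h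
  rw [h]
  have key : ∀ g4 : Equiv.Perm (Fin p), ((S.corner h6).e *
      (S.perm (blockSwap m b c N (blockSwap_le h1 h3 h5)) *
        S.pol (S.map (blk n t N h5.le) (S.map (blk c p t h3.le) (S.map g4 q))))) •
      (b.factorial : ℂ)⁻¹ • ∑ g2 : Equiv.Perm (Fin b),
        (S.corner h5).unit M (S.perm (juxt h1 (1, g2)) • x) =
      swapUnit h1 h3 h5 h6 M (S.map (blk n t N h5.le) (S.map (blk c p t h3.le) q)) x := by
    intro g4
    rw [smul_comm, Finset.smul_sum]
    refine Eq.trans (congrArg _ (Finset.sum_congr rfl fun g2 _ =>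
      swapUnit_perm h1 h2 h3 h4 h5 h6 M g2 g4 q x)) (inv_factorial_smul_sum _)
  simp only [key]
  exact inv_factorial_smul_sum _

/-- The range of `forwardLin` is stable under `A k`. -/
theorem ι_smul_mem_range (r : S.A k) {y : (S.corner h5).Ind M}
    (hy : y ∈ LinearMap.range (forwardLin h1 h2 h3 h4 h5 h6 M)) :
    (S.corner h6).ι r • y ∈ LinearMap.range (forwardLin h1 h2 h3 h4 h5 h6 M) := by
  obtain ⟨ξ, rfl⟩ := hy
  refine ⟨r • ξ, ?_⟩
  exact congrArg ((S.corner h6).resVal _)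
    ((forward h1 h2 h3 h4 h5 h6 M).toLin.map_smul r ξ)

/-- The variables of q are removed one at a time: on the first n strands they move onto x, on the
middle c they become an action of A(k), which preserves the range, and on the last p they are
collected. -/
theorem swapUnit_mem_range (q : S.Q N) (x : M.carrier) :
    swapUnit h1 h3 h5 h6 M q x ∈ LinearMap.range (forwardLin h1 h2 h3 h4 h5 h6 M) := by
  -- The extra polynomial g collects the variables of the last p strands; it is disposed of at the
  -- end by `forwardLin_unit`.
  suffices h : ∀ (g : S.Q p) (x : M.carrier), swapUnit h1 h3 h5 h6 M
      (q * S.map (blk n t N h5.le) (S.map (blk c p t h3.le) g)) x ∈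
        LinearMap.range (forwardLin h1 h2 h3 h4 h5 h6 M) by simpa using h 1 x
  induction q using Q_induction with
  | one =>
    intro g x
    rw [one_mul, ← forwardLin_unit h1 h2 h3 h4 h5 h6]
    exact ⟨_, rfl⟩
  | add q q' e e' =>
    intro g x
    have := add_mem (e g x) (e' g x)
    rwa [swapUnit, swapUnit, ← add_smul, ← mul_add, ← mul_add, ← map_add, ← add_mul] at this
  | smul a q e =>
    intro g x
    have := Submodule.smul_mem _ a (e g x)
    rwa [swapUnit, ← smul_assoc, ← mul_smul_comm, ← mul_smul_comm, ← map_smul S.pol,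
      ← smul_mul_assoc] at this
  | mul_X q i e =>
    intro g x
    obtain ⟨j, rfl⟩ | ⟨j, rfl⟩ := eq_blk_or_eq_blk h5 i
    · have := e g (S.pol (S.X j) • x)
      rwa [swapUnit, ← pol_smul_unit h5, map_X, smul_smul, mul_assoc, mul_assoc, ← map_mul,
        mul_right_comm] at this
    · obtain ⟨j, rfl⟩ | ⟨j, rfl⟩ := eq_blk_or_eq_blk h3 j
      · have := ι_smul_mem_range h1 h2 h3 h4 h5 h6 M (S.pol (S.X (blk m c k h2.le j))) (e g x)
        rwa [swapUnit, smul_smul, ← mul_assoc ((S.corner h6).ι _), (S.corner h6).comm, S.ι_pol_X,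
          mul_assoc, ← mul_assoc (S.pol _), ← blockSwap_blk_three h1 h2 h3 h4 h5,
          ← S.perm_mul_pol_X, mul_assoc, ← map_mul, mul_left_comm (S.X _) q, ← mul_assoc q] at this
      · have := e (S.X j * g) x
        rwa [map_mul, map_mul, map_X, map_X, ← mul_assoc] at this

include h1 h2 h3 h4 in
-- With w = g s g', the factor g' moves onto q and x, the S_l part of g is absorbed by e_l, and its
-- S_k part preserves the range.
theorem e_smul_perm_mem_range (w : Equiv.Perm (Fin N)) (hw : InCoset h1 h3 h5 h6 w) (q : S.Q N)
    (x : M.carrier) :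
    ((S.corner h6).e * (S.perm w * S.pol q)) • (S.corner h5).unit M x ∈
      LinearMap.range (forwardLin h1 h2 h3 h4 h5 h6 M) := by
  obtain ⟨⟨⟨y, y'⟩, ⟨u, v⟩⟩, rfl⟩ := hw
  have := ι_smul_mem_range h1 h2 h3 h4 h5 h6 M (S.perm y)
    (swapUnit_mem_range h1 h2 h3 h4 h5 h6 M (S.map (juxt h5 (u, v)) q) (S.perm u • x))
  rw [swapUnit, ← perm_smul_unit h5 M u v, smul_smul, smul_smul] at this
  convert this using 2
  simp only [map_mul, mul_assoc]
  rw [← perm_mul_pol, ← mul_assoc, e_mul_perm_juxt, mul_assoc]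

end Surjective

end WreathSystem


/-! ### Finite direct sums and naturality -/

section SumHom

variable {A : Type} [Ring A] [Algebra ℂ A] {𝒜 : ℤ → Submodule ℂ A} {C : Type v} [Category.{u} C]
  {J : Type} [Fintype J] (G : J → (C ⥤ GrMod.{u} 𝒜))

/-- The morphism out of a finite direct sum given by its components. -/
def sumHom {X : C} {W : GrMod.{u} 𝒜} (f : ∀ j, (G j).obj X ⟶ W) :
    (directSumFunctor G).obj X ⟶ W where
  toLin := ∑ j, (f j).toLin ∘ₗ LinearMap.proj j
  map_deg d x hx := by
    rw [LinearMap.sum_apply]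
    exact Submodule.sum_mem _ fun j _ => (f j).map_deg d _ (hx j trivial)

theorem sumHom_apply {X : C} {W : GrMod.{u} 𝒜} (f : ∀ j, (G j).obj X ⟶ W)
    (x : ∀ j, ((G j).obj X).carrier) : (sumHom G f).toLin x = ∑ j, (f j).toLin (x j) :=
  LinearMap.sum_apply _ _ _

theorem sumHom_naturality {F : C ⥤ GrMod.{u} 𝒜} (f : ∀ j, G j ⟶ F) {X Y : C} (g : X ⟶ Y) :
    (directSumFunctor G).map g ≫ sumHom G (fun j => (f j).app Y) =
      sumHom G (fun j => (f j).app X) ≫ F.map g := by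
  refine GrMod.hom_ext (LinearMap.ext fun x => ?_)
  change (sumHom G _).toLin _ = (F.map g).toLin ((sumHom G _).toLin x)
  refine (sumHom_apply G _ _).trans (Eq.trans ?_
    ((congrArg (F.map g).toLin (sumHom_apply G _ x)).trans (map_sum (F.map g).toLin _ _)).symm)
  refine Finset.sum_congr rfl fun j _ => ?_
  exact LinearMap.congr_fun (congrArg GrMod.Hom.toLin ((f j).naturality g)) (x j)

end SumHom

namespace WreathSystem

variable {S : WreathSystem}

section Naturality

variable {m b c p n t k l N : ℕ} (h1 : m + b = n) (h2 : m + c = k) (h3 : c + p = t)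
  (h4 : b + p = l) (h5 : n + t = N) (h6 : k + l = N)

theorem forwardBilin_naturality {M M' : GrMod.{u} (S.deg n)} (f : M ⟶ M') (x : M.carrier)
    (z : (S.Z p).carrier) :
    ((S.corner h5).indFunctor.map f).toLin (forwardBilin h1 h2 h3 h4 h5 h6 M x z) =
      forwardBilin h1 h2 h3 h4 h5 h6 M' (f.toLin x) z := by
  rw [forwardBilin_apply, forwardBilin_apply]
  exact (((S.corner h5).indFunctor.map f).toLin.map_smul _ _).trans (congrArg _
    ((((S.corner h5).indFunctor.map f).toLin.map_smul _ _).trans (congrArg _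
      (((S.corner h5).indFunctor.map f).toLin.map_smul _ _))))

/-- The maps `forward` form a natural transformation. -/
def forwardNat : (S.corner h1).resFunctor ⋙ (S.corner h2).indFunctor ⋙
      tensorFunctor.{u} (S.deg k) (S.Z p) ⟶ (S.corner h5).indFunctor ⋙ (S.corner h6).resFunctor where
  app M := forward h1 h2 h3 h4 h5 h6 M
  naturality M M' f := by
    refine GrMod.hom_ext (LinearMap.ext fun ξ => (S.corner h6).resVal_injective _ ?_)
    let L : Summ (p := p) h1 h2 M →ₗ[ℂ] (S.corner h5).Ind M' :=
      forwardLin h1 h2 h3 h4 h5 h6 M' ∘ₗ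
        (((S.corner h1).resFunctor ⋙ (S.corner h2).indFunctor ⋙
          tensorFunctor.{u} (S.deg k) (S.Z p)).map f).toLin.restrictScalars ℂ
    let L' : Summ (p := p) h1 h2 M →ₗ[ℂ] (S.corner h5).Ind M' :=
      ((S.corner h5).indFunctor.map f).toLin.restrictScalars ℂ ∘ₗ
        forwardLin h1 h2 h3 h4 h5 h6 M
    suffices h : ∀ ξ : Summ (p := p) h1 h2 M, L ξ = L' ξ from h ξ
    intro ξ
    induction ξ using TensorProduct.induction_on with
    | zero => rw [map_zero, map_zero]
    | add ξ ξ' e e' => rw [map_add, map_add, e, e']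
    | tmul y z =>
      induction y using Corner.ind_induction with
      | add y y' e e' => rw [TensorProduct.add_tmul, map_add, map_add, e, e']
      | smul r x =>
        exact ((((S.corner h5).indFunctor.map f).toLin.map_smul _ _).trans (congrArg _
          (forwardBilin_naturality h1 h2 h3 h4 h5 h6 f ((S.corner h1).resVal M x) z))).symm

end Naturality

section Summands

variable {l t n k : ℕ}

/-- The block sizes belonging to p. All truncated subtractions are exact, since p ≤ min l t and l -
p ≤ n. -/
theorem summand_left (p : Summand l t n) : n - (l - p.1.1) + (l - p.1.1) = n := by
  have := p.2
  omega

theorem summand_right (h : k + l = n + t) (p : Summand l t n) :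
    n - (l - p.1.1) + (t - p.1.1) = k := by
  have := p.2
  have := p.1.2
  omega

theorem summand_source (p : Summand l t n) : l - p.1.1 + p.1.1 = l := by
  have := p.1.2
  omega

theorem summand_target (p : Summand l t n) : t - p.1.1 + p.1.1 = t := by
  have := p.1.2
  omega

end Summands

/-! ### Assembly over all double cosets -/

section Main

variable (S) (l t n k : ℕ) (h : k + l = n + t)

/-- The natural transformations `F E ⊗ Z → E F` for all summands. -/
def summandNat (p : Summand l t n) :
    (S.corner (summand_left p)).resFunctor ⋙
      (S.corner (summand_right h p)).indFunctor ⋙ tensorFunctor.{u} _ (S.Z p.1.1) ⟶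
    (S.corner (rfl : n + t = n + t)).indFunctor ⋙ (S.corner h).resFunctor :=
  forwardNat (summand_left p) (summand_right h p) (summand_target p) (summand_source p) rfl h

variable (M : GrMod.{u} (S.deg n))

/-- The map `forwardLin` for all summands. -/
def summandLin (p : Summand l t n) :
    Summ (S := S) (m := n - (l - p.1.1)) (b := l - p.1.1) (c := t - p.1.1) (p := p.1.1) (k := k)
      (summand_left p) (summand_right h p) M →ₗ[ℂ]
      (S.corner (rfl : n + t = n + t)).Ind M :=
  forwardLin _ _ (summand_target p) (summand_source p) rfl h M

/-- Applying `back` for the index q kills every other summand and returns the component of x at q.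
-/
theorem summandLin_eq_zero (x : ∀ _p, Summ _ _ M) (hx : ∑ p, summandLin S l t n k h M p (x p) = 0) :
    x = 0 := by
  funext q
  have e := congrArg (back (S := S) (m := n - (l - q.1.1)) (b := l - q.1.1)
      (c := t - q.1.1) (p := q.1.1) (k := k) (l := l) (summand_left q)
      (summand_right h q) (summand_target q) (summand_source q) rfl h M) hx
  rw [map_zero, map_sum, Finset.sum_eq_single q] at e
  · exact (back_forwardLin _ _ _ _ _ _ M (x q)).symm.trans e
  · intro p _ hp
    refine back_forwardLin_of_ne _ _ _ _ _ _ _ _ _ _ M ?_ _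
    exact fun hpq => hp (Subtype.ext (Fin.ext hpq.symm))
  · exact fun hq => absurd (Finset.mem_univ q) hq

/-- F M is spanned by the elements w q ⊗ x, and each w lies in the double coset of some admissible
p. -/
theorem e_smul_mem_iSup_range (y : (S.corner (rfl : n + t = n + t)).Ind M) :
    (S.corner h).e • y ∈ ⨆ p, LinearMap.range (summandLin S l t n k h M p) := by
  induction y using Corner.ind_induction with
  | add y y' e e' =>
    rw [smul_add]
    exact add_mem e e'
  | smul r x =>
    induction r using A_induction with
    | add r r' e e' =>
      rw [add_smul, smul_add]
      exact add_mem e e'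
    | mul w q =>
      obtain ⟨p, hp, hp', g, g', hw⟩ := exists_factor (rfl : n + t = n + t) h w
      rw [smul_smul]
      exact Submodule.mem_iSup_of_mem (⟨⟨p, by omega⟩, hp'⟩ : Summand l t n)
        (e_smul_perm_mem_range (S := S) (m := n - (l - p)) (b := l - p)
          (c := t - p) (p := p) (k := k) (l := l) (by omega) (by omega) (by omega) (by omega)
          rfl h M w ⟨(g, g'), hw⟩ q x)

theorem resVal_sumHom (x : ∀ _p, Summ _ _ M) :
    (S.corner h).resVal _ ((sumHom _ fun p => (summandNat S l t n k h p).app M).toLin x) =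
      ∑ p, summandLin S l t n k h M p (x p) := by
  refine Eq.trans (congrArg _ (sumHom_apply _
    (fun p => (summandNat S l t n k h p).app M) x)) ?_
  exact map_sum ((S.corner h).resVal _) _ _

theorem bijective_sumHom :
    Function.Bijective (sumHom _ fun p => (summandNat S l t n k h p).app M).toLin := by
  classical
  constructor
  · rw [injective_iff_map_eq_zero]
    intro x hx
    refine summandLin_eq_zero S l t n k h M x ((resVal_sumHom S l t n k h M x).symm.trans ?_)
    exact (congrArg ((S.corner h).resVal _) hx).trans (map_zero _)
  · intro y
    obtain ⟨y, rfl⟩ := (S.corner h).resMk_surjective _ y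
    obtain ⟨v, hv, hy⟩ := (Submodule.mem_iSup_iff_exists_finsupp _ _).1
      (e_smul_mem_iSup_range S l t n k h M y)
    choose x hx using hv
    refine ⟨x, (S.corner h).resVal_injective _ ((resVal_sumHom S l t n k h M x).trans ?_)⟩
    refine Eq.trans ?_ hy
    rw [Finsupp.sum_fintype _ _ fun _ => rfl]
    exact Finset.sum_congr rfl fun p _ => hx p

/-- The decomposition of `E F` for a tower of wreath type. -/
theorem nonempty_iso : Nonempty ((S.corner (rfl : n + t = n + t)).indFunctor.{u} ⋙
      (S.corner h).resFunctor ≅ directSumFunctor fun p : Summand l t n =>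
    (S.corner (summand_left p)).resFunctor ⋙
      (S.corner (summand_right h p)).indFunctor ⋙ tensorFunctor.{u} _ (S.Z p.1.1)) :=
  ⟨(NatIso.ofComponents (fun M => GrMod.isoOfBijective
      (sumHom _ fun p => (summandNat S l t n k h p).app M) (bijective_sumHom S l t n k h M))
    fun {_ _} f => sumHom_naturality _ (summandNat S l t n k h) f).symm⟩

end Main

end WreathSystem


/-! ### Normal forms in R(n) -/

theorem Cross.left_ne_right {n : ℕ} (k : Cross n) : k.left ≠ k.right := by
  simp [Fin.ext_iff]

namespace KLR

@[simp]
theorem transp_left {n : ℕ} (k : Cross n) : transp k k.left = k.right := Equiv.swap_apply_left _ _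

@[simp]
theorem transp_right {n : ℕ} (k : Cross n) : transp k k.right = k.left :=
  Equiv.swap_apply_right _ _

theorem transp_of_ne {n : ℕ} (k : Cross n) {i : Fin n} (h : i ≠ k.left) (h' : i ≠ k.right) :
    transp k i = i :=
  Equiv.swap_apply_of_ne_of_ne h h'

@[simp]
theorem transp_mul_self {n : ℕ} (k : Cross n) : transp k * transp k = 1 := Equiv.swap_mul_self _ _

theorem transp_inv {n : ℕ} (k : Cross n) : (transp k)⁻¹ = transp k := Equiv.swap_inv _ _

theorem transp_comm {n : ℕ} (k l : Cross n) (h : k.1 + 1 < l.1) :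
    transp k * transp l = transp l * transp k := by
  refine (Equiv.Perm.disjoint_iff_disjoint_support.2 ?_).commute
  rw [transp, transp, Equiv.Perm.support_swap k.left_ne_right,
    Equiv.Perm.support_swap l.left_ne_right]
  simp [Fin.ext_iff]
  omega

theorem transp_braid {n : ℕ} (k l : Cross n) (h : k.1 + 1 = l.1) :
    transp k * transp l * transp k = transp l * transp k * transp l := by
  obtain ⟨l, hl⟩ := l
  subst h
  refine Equiv.ext fun i => ?_
  simp only [transp, Equiv.Perm.coe_mul, Function.comp_apply, Equiv.swap_apply_def, Fin.ext_iff]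
  grind

theorem t_mul_x {n : ℕ} (k : Cross n) (i : Fin n) : t k * x i = x (transp k i) * t k := by
  by_cases h : i = k.left
  · subst h
    rw [transp_left]
    exact rel (.cross_dot_left k)
  by_cases h' : i = k.right
  · subst h'
    rw [transp_right]
    exact rel (.cross_dot_right k)
  · rw [transp_of_ne k h h']
    exact rel (.cross_dot_far k i h h')

theorem tau_one {n : ℕ} : tau (1 : Equiv.Perm (Fin n)) = 1 := (tauHom n).map_one

theorem tau_mul {n : ℕ} (w w' : Equiv.Perm (Fin n)) : tau (w * w') = tau w * tau w' :=
  (tauHom n).map_mul w w'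

theorem perm_induction {n : ℕ} {P : Equiv.Perm (Fin n) → Prop} (one : P 1)
    (mul : ∀ k w, P w → P (transp k * w)) (w : Equiv.Perm (Fin n)) : P w := by
  obtain ⟨l, rfl⟩ := exists_word w
  induction l with
  | nil => exact one
  | cons k l h => rw [List.map_cons, List.prod_cons]; exact mul k _ h

theorem tau_mul_x {n : ℕ} (w : Equiv.Perm (Fin n)) (i : Fin n) :
    tau w * x i = x (w i) * tau w := by
  induction w using perm_induction with
  | one => rw [tau_one, one_mul, mul_one]; rfl
  | mul k w h => rw [tau_mul, mul_assoc, h, ← mul_assoc, tau_transp, t_mul_x, mul_assoc]; rfl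

/-- Both sides are multiplicative in w, so agreement on adjacent transpositions suffices. -/
theorem emb_tau {s m n : ℕ} (h : s + m ≤ n) (φ : Equiv.Perm (Fin m) →* Equiv.Perm (Fin n))
    (hφ : ∀ k : Cross m, φ (transp k) = transp ⟨s + k.1, by have := k.2; omega⟩)
    (w : Equiv.Perm (Fin m)) : emb s m n h (tau w) = tau (φ w) := by
  induction w using perm_induction with
  | one => rw [map_one, tau_one, tau_one, map_one]
  | mul k w e =>
    rw [map_mul, tau_mul, tau_mul, map_mul, e, hφ, tau_transp, tau_transp, emb, lift_t]

theorem emb_x {s m n : ℕ} (h : s + m ≤ n) (i : Fin m) : emb s m n h (x i) = x (blk s m n h i) :=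
  lift_x _ _ (fun _ _ hab => rel (rel_shift h hab)) i

theorem juxt_transp_left {m l n : ℕ} (h : m + l = n) (k : Cross m) :
    juxt h (transp k, 1) = transp ⟨0 + k.1, by have := k.2; omega⟩ := by
  refine Equiv.ext fun i => ?_
  obtain ⟨j, rfl⟩ | ⟨j, rfl⟩ := eq_blk_or_eq_blk h i
  · rw [juxt_left]
    simp only [transp, Equiv.swap_apply_def, Fin.ext_iff, blk_val]
    grind [blk_val]
  · rw [juxt_right, transp_of_ne]
    · rfl
    · have := k.2
      simp only [ne_eq, Fin.ext_iff, blk_val]; omega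
    · have := k.2
      simp only [ne_eq, Fin.ext_iff, blk_val]; omega

theorem juxt_transp_right {m l n : ℕ} (h : m + l = n) (k : Cross l) :
    juxt h (1, transp k) = transp ⟨m + k.1, by have := k.2; omega⟩ := by
  refine Equiv.ext fun i => ?_
  obtain ⟨j, rfl⟩ | ⟨j, rfl⟩ := eq_blk_or_eq_blk h i
  · rw [juxt_left, transp_of_ne]
    · rfl
    · have := j.2
      simp only [ne_eq, Fin.ext_iff, blk_val]; omega
    · have := j.2
      simp only [ne_eq, Fin.ext_iff, blk_val]; omega
  · rw [juxt_right]
    simp only [transp, Equiv.swap_apply_def, Fin.ext_iff, blk_val]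
    grind [blk_val]

theorem emb_tau_left {m l n : ℕ} (h : m + l = n) (w : Equiv.Perm (Fin m)) :
    emb 0 m n (left_le h) (tau w) = tau (juxt h (w, 1)) :=
  emb_tau _ ((juxt h).comp (MonoidHom.inl _ _)) (juxt_transp_left h) w

theorem emb_tau_right {m l n : ℕ} (h : m + l = n) (w : Equiv.Perm (Fin l)) :
    emb m l n h.le (tau w) = tau (juxt h (1, w)) :=
  emb_tau _ ((juxt h).comp (MonoidHom.inr _ _)) (juxt_transp_right h) w

theorem emb_sym {m l n : ℕ} (h : m + l = n) :
    emb m l n h.le (sym l) = (l.factorial : ℂ)⁻¹ • ∑ w, tau (juxt h (1, w)) := by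
  rw [sym, map_smul, map_sum]
  simp only [emb_tau_right h]

theorem tau_mem {n : ℕ} (w : Equiv.Perm (Fin n)) : tau w ∈ deg n 0 := by
  have := word_mem (gen n) (genDeg n) ((exists_word w).choose.map Sum.inr)
  simpa [tau, gen, genDeg, Function.comp_def, deg] using this

theorem x_mem {n : ℕ} (i : Fin n) : x i ∈ deg n 2 := by
  simpa [gen, genDeg, deg] using word_mem (gen n) (genDeg n) [Sum.inl i]

/-- Evaluation of polynomials needs a commutative target, so `pol` passes through the subalgebra
generated by the dots. -/
theorem isMulCommutative_dots (n : ℕ) :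
    IsMulCommutative (Algebra.adjoin ℂ (Set.range (x (n := n)))) :=
  Algebra.isMulCommutative_adjoin ℂ (by
    rintro _ ⟨i, rfl⟩ _ ⟨j, rfl⟩
    exact rel (.dot_dot i j))

open scoped IsMulCommutative in
/-- The homomorphism from polynomials to `R(n)`. -/
def pol (n : ℕ) : MvPolynomial (Fin n) ℂ →ₐ[ℂ] KLR n :=
  haveI := isMulCommutative_dots n
  (Algebra.adjoin ℂ (Set.range (x (n := n)))).val.comp
    (MvPolynomial.aeval (R := ℂ) (S₁ := Algebra.adjoin ℂ (Set.range (x (n := n)))) fun i => ⟨x i, Algebra.subset_adjoin ⟨i, rfl⟩⟩)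

@[simp]
theorem pol_X {n : ℕ} (i : Fin n) : pol n (MvPolynomial.X i) = x i := by
  simp [pol]

-- The span of the elements τ_w f contains 1 and is stable under left multiplication by the
-- generators: a crossing changes w, and a dot is moved through τ_w into f. Hence it is everything.
@[elab_as_elim]
theorem induction {n : ℕ} {P : KLR n → Prop} (add : ∀ r r', P r → P r' → P (r + r'))
    (smul : ∀ (c : ℂ) r, P r → P (c • r)) (mul : ∀ w f, P (tau w * pol n f)) (r : KLR n) : P r := by
  let N : Submodule ℂ (KLR n) :=
    Submodule.span ℂ (Set.range fun p : Equiv.Perm (Fin n) × MvPolynomial (Fin n) ℂ =>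
      tau p.1 * pol n p.2)
  have hgen : ∀ i, ∀ s ∈ N, gen n i * s ∈ N := by
    intro i s hs
    induction hs using Submodule.span_induction with
    | zero => rw [mul_zero]; exact zero_mem _
    | add s s' _ _ h h' => rw [mul_add]; exact add_mem h h'
    | smul c s _ h => rw [mul_smul_comm]; exact Submodule.smul_mem _ c h
    | mem s hs =>
      obtain ⟨⟨w, f⟩, rfl⟩ := hs
      refine Submodule.subset_span ?_
      cases i with
      | inl i =>
        refine ⟨(w, MvPolynomial.X (w⁻¹ i) * f), ?_⟩
        simp only [gen, Sum.elim_inl]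
        rw [map_mul, pol_X, ← mul_assoc, tau_mul_x, perm_apply_inv, mul_assoc]
      | inr k =>
        refine ⟨(transp k * w, f), ?_⟩
        simp only [gen, Sum.elim_inr]
        rw [tau_mul, tau_transp, mul_assoc]
  have hN : ∀ r ∈ Algebra.adjoin ℂ (Set.range (gen n)), ∀ s ∈ N, r * s ∈ N := by
    intro r hr
    induction hr using Algebra.adjoin_induction with
    | mem r hr => obtain ⟨i, rfl⟩ := hr; exact hgen i
    | algebraMap c =>
      intro s hs
      rw [← Algebra.smul_def]; exact Submodule.smul_mem _ c hs
    | add r r' _ _ h h' => intro s hs; rw [add_mul]; exact add_mem (h s hs) (h' s hs)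
    | mul r r' _ _ h h' => intro s hs; rw [mul_assoc]; exact h _ (h' s hs)
  have hr : r ∈ N := by
    have := hN r (by rw [adjoin_gen]; trivial) 1
      (Submodule.subset_span ⟨(1, 1), by simp only [tau_one, map_one, mul_one]⟩)
    rwa [mul_one] at this
  induction hr using Submodule.span_induction with
  | zero => simpa using mul 1 0
  | add s s' _ _ h h' => exact add _ _ h h'
  | smul c s _ h => exact smul c _ h
  | mem s hs => obtain ⟨⟨w, f⟩, rfl⟩ := hs; exact mul w f

section Representation

variable {n : ℕ} {Q : Type} [CommRing Q] [Algebra ℂ Q] (X : Fin n → Q)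

/-- Multiplication by `X` twisted by permutations. -/
def dotOp (i : Fin n) : Module.End ℂ (Equiv.Perm (Fin n) → Q) :=
  LinearMap.pi fun w => LinearMap.mulLeft ℂ (X (w⁻¹ i)) ∘ₗ LinearMap.proj w

theorem dotOp_apply (i : Fin n) (F : Equiv.Perm (Fin n) → Q) (w : Equiv.Perm (Fin n)) :
    dotOp X i F w = X (w⁻¹ i) * F w :=
  rfl

theorem dotOp_pow_apply (i : Fin n) (a : ℕ) (F : Equiv.Perm (Fin n) → Q)
    (w : Equiv.Perm (Fin n)) : (dotOp X i ^ a) F w = X (w⁻¹ i) ^ a * F w := by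
  induction a generalizing F with
  | zero => rw [pow_zero, pow_zero, one_mul]; rfl
  | succ a h => rw [pow_succ, Module.End.mul_apply, h, dotOp_apply, ← mul_assoc, ← pow_succ]

variable (Q) in
/-- Translation by an adjacent transposition. -/
def crossOp (k : Cross n) : Module.End ℂ (Equiv.Perm (Fin n) → Q) :=
  LinearMap.funLeft ℂ Q fun w => transp k * w

theorem crossOp_apply (k : Cross n) (F : Equiv.Perm (Fin n) → Q) (w : Equiv.Perm (Fin n)) :
    crossOp Q k F w = F (transp k * w) :=
  rfl

/-- The representation of `R(n)` on functions on the symmetric group. -/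
def rep : KLR n →ₐ[ℂ] Module.End ℂ (Equiv.Perm (Fin n) → Q) :=
  lift (dotOp X) (crossOp Q) (by
    intro r s h
    refine LinearMap.ext fun F => funext fun w => ?_
    cases h <;> simp only [Module.End.mul_apply, Module.End.one_apply, dotOp_apply,
      crossOp_apply, mul_inv_rev, Equiv.Perm.mul_apply, transp_inv, transp_left, transp_right,
      ← mul_assoc, transp_mul_self, one_mul]
    case dot_dot k l => rw [mul_comm (X _)]
    case cross_dot_far k l h h' => rw [transp_of_ne k h h']
    case cross_cross_far k l h => rw [transp_comm k l h]
    case braid k l h => rw [transp_braid k l h])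

theorem rep_tau (w : Equiv.Perm (Fin n)) (F : Equiv.Perm (Fin n) → Q) (v : Equiv.Perm (Fin n)) :
    rep X (tau w) F v = F (w⁻¹ * v) := by
  induction w using perm_induction generalizing F v with
  | one => rw [tau_one, map_one, inv_one, one_mul]; rfl
  | mul k w h =>
    rw [tau_mul, map_mul, Module.End.mul_apply, tau_transp, rep, lift_t, crossOp_apply, ← rep, h,
      mul_inv_rev, transp_inv, mul_assoc]

/-- At the identity permutation the twist disappears, so polynomials act on functions supported
there by plain multiplication. -/
theorem rep_pol (f : MvPolynomial (Fin n) ℂ) (q : Q) :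
    rep X (pol n f) (Pi.single 1 q) = Pi.single 1 (MvPolynomial.aeval X f * q) := by
  induction f using MvPolynomial.induction_on generalizing q with
  | C c =>
    rw [← MvPolynomial.algebraMap_eq, AlgHom.commutes, AlgHom.commutes, AlgHom.commutes,
      ← Algebra.smul_def]
    exact (Pi.single_smul (f := fun _ : Equiv.Perm (Fin n) => Q) 1 c q).symm
  | add f g h h' =>
    rw [map_add, map_add, map_add, LinearMap.add_apply, h, h', ← Pi.single_add, add_mul]
  | mul_X f i h =>
    have e : rep X (x i) (Pi.single 1 q) = Pi.single 1 (X i * q) := by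
      rw [rep, lift_x]
      funext w
      rw [dotOp_apply]
      by_cases hw : w = 1
      · subst hw; simp
      · rw [Pi.single_eq_of_ne hw, Pi.single_eq_of_ne hw, mul_zero]
    rw [map_mul, map_mul, Module.End.mul_apply, pol_X, e, h, map_mul, MvPolynomial.aeval_X,
      mul_assoc]

/-- A function F stands for the formal sum of w F(w). Acting on the function supported at 1 reads
off the coefficients of an element; this is the independence of the τ_w over polynomials. -/
theorem rep_tau_mul_pol (w : Equiv.Perm (Fin n)) (f : MvPolynomial (Fin n) ℂ) :
    rep X (tau w * pol n f) (Pi.single 1 1) = Pi.single w (MvPolynomial.aeval X f) := by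
  rw [map_mul, Module.End.mul_apply, rep_pol, mul_one]
  funext v
  rw [rep_tau, Pi.single_apply, Pi.single_apply]
  simp only [inv_mul_eq_one, eq_comm]

end Representation

end KLR

/-! ### Degrees of polynomials and averaging over permutations -/

theorem map_polyDeg_mem {p : ℕ} {B : Type*} [Ring B] [Algebra ℂ B] (ℬ : ℤ → Submodule ℂ B)
    [SetLike.GradedMonoid ℬ] (ψ : MvPolynomial (Fin p) ℂ →ₐ[ℂ] B)
    (hψ : ∀ i, ψ (MvPolynomial.X i) ∈ ℬ 2) {d : ℤ} {f : MvPolynomial (Fin p) ℂ}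
    (hf : f ∈ polyDeg p d) : ψ f ∈ ℬ d := by
  have hf' : MvPolynomial.IsWeightedHomogeneous (fun _ : Fin p => (2 : ℤ)) f d := hf
  have key : ∀ m c, ψ (MvPolynomial.monomial m c) ∈ ℬ (Finsupp.weight (fun _ => (2 : ℤ)) m) := by
    intro m c
    induction m using Finsupp.induction_linear generalizing c with
    | zero =>
      have : (MvPolynomial.monomial 0 c : MvPolynomial (Fin p) ℂ) = algebraMap ℂ _ c := rfl
      rw [this, AlgHom.commutes, map_zero, Algebra.algebraMap_eq_smul_one]
      exact Submodule.smul_mem _ c SetLike.GradedOne.one_mem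
    | add f g hf hg =>
      have : (MvPolynomial.monomial (f + g) c : MvPolynomial (Fin p) ℂ) =
          MvPolynomial.monomial f c * MvPolynomial.monomial g 1 := by
        rw [MvPolynomial.monomial_mul, mul_one]
      rw [this, map_mul, map_add]
      exact SetLike.GradedMul.mul_mem (hf c) (hg 1)
    | single k r =>
      have : (MvPolynomial.monomial (Finsupp.single k r) c : MvPolynomial (Fin p) ℂ) =
          c • MvPolynomial.X k ^ r := by
        rw [MvPolynomial.X_pow_eq_monomial, MvPolynomial.smul_monomial, smul_eq_mul, mul_one]
      rw [this, map_smul, map_pow, Finsupp.weight_apply, Finsupp.sum_single_index (zero_smul ℕ (2 : ℤ))]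
      exact Submodule.smul_mem _ c (SetLike.pow_mem_graded r (hψ k))
  rw [MvPolynomial.as_sum f, map_sum]
  refine Submodule.sum_mem _ fun m hm => ?_
  rw [← hf' (MvPolynomial.mem_support_iff.1 hm)]
  exact key _ _

theorem sum_mul_single {G Q B : Type*} [Fintype G] [DecidableEq G] [Ring Q] [Ring B] [Algebra ℂ Q]
    [Algebra ℂ B] (f : G → B) (φ : Q →ₐ[ℂ] B) (w : G) (q : Q) :
    ∑ v, f v * φ ((Pi.single w q : G → Q) v) = f w * φ q := by
  rw [Finset.sum_eq_single w, Pi.single_eq_same]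
  · intro v _ hv
    rw [Pi.single_eq_of_ne hv, map_zero, mul_zero]
  · exact fun h => absurd (Finset.mem_univ w) h

section Average

variable {p : ℕ} {Q : Type*} [CommRing Q] [Algebra ℂ Q] (ρ : Equiv.Perm (Fin p) → Q →ₐ[ℂ] Q)
  (hρ : ∀ σ τ q, ρ σ (ρ τ q) = ρ (σ * τ) q) (W : Subalgebra ℂ Q)
  (hW : ∀ q, q ∈ W ↔ ∀ σ, ρ σ q = q)

/-- The average over the symmetric group. -/
def average : Q →ₗ[ℂ] W :=
  LinearMap.codRestrict (Subalgebra.toSubmodule W)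
    ((p.factorial : ℂ)⁻¹ • ∑ σ, (ρ σ).toLinearMap) (fun q => (hW _).2 fun σ => by
      simp only [LinearMap.smul_apply, LinearMap.sum_apply, AlgHom.toLinearMap_apply, map_smul,
        map_sum, hρ]
      congr 1
      exact Fintype.sum_equiv (Equiv.mulLeft σ) _ _ fun _ => rfl)

theorem val_average (q : Q) :
    (average ρ hρ W hW q : Q) = (p.factorial : ℂ)⁻¹ • ∑ σ, ρ σ q := by
  change ((p.factorial : ℂ)⁻¹ • ∑ σ, (ρ σ).toLinearMap) q = _
  rw [LinearMap.smul_apply, LinearMap.sum_apply]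
  rfl

theorem average_val (z : W) : average ρ hρ W hW z = z := by
  refine Subtype.ext ?_
  rw [val_average, Finset.sum_congr rfl fun σ _ => (hW _).1 z.2 σ]
  simp only [Finset.sum_const, Finset.card_univ, Fintype.card_perm, Fintype.card_fin,
    ← Nat.cast_smul_eq_nsmul ℂ, smul_smul]
  rw [inv_mul_cancel₀ (Nat.cast_ne_zero.2 p.factorial_ne_zero), one_smul]

end Average


/-! ### The tower R(n) -/

namespace KLR

/-- The coefficients of an element of `R(n)` in the basis of permutations over polynomials in the
elements `X i` of a commutative algebra. -/
def coef {n : ℕ} {Q : Type} [CommRing Q] [Algebra ℂ Q] (X : Fin n → Q) :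
    KLR n →ₗ[ℂ] Equiv.Perm (Fin n) → Q :=
  LinearMap.applyₗ (Pi.single 1 1) ∘ₗ (rep X).toLinearMap

theorem coef_tau_mul_pol {n : ℕ} {Q : Type} [CommRing Q] [Algebra ℂ Q] (X : Fin n → Q)
    (w : Equiv.Perm (Fin n)) (f : MvPolynomial (Fin n) ℂ) :
    coef X (tau w * pol n f) = Pi.single w (MvPolynomial.aeval X f) :=
  rep_tau_mul_pol X w f

theorem average_rename_apply (p : ℕ) (σ τ : Equiv.Perm (Fin p)) (q : MvPolynomial (Fin p) ℂ) :
    MvPolynomial.rename σ (MvPolynomial.rename τ q) = MvPolynomial.rename (σ * τ) q :=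
  MvPolynomial.rename_rename _ _ _

/-- The algebras `R(n)` form a tower of wreath type. -/
def system : WreathSystem where
  A := KLR
  deg := deg
  corner := corner
  Q n := MvPolynomial (Fin n) ℂ
  -- Every element is a root of 0, so lifting is evaluation of polynomials without condition.
  f := 0
  X := MvPolynomial.X
  aeval_X i := map_zero _
  adjoin_X n := MvPolynomial.adjoin_range_X
  exists_lift y _ := ⟨MvPolynomial.aeval y, MvPolynomial.aeval_X y⟩
  perm := tauHom _
  pol := pol _
  perm_mul_pol_X w i := by
    rw [pol_X, pol_X]
    exact tau_mul_x w i
  coef := coef MvPolynomial.X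
  coef_perm_mul_pol w q := by
    refine (coef_tau_mul_pol _ w q).trans ?_
    rw [MvPolynomial.aeval_X_left_apply]
  sum_coef {n} r := by
    induction r using KLR.induction with
    | add r r' h h' =>
      conv_rhs => rw [← h, ← h', ← Finset.sum_add_distrib]
      simp only [map_add, Pi.add_apply, mul_add]
    | smul c r h =>
      conv_rhs => rw [← h, Finset.smul_sum]
      simp only [map_smul, Pi.smul_apply, mul_smul_comm]
    | mul w q =>
      rw [coef_tau_mul_pol, MvPolynomial.aeval_X_left_apply]
      exact sum_mul_single _ _ w q
  ι_perm h w := emb_tau_left h w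
  ι_pol_X {m l n} h i := by
    rw [pol_X, pol_X]
    exact emb_x (left_le h) i
  e_eq h := emb_sym h
  perm_mem w := tau_mem w
  Z := Z
  incl {p} := (MvPolynomial.symmetricSubalgebra (Fin p) ℂ).val.toLinearMap
  symm {p} := average (fun σ => MvPolynomial.rename σ) (average_rename_apply p)
    (MvPolynomial.symmetricSubalgebra (Fin p) ℂ) fun _ => Iff.rfl
  symm_incl z := average_val _ _ _ _ z
  incl_symm {p} φ hφ q := by
    refine (val_average _ (average_rename_apply p) (MvPolynomial.symmetricSubalgebra (Fin p) ℂ)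
      (fun _ => Iff.rfl) q).trans ?_
    congr 1
    refine Finset.sum_congr rfl fun σ _ => ?_
    refine AlgHom.congr_fun (φ₂ := φ σ) (MvPolynomial.algHom_ext fun i => ?_) q
    rw [hφ, MvPolynomial.rename_X]
  pol_mem {p n} j φ hφ d z hz :=
    map_polyDeg_mem (deg n) ((pol n).comp φ) (fun i => by
      rw [AlgHom.comp_apply, hφ, pol_X]
      exact x_mem _) hz

end KLR

/-! ### The cyclotomic tower -/

namespace CycKLR

variable (a : ℕ)

/-- The element τ of the transposition exchanging the strand i with the first one conjugates x_i to
x_1, so the single relation x_1^a = 0 spreads to all dots. -/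
theorem proj_x_pow {n : ℕ} (i : Fin n) : proj a n (KLR.x i) ^ a = 0 := by
  have hn : 0 < n := i.pos
  have key : ∀ b : ℕ, proj a n (KLR.tau (Equiv.swap i ⟨0, hn⟩)) * proj a n (KLR.x i) ^ b =
      proj a n (KLR.x ⟨0, hn⟩) ^ b * proj a n (KLR.tau (Equiv.swap i ⟨0, hn⟩)) := by
    intro b
    rw [← map_pow, ← map_pow, ← map_mul, ← map_mul]
    congr 1
    have : SemiconjBy (KLR.tau (Equiv.swap i ⟨0, hn⟩)) (KLR.x i) (KLR.x ⟨0, hn⟩) := by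
      have := KLR.tau_mul_x (Equiv.swap i ⟨0, hn⟩) i
      rwa [Equiv.swap_apply_left] at this
    exact this.pow_right b
  have h := key a
  rw [proj_dot_pow, zero_mul] at h
  have h' := congrArg (proj a n (KLR.tau (Equiv.swap i ⟨0, hn⟩)) * ·) h
  simp only [← mul_assoc, ← map_mul, ← KLR.tau_mul, Equiv.swap_mul_self, KLR.tau_one, map_one,
    one_mul, mul_zero] at h'
  exact h'

/-- The generators of the truncated polynomial algebra. -/
def truncX {n : ℕ} (i : Fin n) : Trunc a n := Ideal.Quotient.mkₐ ℂ _ (MvPolynomial.X i)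

theorem truncX_pow {n : ℕ} (i : Fin n) : truncX a i ^ a = 0 := by
  rw [truncX, ← map_pow]
  exact Ideal.Quotient.eq_zero_iff_mem.2 (Ideal.subset_span ⟨i, rfl⟩)

theorem aeval_truncX {n : ℕ} (f : MvPolynomial (Fin n) ℂ) :
    MvPolynomial.aeval (truncX a) f = Ideal.Quotient.mkₐ ℂ (powIdeal a n) f :=
  AlgHom.congr_fun (MvPolynomial.algHom_ext fun i => by rw [MvPolynomial.aeval_X]; rfl) f

/-- The homomorphism out of the truncated polynomial algebra induced by one out of the polynomial
algebra. -/
def truncLift {n : ℕ} {B : Type*} [Ring B] [Algebra ℂ B] (φ : MvPolynomial (Fin n) ℂ →ₐ[ℂ] B)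
    (hφ : ∀ i, φ (MvPolynomial.X i) ^ a = 0) : Trunc a n →ₐ[ℂ] B :=
  Ideal.Quotient.liftₐ (powIdeal a n) φ (by
    intro f hf
    induction hf using Submodule.span_induction with
    | zero => exact map_zero _
    | add f g _ _ h h' => rw [map_add, h, h', add_zero]
    | smul g f _ h => rw [smul_eq_mul, map_mul, h, mul_zero]
    | mem f hf =>
      obtain ⟨i, rfl⟩ := hf
      simp only [map_pow, hφ])

theorem truncLift_mk {n : ℕ} {B : Type*} [Ring B] [Algebra ℂ B]
    (φ : MvPolynomial (Fin n) ℂ →ₐ[ℂ] B) (hφ : ∀ i, φ (MvPolynomial.X i) ^ a = 0)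
    (f : MvPolynomial (Fin n) ℂ) :
    truncLift a φ hφ (Ideal.Quotient.mkₐ ℂ (powIdeal a n) f) = φ f :=
  rfl

theorem truncLift_X {n : ℕ} {B : Type*} [Ring B] [Algebra ℂ B]
    (φ : MvPolynomial (Fin n) ℂ →ₐ[ℂ] B) (hφ : ∀ i, φ (MvPolynomial.X i) ^ a = 0) (i : Fin n) :
    truncLift a φ hφ (truncX a i) = φ (MvPolynomial.X i) :=
  rfl

/-- The homomorphism from truncated polynomials to the cyclotomic algebra. -/
def pol (n : ℕ) : Trunc a n →ₐ[ℂ] CycKLR a n :=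
  truncLift a ((proj a n).comp (KLR.pol n)) fun i => by
    rw [AlgHom.comp_apply, KLR.pol_X, proj_x_pow]

theorem pol_X {n : ℕ} (i : Fin n) : pol a n (truncX a i) = proj a n (KLR.x i) :=
  (truncLift_X a _ _ i).trans (by rw [AlgHom.comp_apply, KLR.pol_X])

/-- The coefficients of an element of the cyclotomic algebra in the basis of permutations over
truncated polynomials. -/
def coef {n : ℕ} : CycKLR a n →ₗ[ℂ] Equiv.Perm (Fin n) → Trunc a n :=
  LinearMap.applyₗ (Pi.single 1 1) ∘ₗ (lift (a := a) (KLR.rep (truncX a)) fun h => by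
    refine LinearMap.ext fun F => funext fun w => ?_
    -- In the representation over truncated polynomials, x_1^a acts at w by the a-th power of a
    -- variable, which is zero; hence the representation factors through the quotient.
    rw [KLR.rep, KLR.lift_x, KLR.dotOp_pow_apply, truncX_pow, zero_mul]
    rfl).toLinearMap

theorem coef_proj {n : ℕ} (r : KLR n) : coef a (proj a n r) = KLR.coef (truncX a) r :=
  congrArg (LinearMap.applyₗ (Pi.single 1 1)) (lift_proj _ _ r)

theorem coef_tau_mul_pol {n : ℕ} (w : Equiv.Perm (Fin n)) (q : Trunc a n) :
    coef a (proj a n (KLR.tau w) * pol a n q) = Pi.single w q := by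
  obtain ⟨f, rfl⟩ := Ideal.Quotient.mkₐ_surjective ℂ (powIdeal a n) q
  rw [pol, truncLift_mk, AlgHom.comp_apply, ← map_mul, coef_proj, KLR.coef_tau_mul_pol,
    aeval_truncX]

theorem truncPerm_mul (p : ℕ) (σ τ : Equiv.Perm (Fin p)) (q : Trunc a p) :
    truncPerm a p σ (truncPerm a p τ q) = truncPerm a p (σ * τ) q := by
  obtain ⟨f, rfl⟩ := Ideal.Quotient.mkₐ_surjective ℂ (powIdeal a p) q
  exact congrArg (Ideal.Quotient.mkₐ ℂ (powIdeal a p)) (MvPolynomial.rename_rename τ σ f)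

theorem trunc_hom_ext {n : ℕ} {B : Type*} [Semiring B] [Algebra ℂ B] {φ ψ : Trunc a n →ₐ[ℂ] B}
    (h : ∀ i, φ (truncX a i) = ψ (truncX a i)) : φ = ψ :=
  Ideal.Quotient.algHom_ext _ (MvPolynomial.algHom_ext h)

theorem emb_proj {m n : ℕ} (h : m ≤ n) (r : KLR m) :
    emb a m n h (proj a m r) = proj a n (KLR.emb 0 m n (by omega) r) :=
  lift_proj (a := a) ((proj a n).comp (KLR.emb 0 m n (by omega))) _ r

/-- The cyclotomic algebras form a tower of wreath type. -/
def system : WreathSystem where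
  A := CycKLR a
  deg := deg a
  corner := corner a
  Q n := Trunc a n
  f := Polynomial.X ^ a
  X := truncX a
  aeval_X i := by rw [map_pow, Polynomial.aeval_X, truncX_pow]
  adjoin_X n := by
    have h : truncX a (n := n) = Ideal.Quotient.mkₐ ℂ (powIdeal a n) ∘ MvPolynomial.X := rfl
    rw [h, Set.range_comp, ← AlgHom.map_adjoin, MvPolynomial.adjoin_range_X, Algebra.map_top,
      AlgHom.range_eq_top]
    exact Ideal.Quotient.mkₐ_surjective ℂ _
  exists_lift y hy := ⟨truncLift a (MvPolynomial.aeval y) fun i => by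
      have := hy i
      rwa [map_pow, Polynomial.aeval_X, ← MvPolynomial.aeval_X (R := ℂ) y i] at this,
    fun i => (truncLift_X a _ _ i).trans (MvPolynomial.aeval_X y i)⟩
  perm {n} := (proj a n).toMonoidHom.comp (KLR.tauHom n)
  pol {n} := pol a n
  perm_mul_pol_X {n} w i := by
    rw [pol_X, pol_X]
    refine ((proj a n).map_mul _ _).symm.trans (Eq.trans ?_ ((proj a n).map_mul _ _))
    exact congrArg _ (KLR.tau_mul_x w i)
  coef := coef a
  coef_perm_mul_pol w q := coef_tau_mul_pol a w q
  sum_coef {n} r := by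
    obtain ⟨r, rfl⟩ := proj_surjective a n r
    induction r using KLR.induction with
    | add r r' h h' =>
      rw [map_add]
      conv_rhs => rw [← h, ← h', ← Finset.sum_add_distrib]
      simp only [map_add, Pi.add_apply, mul_add]
    | smul c r h =>
      rw [map_smul]
      conv_rhs => rw [← h, Finset.smul_sum]
      simp only [map_smul, Pi.smul_apply, mul_smul_comm]
    | mul w q =>
      rw [coef_proj, KLR.coef_tau_mul_pol, map_mul]
      exact (sum_mul_single _ (pol a n) w _).trans (by rw [aeval_truncX]; rfl)
  ι_perm {m l n} h w := (emb_proj a ((Nat.le_add_right m l).trans h.le) _).trans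
    (congrArg (proj a n) (KLR.emb_tau_left h w))
  ι_pol_X {m l n} h i := by
    rw [pol_X, pol_X]
    exact (emb_proj a ((Nat.le_add_right m l).trans h.le) _).trans (congrArg (proj a n) (KLR.emb_x (left_le h) i))
  e_eq {m l n} h := by
    refine (congrArg (proj a n) (KLR.emb_sym h)).trans ?_
    rw [map_smul, map_sum]
    rfl
  perm_mem w := proj_mem _ _ _ _ (KLR.tau_mem w)
  Z := cycZ a
  incl {p} := (truncInvariants a p).val.toLinearMap
  symm {p} := average (truncPerm a p) (truncPerm_mul a p) (truncInvariants a p) fun _ => Iff.rfl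
  symm_incl z := average_val _ _ _ _ z
  incl_symm {p} φ hφ q := by
    refine (val_average _ (truncPerm_mul a p) (truncInvariants a p) (fun _ => Iff.rfl) q).trans ?_
    congr 1
    refine Finset.sum_congr rfl fun σ _ => ?_
    refine AlgHom.congr_fun (φ₂ := φ σ) (trunc_hom_ext a fun i => ?_) q
    rw [hφ]
    exact congrArg (Ideal.Quotient.mkₐ ℂ (powIdeal a p)) (MvPolynomial.rename_X _ _)
  pol_mem {p n} j φ hφ d z hz := by
    -- A truncated polynomial of degree d has a homogeneous representative f, not necessarily
    -- symmetric, and degrees can be checked on it.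
    obtain ⟨f, hf, hz⟩ := hz
    have := map_polyDeg_mem (deg a n)
      (((pol a n).comp φ).comp (Ideal.Quotient.mkₐ ℂ (powIdeal a p))) (fun i => by
        have : pol a n (φ (truncX a i)) ∈ deg a n 2 := by
          rw [hφ, pol_X]
          exact proj_mem _ _ _ _ (KLR.x_mem _)
        exact this) hf
    exact Eq.subst (motive := fun q => pol a n (φ q) ∈ deg a n d) hz this

end CycKLR

end JordanKLR

end

theorem mainTheorem7 (l t : ℕ) (hl : 1 ≤ l) (ht : 1 ≤ t) :
    (∀ (n k : ℕ) (h : k + l = n + t),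
      Nonempty ((KLR.F.{u} (m := n) (l := t) rfl ⋙ KLR.E.{u} h) ≅
        directSumFunctor fun p : Summand l t n =>
          KLR.E.{u} (m := n - (l - p.1)) (l := l - p.1) (n := n) (by have := p.2; omega) ⋙
            KLR.F.{u} (l := t - p.1) (n := k) (by have := p.2; have := p.1.2; omega) ⋙
              tensorFunctor _ (Z p.1))) ∧
    (∀ (a : ℕ), 1 ≤ a → ∀ (n k : ℕ) (h : k + l = n + t),
      Nonempty ((CycKLR.F.{u} a (m := n) (l := t) rfl ⋙ CycKLR.E.{u} a h) ≅
        directSumFunctor fun p : Summand l t n =>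
          CycKLR.E.{u} a (m := n - (l - p.1)) (l := l - p.1) (n := n) (by have := p.2; omega) ⋙
            CycKLR.F.{u} a (l := t - p.1) (n := k) (by have := p.2; have := p.1.2; omega) ⋙
              tensorFunctor _ (cycZ a p.1))) :=
  -- By definition F and E are induction and restriction along the corners of the two towers, so
  -- both statements are instances of one theorem.
  ⟨fun n k h => KLR.system.nonempty_iso l t n k h,
    fun a _ n k h => (CycKLR.system a).nonempty_iso l t n k h⟩
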